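/- Let $d_X,d_Y,d_Z\ge 1$ and let $(\boldsymbol X,\boldsymbol Y,\boldsymbol Z)$ be a random vector in $\mathbb R^{d_X}\times\mathbb R^{d_Y}\times\mathbb R^{d_Z}$ with joint Lebesgue density $p_{\boldsymbol X,\boldsymbol Y,\boldsymbol Z}$; marginal densities are denoted $p_{\boldsymbol X,\boldsymbol Z}$, $p_{\boldsymbol Z}$, etc., and $p(\boldsymbol x|\boldsymbol z)=p_{\boldsymbol X,\boldsymbol Z}(\boldsymbol x,\boldsymbol z)/p_{\boldsymbol Z}(\boldsymbol z)$ is the conditional density of $\boldsymbol X$ given $\boldsymbol Z=\boldsymbol z$. All norms are Euclidean. **Statistic.** For probability measures $P,Q$ on $\mathbb R^{d_X}$ let $$\Theta^2(P,Q)=\iint \big(P(\bar B(u,\|v-u\|))-Q(\bar B(u,\|v-u\|))\big)^2\{dP(u)\,dP(v)+dQ(u)\,dQ(v)\},$$ where $\bar B(u,\varepsilon)$ is the closed ball. Let $K_1,K_2$ be kernels, $h_1=h_1(n)>0$, $h_2=h_2(n)>0$ bandwidths, and $a:\mathbb R^{d_Y}\times\mathbb R^{d_Z}\to[0,\infty)$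 a bounded measurable function that is positive wherever $p_{\boldsymbol Y,\boldsymbol Z}>0$. For a data set $\mathcal D=\{(\boldsymbol X_i,\boldsymbol Y_i,\boldsymbol Z_i)\}_{i=1}^n$ put $$\tilde P_{\boldsymbol X|\boldsymbol y,\boldsymbol z}=\frac{\sum_{i}K_1\big(\|(\boldsymbol y,\boldsymbol z)-(\boldsymbol Y_i,\boldsymbol Z_i)\|/h_1\big)\,\delta_{\boldsymbol X_i}}{\sum_{i}K_1\big(\|(\boldsymbol y,\boldsymbol z)-(\boldsymbol Y_i,\boldsymbol Z_i)\|/h_1\big)},\qquad \tilde P_{\boldsymbol X|\boldsymbol z}=\frac{\sum_{i}K_2\big(\|\boldsymbol z-\boldsymbol Z_i\|/h_2\big)\,\delta_{\boldsymbol X_i}}{\sum_{i}K_2\big(\|\boldsymbol z-\boldsymbol Z_i\|/h_2\big)}$$ (with $0/0=0$) and $$\hat\zeta_n(\mathcal D)=\frac1n\sum_{s=1}^n\Theta^2\big(\tilde P_{\boldsymbol X|\boldsymbol Y_s,\boldsymbol Z_s},\tilde P_{\boldsymbol X|\boldsymbol Z_s}\big)\,a(\boldsymbol Y_s,\boldsymbol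 Z_s).$$ **Assumptions.** A density $f(\boldsymbol x,\boldsymbol v)$ is called nice with respect to $\boldsymbol v$ if, for every $\boldsymbol v$ and almost every $\boldsymbol x$ with $f(\boldsymbol x,\boldsymbol v)\neq0$, $f(\boldsymbol x,\cdot)$ is differentiable at $\boldsymbol v$, and for every sequence $\delta_n\to0$, $\delta_n\ne0$, the quantity $\sup_{\|\boldsymbol u\|=1}\limsup_n\int R_n(\boldsymbol x,\boldsymbol v;\boldsymbol u)^2f(\boldsymbol x,\boldsymbol v)\,d\boldsymbol x$ is bounded uniformly in $\boldsymbol v$, where $$R_n(\boldsymbol x,\boldsymbol v;\boldsymbol u)=\frac1{\delta_n^2}\Big\{\frac{f(\boldsymbol x,\boldsymbol v+\delta_n\boldsymbol u)}{f(\boldsymbol x,\boldsymbol v)}-1-\delta_n\frac{\partial_{\boldsymbol v}f(\boldsymbol x,\boldsymbol v)}{f(\boldsymbol x,\boldsymbol v)}\boldsymbol u^\top\Big\}$$ (points with $f(\boldsymbol x,\boldsymbol v)=0$ do not contribute to the integral). 1. $p_{\boldsymbol X,\boldsymbol Z}$ is nice with respect to $\boldsymbol Z$, $p_{\boldsymbol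 X,\boldsymbol Y,\boldsymbol Z}$ is nice with respect to $(\boldsymbol Y,\boldsymbol Z)$, and $p_{\boldsymbol X,\boldsymbol Y,\boldsymbol Z}$ and all its marginals are uniformly bounded. 2. Each of $K=K_1$ (with $d=d_Y+d_Z$) and $K=K_2$ (with $d=d_Z$) is measurable, bounded, non-negative, symmetric about $0$ and compactly supported, with $\int_{\mathbb R^d}K(\|\boldsymbol u\|)\,d\boldsymbol u=1$ and $\int_{\mathbb R^d}\boldsymbol u^\top\boldsymbol u\,K(\|\boldsymbol u\|)\,d\boldsymbol u=\tau\boldsymbol I_d$ (row vectors $\boldsymbol u$) for some $\tau>0$. (The case $K_1=K_2$ is included.) 3. With $d_1=d_Y+d_Z$ and $d_2=d_Z$: $h_1^{d_1}/h_2^{d_2}\to0$, $nh_i^{d_i}\to\infty$ and $nh_i^{d_i+4}\to0$ for $i=1,2$, as $n\to\infty$. **Conditional permutation test.** Let $(\boldsymbol X_i,\boldsymbol Y_i,\boldsymbol Z_i)$, $i\ge1$, be i.i.d. copies of $(\boldsymbol X,\boldsymbol Y,\boldsymbol Z)$ and $\mathcal D_0=\{(\boldsymbol X_i,\boldsymbol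 Y_i,\boldsymbol Z_i)\}_{i=1}^n$. Given $\mathcal D_0$, draw permutations $\pi_1,\dots,\pi_M$ of $\{1,\dots,n\}$ independently from $$\mathbb P(\Pi=\pi\mid\mathcal D_0)=\frac{\prod_{\ell=1}^np(\boldsymbol X_{\pi(\ell)}|\boldsymbol Z_\ell)}{\sum_{\pi'\in S_n}\prod_{\ell=1}^np(\boldsymbol X_{\pi'(\ell)}|\boldsymbol Z_\ell)},$$ let $\mathcal D^{\pi_j}=\{(\boldsymbol X_{\pi_j(i)},\boldsymbol Y_i,\boldsymbol Z_i)\}_{i=1}^n$, and $$p_{CPT}=\frac{1+\sum_{j=1}^M\mathbf 1\{\hat\zeta_n(\mathcal D^{\pi_j})\ge\hat\zeta_n(\mathcal D_0)\}}{1+M}.$$ Fix $\alpha\in(0,1)$ and let $\phi_{CPT}=\mathbf 1\{p_{CPT}<\alpha\}$. **Proposition.** Under assumptions 1–3: * if $\boldsymbol X\perp\!\!\!\perp\boldsymbol Y\mid\boldsymbol Z$ (hypothesis $H_0$), then $\mathbb P(\phi_{CPT}=1)\le\alpha$ for every $n$ and every $M$; * if $\boldsymbol X\not\perp\!\!\!\perp\boldsymbol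 Y\mid\boldsymbol Z$ (hypothesis $H_1$) and $M>(1-\alpha)/\alpha$ is fixed, then $\lim_{n\to\infty}\mathbb P(\phi_{CPT}=1)=1$. -/

import Mathlib

open MeasureTheory ProbabilityTheory Filter Topology
open scoped ENNReal NNReal

noncomputable section

/-- `ℝ^d` with the Euclidean norm. -/
abbrev Rd (d : ℕ) : Type := EuclideanSpace ℝ (Fin d)

/-- The Euclidean space `ℝ^{dY} × ℝ^{dZ} = ℝ^{dY + dZ}` of pairs `(y, z)`, with norm
`√(‖y‖² + ‖z‖²)`. -/
abbrev RdPair (dY dZ : ℕ) : Type := WithLp 2 (Rd dY × Rd dZ)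

/-! ### Ball divergence -/

section BallDivergence

variable {E : Type*} [PseudoMetricSpace E] [MeasurableSpace E]

/-- The ball divergence
`∬ (P - Q)²(B̄(u, ρ(v, u))) {dP(u) dP(v) + dQ(u) dQ(v)}`. -/
def ballDivergence (P Q : Measure E) : ℝ :=
  (∫ v, ∫ u, (P.real (Metric.closedBall u (dist v u)) -
      Q.real (Metric.closedBall u (dist v u))) ^ 2 ∂P ∂P) +
  (∫ v, ∫ u, (P.real (Metric.closedBall u (dist v u)) -
      Q.real (Metric.closedBall u (dist v u))) ^ 2 ∂Q ∂Q)

/-- The discrete measure `A ↦ (∑ i, W i * 1{X i ∈ A}) / ∑ i, W i`. -/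
def weightedEmpirical {n : ℕ} (X : Fin n → E) (W : Fin n → ℝ) : Measure E :=
  ∑ i, ENNReal.ofReal (W i / ∑ k, W k) • Measure.dirac (X i)

end BallDivergence

/-! ### The estimate of the conditional ball divergence -/

/-- A data set of size `n`: the `i`-th observation is `(X_i, Y_i, Z_i)`. -/
abbrev Sample (dX dY dZ n : ℕ) : Type := Fin n → Rd dX × Rd dY × Rd dZ

section Estimate

variable {dX dY dZ n : ℕ}

/-- The kernel estimate of the law of `X` given `(Y, Z) = (y, z)`, with bandwidth `h`. -/
def estCondYZ (K : ℝ → ℝ) (h : ℝ) (D : Sample dX dY dZ n) (y : Rd dY) (z : Rd dZ) :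
    Measure (Rd dX) :=
  weightedEmpirical (fun i => (D i).1)
    (fun i => K (‖(WithLp.toLp 2 (y, z) - WithLp.toLp 2 (D i).2 : RdPair dY dZ)‖ / h))

/-- The kernel estimate of the law of `X` given `Z = z`, with bandwidth `h`. -/
def estCondZ (K : ℝ → ℝ) (h : ℝ) (D : Sample dX dY dZ n) (z : Rd dZ) : Measure (Rd dX) :=
  weightedEmpirical (fun i => (D i).1) (fun i => K (‖z - (D i).2.2‖ / h))

/-- The estimate
`(1/n) ∑ s, Θ²(P̃_{X | Y_s, Z_s}, P̃_{X | Z_s}) a(Y_s, Z_s)` of the conditional ball divergence. -/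
def cbdEstimate (K₁ K₂ : ℝ → ℝ) (h₁ h₂ : ℝ) (a : Rd dY → Rd dZ → ℝ)
    (D : Sample dX dY dZ n) : ℝ :=
  (1 / (n : ℝ)) * ∑ s, ballDivergence (estCondYZ K₁ h₁ D (D s).2.1 (D s).2.2)
    (estCondZ K₂ h₂ D (D s).2.2) * a (D s).2.1 (D s).2.2

end Estimate

/-! ### Marginal densities of a joint density `p` of `(X, Y, Z)` -/

section Density

variable {dX dY dZ : ℕ}

def margXY (p : Rd dX → Rd dY → Rd dZ → ℝ) (x : Rd dX) (y : Rd dY) : ℝ≥0∞ :=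
  ∫⁻ z, ENNReal.ofReal (p x y z)

def margXZ (p : Rd dX → Rd dY → Rd dZ → ℝ) (x : Rd dX) (z : Rd dZ) : ℝ≥0∞ :=
  ∫⁻ y, ENNReal.ofReal (p x y z)

def margYZ (p : Rd dX → Rd dY → Rd dZ → ℝ) (y : Rd dY) (z : Rd dZ) : ℝ≥0∞ :=
  ∫⁻ x, ENNReal.ofReal (p x y z)

def margX (p : Rd dX → Rd dY → Rd dZ → ℝ) (x : Rd dX) : ℝ≥0∞ :=
  ∫⁻ y, ∫⁻ z, ENNReal.ofReal (p x y z)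

def margY (p : Rd dX → Rd dY → Rd dZ → ℝ) (y : Rd dY) : ℝ≥0∞ :=
  ∫⁻ x, ∫⁻ z, ENNReal.ofReal (p x y z)

def margZ (p : Rd dX → Rd dY → Rd dZ → ℝ) (z : Rd dZ) : ℝ≥0∞ :=
  ∫⁻ x, ∫⁻ y, ENNReal.ofReal (p x y z)

/-- The conditional density `p(x | z) = p_{X,Z}(x, z) / p_Z(z)`. -/
def condDensity (p : Rd dX → Rd dY → Rd dZ → ℝ) (x : Rd dX) (z : Rd dZ) : ℝ :=
  (margXZ p x z).toReal / (margZ p z).toReal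

end Density

/-! ### The assumptions on the density, the kernels and the bandwidths -/

section Assumptions

/-- The second order relative remainder
`δ⁻² { f(x, y + δ u) / f(x, y) - 1 - δ (∂_y f(x, y) / f(x, y)) u }`. -/
def niceRemainder {E F : Type*} [NormedAddCommGroup F] [NormedSpace ℝ F]
    (f : E → F → ℝ) (δ : ℝ) (x : E) (y u : F) : ℝ :=
  (1 / δ ^ 2) * (f x (y + δ • u) / f x y - 1 - δ * (fderiv ℝ (f x) y u / f x y))

/-- `f` is nice with respect to its second variable: for every sequence `δ n → 0` (of nonzero
numbers), `sup_{‖u‖ = 1} limsup_n ∫ R_n(x, y; u)² f(x, y) dx` is bounded uniformly in `y`.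
The points `x` with `f(x, y) = 0`, where the remainder has no meaning, do not contribute to the
integral with respect to `f(x, y) dx`. -/
def IsNice {E F : Type*} [MeasureSpace E] [NormedAddCommGroup F] [NormedSpace ℝ F]
    (f : E → F → ℝ) : Prop :=
  (∀ y, ∀ᵐ x, f x y ≠ 0 → DifferentiableAt ℝ (f x) y) ∧
  ∀ δ : ℕ → ℝ, (∀ n, δ n ≠ 0) → Tendsto δ atTop (𝓝 0) →
    ∃ C : ℝ≥0, ∀ y u : F, ‖u‖ = 1 →
      limsup (fun n => ∫⁻ x, ENNReal.ofReal (niceRemainder f (δ n) x y u ^ 2 * f x y)) atTop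
        ≤ (C : ℝ≥0∞)

/-- The joint densities of `(X, Z)` and `(X, Y, Z)` are nice with respect to `Z` and `(Y, Z)`, and
the joint density of `(X, Y, Z)` and all its marginals are uniformly bounded. -/
structure DensityAssumption {dX dY dZ : ℕ} (p : Rd dX → Rd dY → Rd dZ → ℝ) : Prop where
  nice_XZ : IsNice (fun (x : Rd dX) (z : Rd dZ) => (margXZ p x z).toReal)
  nice_XYZ : IsNice (fun (x : Rd dX) (v : RdPair dY dZ) => p x v.fst v.snd)
  bounded : ∃ C : ℝ≥0, (∀ x y z, p x y z ≤ (C : ℝ)) ∧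
    (∀ x y, margXY p x y ≤ C) ∧ (∀ x z, margXZ p x z ≤ C) ∧ (∀ y z, margYZ p y z ≤ C) ∧
    (∀ x, margX p x ≤ C) ∧ (∀ y, margY p y ≤ C) ∧ (∀ z, margZ p z ≤ C)

/-- The assumptions on a kernel `K`, used on `ℝ^d` through `u ↦ K(‖u‖)`. -/
structure KernelAssumption (d : ℕ) (K : ℝ → ℝ) : Prop where
  measurable : Measurable K
  nonneg : ∀ r, 0 ≤ K r
  bounded : ∃ C, ∀ r, K r ≤ C
  symm : ∀ r, K (-r) = K r
  compact_support : HasCompactSupport K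
  integral_eq_one : ∫ u : Rd d, K ‖u‖ = 1
  second_moment : ∃ τ : ℝ, 0 < τ ∧ ∀ i j : Fin d,
    ∫ u : Rd d, u i * u j * K ‖u‖ = if i = j then τ else 0

/-- The assumptions on the bandwidth sequences; here `d₁ = dY + dZ` and `d₂ = dZ`. -/
structure BandwidthAssumption (d₁ d₂ : ℕ) (h₁ h₂ : ℕ → ℝ) : Prop where
  pos₁ : ∀ n, 0 < h₁ n
  pos₂ : ∀ n, 0 < h₂ n
  ratio : Tendsto (fun n => h₁ n ^ d₁ / h₂ n ^ d₂) atTop (𝓝 0)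
  large₁ : Tendsto (fun n : ℕ => (n : ℝ) * h₁ n ^ d₁) atTop atTop
  large₂ : Tendsto (fun n : ℕ => (n : ℝ) * h₂ n ^ d₂) atTop atTop
  small₁ : Tendsto (fun n : ℕ => (n : ℝ) * h₁ n ^ (d₁ + 4)) atTop (𝓝 0)
  small₂ : Tendsto (fun n : ℕ => (n : ℝ) * h₂ n ^ (d₂ + 4)) atTop (𝓝 0)

/-- The weight function is measurable, non-negative, bounded, and positive wherever the density
of `(Y, Z)` is positive. -/
structure WeightAssumption {dX dY dZ : ℕ} (p : Rd dX → Rd dY → Rd dZ → ℝ)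
    (a : Rd dY → Rd dZ → ℝ) : Prop where
  measurable : Measurable (Function.uncurry a)
  nonneg : ∀ y z, 0 ≤ a y z
  bounded : ∃ C, ∀ y z, a y z ≤ C
  pos : ∀ y z, margYZ p y z ≠ 0 → 0 < a y z

end Assumptions

/-! ### The null hypothesis -/

/-- `X` and `Y` are conditionally independent given `Z`, for `(X, Y, Z)` with law `P`. -/
def CondIndepXYgivenZ {dX dY dZ : ℕ} (P : Measure (Rd dX × Rd dY × Rd dZ))
    [IsFiniteMeasure P] : Prop :=
  CondIndepFun
    (MeasurableSpace.comap (fun w : Rd dX × Rd dY × Rd dZ => w.2.2) inferInstance)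
    (Measurable.comap_le (measurable_snd.comp measurable_snd))
    (fun w : Rd dX × Rd dY × Rd dZ => w.1) (fun w : Rd dX × Rd dY × Rd dZ => w.2.1) P

/-! ### The conditional permutation test -/

section CPT

variable {dX dY dZ n : ℕ}

/-- The probability of the permutation `π` given the data, that is,
`∏ ℓ, p(X_{π(ℓ)} | Z_ℓ) / ∑ π', ∏ ℓ, p(X_{π'(ℓ)} | Z_ℓ)`. -/
def cptProb (p : Rd dX → Rd dY → Rd dZ → ℝ) (D : Sample dX dY dZ n)
    (π : Equiv.Perm (Fin n)) : ℝ :=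
  (∏ l, condDensity p (D (π l)).1 (D l).2.2) /
    ∑ π' : Equiv.Perm (Fin n), ∏ l, condDensity p (D (π' l)).1 (D l).2.2

/-- The resampled data set `(X_{π(i)}, Y_i, Z_i)`, `i = 1, …, n`. -/
def permuteX (π : Equiv.Perm (Fin n)) (D : Sample dX dY dZ n) : Sample dX dY dZ n :=
  fun i => ((D (π i)).1, (D i).2)

open Classical in
/-- The `p`-value `(1 + ∑ j, 1{T(D^{π_j}) ≥ T(D)}) / (1 + M)` of the statistic `T`. -/
def cptPValue {M : ℕ} (T : Sample dX dY dZ n → ℝ) (D : Sample dX dY dZ n)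
    (π : Fin M → Equiv.Perm (Fin n)) : ℝ :=
  (1 + ∑ j, if T (permuteX (π j) D) ≥ T D then (1 : ℝ) else 0) / (1 + (M : ℝ))

/-- The first `n` observations of a sequence of observations. -/
def firstObs {Ω : Type*} (W : ℕ → Ω → Rd dX × Rd dY × Rd dZ) (n : ℕ) (ω : Ω) :
    Sample dX dY dZ n :=
  fun i => W i ω

/-- For each sample size `n`, given the data the `M` random permutations `π n 0, …, π n (M - 1)` are
independent with law `cptProb`. -/
structure IsCPTDraw {Ω : Type*} [MeasurableSpace Ω] (μ : Measure Ω)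
    (p : Rd dX → Rd dY → Rd dZ → ℝ) (W : ℕ → Ω → Rd dX × Rd dY × Rd dZ) (M : ℕ)
    (π : (n : ℕ) → Fin M → Ω → Equiv.Perm (Fin n)) : Prop where
  measurable : ∀ n j σ, MeasurableSet {ω | π n j ω = σ}
  cond_law : ∀ (n : ℕ) (σ : Fin M → Equiv.Perm (Fin n)),
    μ⟦{ω | ∀ j, π n j ω = σ j} | MeasurableSpace.comap (firstObs W n) inferInstance⟧ =ᵐ[μ]
      fun ω => ∏ j, cptProb p (firstObs W n ω) (σ j)

/-- The event that the conditional permutation test, based on the estimate of the conditional ball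
divergence from `n` observations, rejects: its `p`-value is smaller than `α`. -/
def cptRejects {Ω : Type*} (K₁ K₂ : ℝ → ℝ) (h₁ h₂ : ℕ → ℝ) (a : Rd dY → Rd dZ → ℝ) (α : ℝ)
    (W : ℕ → Ω → Rd dX × Rd dY × Rd dZ) {M : ℕ}
    (π : (n : ℕ) → Fin M → Ω → Equiv.Perm (Fin n)) (n : ℕ) : Set Ω :=
  {ω | cptPValue (cbdEstimate K₁ K₂ (h₁ n) (h₂ n) a) (firstObs W n ω) (fun j => π n j ω) < α}

end CPT

end

/-! Level. Under conditional independence the sample has density `∏ l, p(X_l | Z_l)` with respect to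
a product measure that does not change when the `X` parts are permuted. Hence redrawing the
permutation from `cptProb` leaves the law of the sample invariant
(`lintegral_sum_cptProb_permuteX`). After such a redraw, the data and their `M` permuted versions
are, given the orbit, `M + 1` independent draws from one law. The p-value is the normalised rank of
one of them, and at most `α (M + 1)` of `M + 1` numbers can have rank below `α (M + 1)`
(`sum_prod_rank_lt_le`). Ties only make the test more conservative.

Power. Since `1 / (1 + M) < α`, the test rejects as soon as the statistic exceeds all `M` permuted
ones. So it suffices that the permuted statistic tends to zero in mean, while the statistic itself
stays above a fixed `c > 0` with probability tending to one.

The permuted statistic. The kernel weights depend on `(Y, Z)` only, so a permutation relabels the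
points that carry two fixed systems of weights `w` and `v`. Write the difference of the masses of a
ball as `∑ i, ∑ j, w i * v j * (1_i - 1_j)`. Transposing `i` and `j` flips the sign of the bracket
and changes the mass difference by little, so the mean square is controlled by how far the
permutation law is from being invariant under the transposition (`sum_mul_ballSum_le`). This
distance is at most twice a mean, over the permuted data, of the positive part of one minus a
likelihood ratio (`swapDist_cptProb_le`). Only `(X, Z)` enters here, and the law of `(X, Z)` is the
same as under `condProduct`, where the resampling is invariant; so the permuted data can be replaced
by the data even without conditional independence (`lintegral_le_of_le_sum_cptProb`). What remains
is the integral of `|F(x, z) F(x', z') - F(x', z) F(x, z')|` for `F = p_{X,Z}` and `z`, `z'` within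
a bandwidth of a common point, which vanishes by continuity of translations in `L¹`. The weights `w`
also involve `Y`; it is integrated out where `p_{X,Z} ≥ η`, because there `p ≤ (C / η) p_{X,Z}`, and
the complement has small probability.

The statistic under dependence. Kernel estimates of the densities of `(Y, Z)` and of `Z` on an event
`X ∈ A` are consistent at the observations: the bias is an `L¹` modulus of continuity and the
fluctuation is a variance (`lintegral_kernelAverage_sub_le`). If the conditional laws of `X` given
`(Y, Z)` and given `Z` differ, Besicovitch differentiation supplies a ball, with centre and a
boundary point in the support, on which they differ (`measure_eq_of_closedBall_eq`). The difference
survives small changes of centre and boundary point, so countably many configurations of balls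
suffice, and one of them works with positive probability (`exists_measure_gapSet_ne_zero`). At such
observations the ball divergence is at least the product of the masses of two small balls and a
squared gap (`mul_sq_le_ballSum`). -/

noncomputable section

/-! ### Product measures -/

section PiMeasure

variable {ι : Type*} [Fintype ι] {S : ι → Type*} [∀ i, MeasurableSpace (S i)]

/-- Resampling one coordinate does not change the integral with respect to a product of
probability measures. -/
theorem lintegral_pi_update [DecidableEq ι] (μ : ∀ i, Measure (S i))
    [∀ i, IsProbabilityMeasure (μ i)] (i : ι)
    {f : (∀ i, S i) → ℝ≥0∞} (hf : Measurable f) :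
    ∫⁻ x, f x ∂Measure.pi μ = ∫⁻ x, ∫⁻ y, f (Function.update x i y) ∂μ i ∂Measure.pi μ := by
  refine lintegral_eq_of_lmarginal_eq {i} hf ?_ ?_
  · simpa only [lmarginal_singleton] using hf.lmarginal μ (s := {i})
  · rw [lmarginal_singleton, lmarginal_singleton]
    ext x
    simp

/-- Tonelli with the coordinates integrated out one at a time; the induction keeps the factors that
are not yet integrated as functions of the point. -/
theorem lintegral_pi_prod [DecidableEq ι] (μ : ∀ i, Measure (S i)) [∀ i, SigmaFinite (μ i)]
    {f : ∀ i, S i → ℝ≥0∞} (hf : ∀ i, Measurable (f i)) :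
    ∫⁻ x, ∏ i, f i (x i) ∂Measure.pi μ = ∏ i, ∫⁻ y, f i y ∂μ i := by
  have hprod : Measurable fun x : ∀ i, S i => ∏ i, f i (x i) :=
    Finset.measurable_prod _ fun i _ => (hf i).comp (measurable_pi_apply i)
  have key : ∀ t : Finset ι, (∫⋯∫⁻_t, (fun x => ∏ i, f i (x i)) ∂μ) =
      fun x => (∏ i ∈ t, ∫⁻ y, f i y ∂μ i) * ∏ i ∈ tᶜ, f i (x i) := by
    intro t
    induction t using Finset.induction with
    | empty => ext x; simp
    | insert i t hi ih =>
      ext x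
      rw [lmarginal_insert _ hprod hi, ih, Finset.prod_insert hi]
      have hc : (tᶜ : Finset ι) = insert i (insert i t)ᶜ := by
        ext j; by_cases h : j = i <;> simp [h, hi]
      have h1 : ∀ y, ∏ j ∈ tᶜ, f j (Function.update x i y j) =
          f i y * ∏ j ∈ (insert i t)ᶜ, f j (x j) := by
        intro y
        rw [hc, Finset.prod_insert (by simp)]
        congr 1
        · simp
        · refine Finset.prod_congr rfl fun j hj => ?_
          have : j ≠ i := by rintro rfl; simp at hj
          simp [this]
      simp_rw [h1]
      rw [lintegral_const_mul _ ((hf i).mul_const _), lintegral_mul_const _ (hf i)]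
      ring
  rcases isEmpty_or_nonempty (∀ i, S i) with h | ⟨⟨x⟩⟩
  · obtain ⟨i, hi⟩ : ∃ i, IsEmpty (S i) := by
      by_contra! hcon
      exact h.elim fun i => Classical.choice (hcon i)
    rw [lintegral_of_isEmpty, eq_comm, Finset.prod_eq_zero (Finset.mem_univ i)]
    exact lintegral_of_isEmpty _ _
  · rw [lintegral_eq_lmarginal_univ x, key]
    simp

/-- It is enough to compare boxes, and the indicator of a box times the product density is again a
product of functions of one coordinate. -/
theorem pi_withDensity [DecidableEq ι] (μ : ∀ i, Measure (S i)) [∀ i, SigmaFinite (μ i)]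
    {f : ∀ i, S i → ℝ≥0∞} (hf : ∀ i, Measurable (f i))
    [∀ i, SigmaFinite ((μ i).withDensity (f i))] :
    Measure.pi (fun i => (μ i).withDensity (f i)) =
      (Measure.pi μ).withDensity fun x => ∏ i, f i (x i) := by
  refine Measure.pi_eq fun s hs => ?_
  rw [withDensity_apply _ (MeasurableSet.univ_pi hs), ← lintegral_indicator (.univ_pi hs)]
  have : ∀ x : ∀ i, S i, (Set.univ.pi s).indicator (fun x => ∏ i, f i (x i)) x =
      ∏ i, (s i).indicator (f i) (x i) := by
    intro x
    by_cases hx : x ∈ Set.univ.pi s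
    · rw [Set.indicator_of_mem hx]
      exact Finset.prod_congr rfl fun i _ => (Set.indicator_of_mem (hx i trivial) _).symm
    · rw [Set.indicator_of_notMem hx]
      simp only [Set.mem_pi, Set.mem_univ, true_implies, not_forall] at hx
      obtain ⟨i, hi⟩ := hx
      exact (Finset.prod_eq_zero (Finset.mem_univ i) (Set.indicator_of_notMem hi _)).symm
  simp_rw [this]
  rw [lintegral_pi_prod μ fun i => (hf i).indicator (hs i)]
  refine Finset.prod_congr rfl fun i _ => ?_
  rw [withDensity_apply _ (hs i), lintegral_indicator (hs i)]

end PiMeasure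

/-! ### Finite measures that agree on balls -/

/-- Two finite measures of the same mass agree, if the first has no atoms and they agree on all
closed balls with centre and a boundary point in the support of the first. -/
theorem measure_eq_of_closedBall_eq {d : ℕ} (F G : Measure (Rd d)) [IsFiniteMeasure F]
    [IsFiniteMeasure G] (hat : ∀ x, F {x} = 0) (hmass : F Set.univ = G Set.univ)
    (h : ∀ u ∈ F.support, ∀ v ∈ F.support,
      F (Metric.closedBall u (dist v u)) = G (Metric.closedBall u (dist v u))) : F = G := by
  -- By Besicovitch differentiation the ratio of `G` to `F` on small closed balls about `x` tends to
  -- the density, for `F`-almost every `x`. As `x` is not an atom, arbitrarily near it there are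
  -- support points `v ≠ x`, and at the radii `dist v x` the ratio is one.
  have h1 : ∀ᵐ x ∂F, G.rnDeriv F x = 1 := by
    filter_upwards [Besicovitch.ae_tendsto_rnDeriv G F, Measure.support_mem_ae (μ := F)]
      with x hx hxs
    refine tendsto_nhds_unique_of_frequently_eq hx tendsto_const_nhds ?_
    rw [frequently_nhdsWithin_iff, Metric.nhds_basis_ball.frequently_iff]
    intro ε hε
    have hpos : 0 < F (Metric.ball x ε \ {x}) := by
      rw [measure_sdiff_null (hat x)]
      exact (Measure.mem_support_iff_forall x).1 hxs _ (Metric.ball_mem_nhds x hε)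
    obtain ⟨v, hv, hvs⟩ := Measure.nonempty_inter_support_of_pos hpos
    have hd : 0 < dist v x := dist_pos.2 hv.2
    refine ⟨dist v x, ?_, ?_, hd⟩
    · simpa [abs_of_pos hd] using hv.1
    · have hb : 0 < F (Metric.closedBall x (dist v x)) :=
        (Measure.mem_support_iff_forall x).1 hxs _ (Metric.closedBall_mem_nhds x hd)
      rw [← h x hxs v hvs, ENNReal.div_self hb.ne' (measure_ne_top _ _)]
  -- The absolutely continuous part of `G` is all of `F`; equal masses then leave no room for a
  -- singular part.
  have hle : F ≤ G := by
    calc F = F.withDensity 1 := by simp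
      _ = F.withDensity (G.rnDeriv F) := (withDensity_congr_ae h1).symm
      _ ≤ G := Measure.withDensity_rnDeriv_le G F
  exact Measure.eq_of_le_of_measure_univ_eq hle hmass

/-! ### Continuity of translations in `L¹` -/

/-- The integral is the distance in `L¹` between a class and its translate, and translations act
continuously on `L¹`. -/
theorem tendsto_lintegral_enorm_translate_sub {V : Type*} [NormedAddCommGroup V]
    [MeasurableSpace V] [BorelSpace V] [SecondCountableTopology V] [LocallyCompactSpace V]
    (μ : Measure V) [μ.IsAddHaarMeasure] [μ.InnerRegularCompactLTTop]
    {f : V → ℝ} (hf : Integrable f μ) :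
    Tendsto (fun u => ∫⁻ v, ‖f (u + v) - f v‖ₑ ∂μ) (𝓝 0) (𝓝 0) := by
  have hmem : MemLp f 1 μ := memLp_one_iff_integrable.2 hf
  have : Fact ((1 : ℝ≥0∞) ≠ ∞) := ⟨by simp⟩
  let F : Lp ℝ 1 μ := hmem.toLp f
  have hc : Tendsto (fun u : V => DomAddAct.mk u +ᵥ F) (𝓝 0) (𝓝 (DomAddAct.mk (0 : V) +ᵥ F)) := by
    have : Continuous fun u : V => DomAddAct.mk u +ᵥ F := by
      have h1 : Continuous fun u : V => DomAddAct.mk u := DomAddAct.continuous_mk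
      exact (continuous_vadd (M := Vᵈᵃᵃ) (X := Lp ℝ 1 μ)).comp (h1.prodMk continuous_const)
    exact this.tendsto 0
  have h0 : DomAddAct.mk (0 : V) +ᵥ F = F := by
    have : DomAddAct.mk (0 : V) = 0 := rfl
    rw [this, zero_vadd]
  rw [h0, tendsto_iff_edist_tendsto_0] at hc
  refine hc.congr fun u => ?_
  rw [show DomAddAct.mk u +ᵥ F = _ from DomAddAct.mk_vadd_toLp u hmem, Lp.edist_toLp_toLp,
    eLpNorm_one_eq_lintegral_enorm]
  rfl

/-! ### Measurability of the marginal densities -/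

section MarginalMeasurability

variable {dX dY dZ : ℕ} {p : Rd dX → Rd dY → Rd dZ → ℝ}

theorem measurable_margXZ (hp : Measurable fun w : Rd dX × Rd dY × Rd dZ => p w.1 w.2.1 w.2.2) :
    Measurable fun w : Rd dX × Rd dZ => margXZ p w.1 w.2 :=
  Measurable.lintegral_prod_right'
    (f := fun q : (Rd dX × Rd dZ) × Rd dY => ENNReal.ofReal (p q.1.1 q.2 q.1.2))
    (hp.comp (measurable_fst.fst.prodMk (measurable_snd.prodMk measurable_fst.snd))).ennreal_ofReal

theorem measurable_margYZ (hp : Measurable fun w : Rd dX × Rd dY × Rd dZ => p w.1 w.2.1 w.2.2) :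
    Measurable fun v : Rd dY × Rd dZ => margYZ p v.1 v.2 :=
  Measurable.lintegral_prod_right'
    (f := fun q : (Rd dY × Rd dZ) × Rd dX => ENNReal.ofReal (p q.2 q.1.1 q.1.2))
    (hp.comp (measurable_snd.prodMk measurable_fst)).ennreal_ofReal

theorem measurable_margZ (hp : Measurable fun w : Rd dX × Rd dY × Rd dZ => p w.1 w.2.1 w.2.2) :
    Measurable (margZ p) :=
  Measurable.lintegral_prod_right'
    (f := fun q : Rd dZ × Rd dX => margXZ p q.2 q.1)
    ((measurable_margXZ hp).comp measurable_swap)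

theorem measurable_condDensity
    (hp : Measurable fun w : Rd dX × Rd dY × Rd dZ => p w.1 w.2.1 w.2.2) :
    Measurable fun w : Rd dX × Rd dZ => condDensity p w.1 w.2 :=
  (measurable_margXZ hp).ennreal_toReal.div
    ((measurable_margZ hp).comp measurable_snd).ennreal_toReal

theorem condDensity_nonneg (p : Rd dX → Rd dY → Rd dZ → ℝ) (x : Rd dX) (z : Rd dZ) :
    0 ≤ condDensity p x z :=
  div_nonneg ENNReal.toReal_nonneg ENNReal.toReal_nonneg

end MarginalMeasurability

/-! ### Ranks of exchangeable draws -/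

section Rank

/-- Among the indices of small rank take one with the smallest value of `t`: all the others lie
above it, so its own rank already counts the whole set. -/
theorem card_filter_rank_lt_le {ι : Type*} [Fintype ι] (t : ι → ℝ) {r : ℝ} (hr : 0 ≤ r) :
    ((Finset.univ.filter fun m => ((Finset.univ.filter fun j => t m ≤ t j).card : ℝ) < r).card : ℝ)
      ≤ r := by
  classical
  set A := Finset.univ.filter fun m => ((Finset.univ.filter fun j => t m ≤ t j).card : ℝ) < r
  rcases A.eq_empty_or_nonempty with h | h
  · simpa [h] using hr
  · obtain ⟨m, hm, hmin⟩ := A.exists_min_image t h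
    have h1 : A ⊆ Finset.univ.filter fun j => t m ≤ t j := fun j hj => by
      simpa using hmin j hj
    have h2 := (Finset.mem_filter.1 hm).2
    exact (Nat.cast_le.2 (Finset.card_le_card h1)).trans h2.le

/-- For independent draws `τ 0, …, τ M` from a (sub-)probability `q` on a finite set, the
probability that the rank of `t (τ 0)` from the top is less than `α (M + 1)` is at most `α`. -/
theorem sum_prod_rank_lt_le {G : Type*} [Fintype G] [DecidableEq G] {q : G → ℝ}
    (hq : ∀ g, 0 ≤ q g) (hsum : ∑ g, q g ≤ 1) (t : G → ℝ) (M : ℕ) {α : ℝ} (hα : 0 ≤ α) :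
    ∑ τ : Fin (M + 1) → G, (∏ j, q (τ j)) *
      (if ((Finset.univ.filter fun j => t (τ 0) ≤ t (τ j)).card : ℝ) < α * (M + 1)
        then (1 : ℝ) else 0) ≤ α := by
  set I : Fin (M + 1) → (Fin (M + 1) → G) → ℝ := fun m τ =>
    if ((Finset.univ.filter fun j => t (τ m) ≤ t (τ j)).card : ℝ) < α * (M + 1) then 1 else 0
  -- Exchangeability of independent draws: transposing coordinates `0` and `m` carries the event for
  -- draw `m` to the event for draw `0`.
  have hswap : ∀ m, ∑ τ : Fin (M + 1) → G, (∏ j, q (τ j)) * I m τ =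
      ∑ τ : Fin (M + 1) → G, (∏ j, q (τ j)) * I 0 τ := by
    intro m
    refine Fintype.sum_equiv (Equiv.arrowCongr (Equiv.swap 0 m) (Equiv.refl G)) _ _ fun τ => ?_
    have hτ : ∀ j, Equiv.arrowCongr (Equiv.swap 0 m) (Equiv.refl G) τ j = τ (Equiv.swap 0 m j) :=
      fun j => rfl
    simp only [hτ, I, Equiv.swap_apply_left]
    congr 1
    · exact (Equiv.prod_comp (Equiv.swap 0 m) fun j => q (τ j)).symm
    · have : (Finset.univ.filter fun j => t (τ m) ≤ t (τ (Equiv.swap 0 m j))).card =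
          (Finset.univ.filter fun j => t (τ m) ≤ t (τ j)).card := by
        rw [← Finset.card_map (Equiv.swap 0 m).toEmbedding]
        congr 1
        ext j
        simp only [Finset.mem_map_equiv, Finset.mem_filter, Finset.mem_univ, true_and,
          Equiv.symm_swap, Equiv.swap_apply_self]
      rw [this]
  have hM : (0 : ℝ) < M + 1 := by positivity
  -- For each fixed `τ` the sum over `m` counts the draws of small rank, so the bound holds before
  -- any probability enters.
  have htot : ∑ m, ∑ τ : Fin (M + 1) → G, (∏ j, q (τ j)) * I m τ ≤ α * (M + 1) := by
    rw [Finset.sum_comm]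
    simp_rw [← Finset.mul_sum]
    have hI : ∀ τ, ∑ m, I m τ ≤ α * (M + 1) := by
      intro τ
      have := card_filter_rank_lt_le (fun j => t (τ j)) (r := α * (M + 1)) (by positivity)
      simpa [I, Finset.sum_ite] using this
    calc ∑ τ : Fin (M + 1) → G, (∏ j, q (τ j)) * ∑ m, I m τ
        ≤ ∑ τ : Fin (M + 1) → G, (∏ j, q (τ j)) * (α * (M + 1)) :=
          Finset.sum_le_sum fun τ _ => mul_le_mul_of_nonneg_left (hI τ)
            (Finset.prod_nonneg fun j _ => hq _)
      _ = (∑ g, q g) ^ (M + 1) * (α * (M + 1)) := by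
          rw [← Finset.sum_mul]
          congr 1
          have := (Finset.prod_univ_sum (fun _ : Fin (M + 1) => (Finset.univ : Finset G))
            fun _ g => q g).symm
          simpa using this
      _ ≤ 1 * (α * (M + 1)) := by
          gcongr
          exact pow_le_one₀ (Finset.sum_nonneg fun g _ => hq g) hsum
      _ = α * (M + 1) := one_mul _
  simp_rw [hswap] at htot
  rw [Finset.sum_const, Finset.card_univ, Fintype.card_fin, nsmul_eq_mul] at htot
  push_cast at htot
  exact le_of_mul_le_mul_left (by linarith) hM

end Rank

/-! ### The conditional permutation law -/

section PermutationLaw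

variable {dX dY dZ n : ℕ} {p : Rd dX → Rd dY → Rd dZ → ℝ}

theorem permuteX_permuteX (π σ : Equiv.Perm (Fin n)) (D : Sample dX dY dZ n) :
    permuteX π (permuteX σ D) = permuteX (σ * π) D := rfl

theorem permuteX_one (D : Sample dX dY dZ n) : permuteX 1 D = D := rfl

/-- The conditional likelihood `∏ l, p(X_l | Z_l)`. -/
def condLikelihood (p : Rd dX → Rd dY → Rd dZ → ℝ) (D : Sample dX dY dZ n) : ℝ :=
  ∏ l, condDensity p (D l).1 (D l).2.2

theorem condLikelihood_nonneg (D : Sample dX dY dZ n) : 0 ≤ condLikelihood p D :=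
  Finset.prod_nonneg fun _ _ => condDensity_nonneg _ _ _

theorem cptProb_eq_condLikelihood (D : Sample dX dY dZ n) (π : Equiv.Perm (Fin n)) :
    cptProb p D π = condLikelihood p (permuteX π D) / ∑ π', condLikelihood p (permuteX π' D) :=
  rfl

theorem sum_condLikelihood_permuteX (D : Sample dX dY dZ n) (σ : Equiv.Perm (Fin n)) :
    ∑ π', condLikelihood p (permuteX π' (permuteX σ D)) =
      ∑ π', condLikelihood p (permuteX π' D) := by
  simp_rw [permuteX_permuteX]
  exact Equiv.sum_comp (Equiv.mulLeft σ) fun π' => condLikelihood p (permuteX π' D)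

theorem cptProb_nonneg (D : Sample dX dY dZ n) (π : Equiv.Perm (Fin n)) : 0 ≤ cptProb p D π := by
  rw [cptProb_eq_condLikelihood]
  exact div_nonneg (condLikelihood_nonneg _)
    (Finset.sum_nonneg fun _ _ => condLikelihood_nonneg _)

theorem sum_cptProb_le_one (D : Sample dX dY dZ n) : ∑ π, cptProb p D π ≤ 1 := by
  simp_rw [cptProb_eq_condLikelihood, ← Finset.sum_div]
  exact div_self_le_one _

/-- Permuted data have the same orbit, hence the same normalising sum. So all data sets of one orbit
share one resampling law, up to a translation in the group. -/
theorem cptProb_permuteX (D : Sample dX dY dZ n) (σ π : Equiv.Perm (Fin n)) :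
    cptProb p (permuteX σ D) π = cptProb p D (σ * π) := by
  rw [cptProb_eq_condLikelihood, cptProb_eq_condLikelihood, sum_condLikelihood_permuteX,
    permuteX_permuteX]

theorem measurable_permuteX (π : Equiv.Perm (Fin n)) :
    Measurable (permuteX π : Sample dX dY dZ n → Sample dX dY dZ n) :=
  measurable_pi_lambda _ fun i =>
    (measurable_pi_apply (π i)).fst.prodMk (measurable_pi_apply i).snd

theorem measurable_condLikelihood
    (hp : Measurable fun w : Rd dX × Rd dY × Rd dZ => p w.1 w.2.1 w.2.2) :
    Measurable (condLikelihood p : Sample dX dY dZ n → ℝ) :=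
  Finset.measurable_prod _ fun l _ => (measurable_condDensity hp).comp
    ((measurable_pi_apply l).fst.prodMk (measurable_pi_apply l).snd.snd)

theorem measurable_cptProb
    (hp : Measurable fun w : Rd dX × Rd dY × Rd dZ => p w.1 w.2.1 w.2.2)
    (π : Equiv.Perm (Fin n)) :
    Measurable fun D : Sample dX dY dZ n => cptProb p D π :=
  ((measurable_condLikelihood hp).comp (measurable_permuteX π)).div
    (Finset.measurable_sum _ fun π' _ =>
      (measurable_condLikelihood hp).comp (measurable_permuteX π'))

/-- The sample splits into its `X` part and its `(Y, Z)` part; the permutation acts on the first,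
which carries a product of equal measures. -/
theorem measurePreserving_permuteX (lam : Measure (Rd dX)) [SigmaFinite lam]
    (ν : Measure (Rd dY × Rd dZ)) [SigmaFinite ν] (π : Equiv.Perm (Fin n)) :
    MeasurePreserving (permuteX π : Sample dX dY dZ n → Sample dX dY dZ n)
      (Measure.pi fun _ => lam.prod ν) (Measure.pi fun _ => lam.prod ν) := by
  have h1 := measurePreserving_arrowProdEquivProdArrow (Rd dX) (Rd dY × Rd dZ) (Fin n)
    (fun _ => lam) (fun _ => ν)
  have h2 := measurePreserving_piCongrLeft (fun _ : Fin n => lam) π.symm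
  have h3 := h1.symm.comp ((h2.prod (MeasurePreserving.id (Measure.pi fun _ : Fin n => ν))).comp h1)
  convert h3 using 1
  ext1 D
  funext i
  refine Prod.ext ?_ rfl
  change (D (π i)).1 =
    (MeasurableEquiv.piCongrLeft (fun _ : Fin n => Rd dX) π.symm) (fun j => (D j).1) i
  have := MeasurableEquiv.piCongrLeft_apply_apply (β := fun _ : Fin n => Rd dX) π.symm
    (fun j => (D j).1) (π i)
  simpa using this.symm

/-- Under the law with density `p(x | z)` with respect to `dx ⊗ ν(dy, dz)`, resampling by the
conditional permutation law leaves the law of the data invariant. -/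
theorem lintegral_sum_cptProb_permuteX
    (hp : Measurable fun w : Rd dX × Rd dY × Rd dZ => p w.1 w.2.1 w.2.2)
    (ν : Measure (Rd dY × Rd dZ)) [SigmaFinite ν]
    (R : Measure (Rd dX × Rd dY × Rd dZ)) [SigmaFinite R]
    (hR : R = ((volume : Measure (Rd dX)).prod ν).withDensity
      fun w => ENNReal.ofReal (condDensity p w.1 w.2.2))
    {H : Sample dX dY dZ n → ℝ≥0∞} (hH : Measurable H) :
    ∫⁻ D, ∑ π, ENNReal.ofReal (cptProb p D π) * H (permuteX π D) ∂Measure.pi (fun _ => R) =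
      ∫⁻ D, H D ∂Measure.pi (fun _ => R) := by
  have hc : Measurable fun w : Rd dX × Rd dY × Rd dZ => ENNReal.ofReal (condDensity p w.1 w.2.2) :=
    ((measurable_condDensity hp).comp
      (measurable_fst.prodMk measurable_snd.snd)).ennreal_ofReal
  subst hR
  rw [pi_withDensity _ fun _ => hc]
  have hL : ∀ D : Sample dX dY dZ n,
      ∏ l, ENNReal.ofReal (condDensity p (D l).1 (D l).2.2) =
        ENNReal.ofReal (condLikelihood p D) := fun D =>
    (ENNReal.ofReal_prod_of_nonneg fun _ _ => condDensity_nonneg _ _ _).symm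
  simp_rw [hL]
  set m : Measure (Sample dX dY dZ n) := Measure.pi fun _ => (volume : Measure (Rd dX)).prod ν
  have hLm : Measurable fun D : Sample dX dY dZ n => ENNReal.ofReal (condLikelihood p D) :=
    (measurable_condLikelihood hp).ennreal_ofReal
  have hPm : ∀ π, Measurable fun D : Sample dX dY dZ n => ENNReal.ofReal (cptProb p D π) :=
    fun π => (measurable_cptProb hp π).ennreal_ofReal
  have hHm : ∀ π, Measurable fun D : Sample dX dY dZ n => H (permuteX π D) :=
    fun π => hH.comp (measurable_permuteX π)
  have hsum : Measurable fun D : Sample dX dY dZ n =>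
      ∑ π, ENNReal.ofReal (cptProb p D π) * H (permuteX π D) :=
    Finset.measurable_sum _ fun π _ => (hPm π).mul (hHm π)
  rw [lintegral_withDensity_eq_lintegral_mul _ hLm hsum,
    lintegral_withDensity_eq_lintegral_mul _ hLm hH]
  simp only [Pi.mul_apply, Finset.mul_sum]
  have hterm : ∀ π, Measurable fun D : Sample dX dY dZ n => ENNReal.ofReal (condLikelihood p D) *
      (ENNReal.ofReal (cptProb p D π) * H (permuteX π D)) :=
    fun π => hLm.mul ((hPm π).mul (hHm π))
  have hterm' : ∀ π, Measurable fun D : Sample dX dY dZ n => ENNReal.ofReal (condLikelihood p D) *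
      (ENNReal.ofReal (cptProb p D π) * H D) :=
    fun π => hLm.mul ((hPm π).mul hH)
  rw [lintegral_finsetSum _ fun π _ => hterm π]
  -- Detailed balance. Substituting the data permuted by `π⁻¹` turns `L(D) q_D(π)` into `L(π⁻¹ D)
  -- q_D(1)`, with `L` the likelihood and `q_D` the permutation law; both this and `L(D) q_D(π⁻¹)`
  -- equal `L(D) L(π⁻¹ D)` over the normalising sum.
  have hsub : ∀ π : Equiv.Perm (Fin n),
      ∫⁻ D, ENNReal.ofReal (condLikelihood p D) *
          (ENNReal.ofReal (cptProb p D π) * H (permuteX π D)) ∂m =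
        ∫⁻ D, ENNReal.ofReal (condLikelihood p D) *
          (ENNReal.ofReal (cptProb p D π⁻¹) * H D) ∂m := by
    intro π
    rw [← (measurePreserving_permuteX volume ν π⁻¹).lintegral_comp (hterm π)]
    refine lintegral_congr fun D => ?_
    rw [permuteX_permuteX, cptProb_permuteX, inv_mul_cancel, permuteX_one, ← mul_assoc,
      ← mul_assoc, ← ENNReal.ofReal_mul (condLikelihood_nonneg _),
      ← ENNReal.ofReal_mul (condLikelihood_nonneg _)]
    congr 2
    rw [cptProb_eq_condLikelihood, cptProb_eq_condLikelihood, permuteX_one]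
    ring
  simp_rw [hsub]
  have hinv := Equiv.sum_comp (Equiv.inv (Equiv.Perm (Fin n))) fun π =>
    ∫⁻ D, ENNReal.ofReal (condLikelihood p D) * (ENNReal.ofReal (cptProb p D π) * H D) ∂m
  simp only [Equiv.inv_apply] at hinv
  rw [hinv, ← lintegral_finsetSum _ fun π _ => hterm' π]
  refine lintegral_congr fun D => ?_
  rw [← Finset.mul_sum, ← Finset.sum_mul, ← mul_assoc]
  congr 1
  rw [← ENNReal.ofReal_sum_of_nonneg fun π _ => cptProb_nonneg D π,
    ← ENNReal.ofReal_mul (condLikelihood_nonneg _)]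
  congr 1
  simp_rw [cptProb_eq_condLikelihood, ← Finset.sum_div]
  -- Data of likelihood zero contribute nothing. Otherwise the identity term makes the normalising
  -- sum positive, and the probabilities add up to one.
  by_cases h0 : condLikelihood p D = 0
  · simp [h0]
  · rw [div_self, mul_one]
    have h1 := Finset.single_le_sum (f := fun π => condLikelihood p (permuteX π D))
      (fun π _ => condLikelihood_nonneg _) (Finset.mem_univ (1 : Equiv.Perm (Fin n)))
    rw [permuteX_one] at h1
    exact (lt_of_lt_of_le ((condLikelihood_nonneg D).lt_of_ne' h0) h1).ne'

/-- The probability, given the data `D`, that the test based on `T` rejects. -/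
def rejectProb (p : Rd dX → Rd dY → Rd dZ → ℝ) (M : ℕ) (α : ℝ) (T : Sample dX dY dZ n → ℝ)
    (D : Sample dX dY dZ n) : ℝ :=
  ∑ σ : Fin M → Equiv.Perm (Fin n), (∏ j, cptProb p D (σ j)) *
    (if cptPValue T D σ < α then 1 else 0)

/-- The `1` in the numerator of the p-value is the comparison of draw `0` with itself, so the
p-value is exactly the rank of draw `0` among all `M + 1` draws, divided by `M + 1`. -/
theorem cptPValue_lt_iff {M : ℕ} (T : Sample dX dY dZ n → ℝ) (D : Sample dX dY dZ n)
    (τ : Fin (M + 1) → Equiv.Perm (Fin n)) (α : ℝ) :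
    cptPValue T (permuteX (τ 0) D) (fun j => (τ 0)⁻¹ * τ j.succ) < α ↔
      ((Finset.univ.filter fun j => T (permuteX (τ 0) D) ≤ T (permuteX (τ j) D)).card : ℝ) <
        α * (M + 1) := by
  have hM : (0 : ℝ) < 1 + M := by positivity
  unfold cptPValue
  rw [div_lt_iff₀ hM, add_comm (1 : ℝ) (M : ℝ)]
  have : ((Finset.univ.filter fun j => T (permuteX (τ 0) D) ≤ T (permuteX (τ j) D)).card : ℝ) =
      ∑ j, if T (permuteX (τ 0) D) ≤ T (permuteX (τ j) D) then (1 : ℝ) else 0 := by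
    simp
  rw [this, Fin.sum_univ_succ]
  simp only [le_refl, if_true, permuteX_permuteX, mul_inv_cancel_left, ge_iff_le]

/-- This bounds, on one orbit, the rejection probability for data that were themselves drawn by the
permutation law. The data and their permuted versions are then independent draws from the same law,
so the rank bound applies. -/
theorem sum_cptProb_mul_rejectProb_le (M : ℕ) {α : ℝ} (hα : 0 ≤ α) (T : Sample dX dY dZ n → ℝ)
    (D : Sample dX dY dZ n) :
    ∑ π, cptProb p D π * rejectProb p M α T (permuteX π D) ≤ α := by
  refine le_trans (le_of_eq ?_) (sum_prod_rank_lt_le (q := cptProb p D) (cptProb_nonneg D)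
    (sum_cptProb_le_one D) (fun π => T (permuteX π D)) M hα)
  rw [← (Fin.consEquiv fun _ : Fin (M + 1) => Equiv.Perm (Fin n)).sum_comp, Fintype.sum_prod_type]
  refine Finset.sum_congr rfl fun π _ => ?_
  rw [rejectProb, Finset.mul_sum,
    -- The permutations drawn for the data permuted by `π` are rewritten relative to `D`, by `σ ↦
    -- π⁻¹ σ`.
    ← Equiv.sum_comp (Equiv.piCongrRight fun _ : Fin M => Equiv.mulLeft π⁻¹)]
  refine Finset.sum_congr rfl fun σ _ => ?_
  have h := cptPValue_lt_iff T D (Fin.cons π σ) α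
  simp only [Fin.cons_zero, Fin.cons_succ] at h
  have hσ : (Equiv.piCongrRight fun _ : Fin M => Equiv.mulLeft π⁻¹) σ = fun j => π⁻¹ * σ j := rfl
  simp only [hσ, cptProb_permuteX, mul_inv_cancel_left, h, Fin.consEquiv_apply,
    Fin.prod_univ_succ, Fin.cons_zero, Fin.cons_succ]
  ring

theorem rejectProb_nonneg (M : ℕ) (α : ℝ) (T : Sample dX dY dZ n → ℝ) (D : Sample dX dY dZ n) :
    0 ≤ rejectProb p M α T D :=
  Finset.sum_nonneg fun σ _ => mul_nonneg (Finset.prod_nonneg fun j _ => cptProb_nonneg _ _)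
    (by split_ifs <;> norm_num)

theorem measurableSet_cptPValue_lt {M : ℕ} {T : Sample dX dY dZ n → ℝ} (hT : Measurable T)
    (σ : Fin M → Equiv.Perm (Fin n)) (α : ℝ) : MeasurableSet {D | cptPValue T D σ < α} := by
  classical
  refine measurableSet_lt ?_ measurable_const
  refine Measurable.div_const (measurable_const.add (Finset.measurable_sum _ fun j _ => ?_)) _
  exact Measurable.ite (measurableSet_le hT (hT.comp (measurable_permuteX (σ j))))
    measurable_const measurable_const

theorem measurable_rejectProb
    (hp : Measurable fun w : Rd dX × Rd dY × Rd dZ => p w.1 w.2.1 w.2.2)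
    (M : ℕ) (α : ℝ) {T : Sample dX dY dZ n → ℝ} (hT : Measurable T) :
    Measurable (rejectProb p M α T) :=
  Finset.measurable_sum _ fun σ _ =>
    (Finset.measurable_prod _ fun j _ => measurable_cptProb hp (σ j)).mul
      (Measurable.ite (measurableSet_cptPValue_lt hT σ α) measurable_const measurable_const)

/-- The conditional permutation test has level `α` if the conditional density of `X` given
`(Y, Z)` is `p(x | z)`. -/
theorem lintegral_rejectProb_le
    (hp : Measurable fun w : Rd dX × Rd dY × Rd dZ => p w.1 w.2.1 w.2.2)
    (ν : Measure (Rd dY × Rd dZ)) [SigmaFinite ν]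
    (R : Measure (Rd dX × Rd dY × Rd dZ)) [IsProbabilityMeasure R]
    (hR : R = ((volume : Measure (Rd dX)).prod ν).withDensity
      fun w => ENNReal.ofReal (condDensity p w.1 w.2.2))
    (M : ℕ) {α : ℝ} (hα : 0 ≤ α) {T : Sample dX dY dZ n → ℝ} (hT : Measurable T) :
    ∫⁻ D, ENNReal.ofReal (rejectProb p M α T D) ∂Measure.pi (fun _ => R) ≤ ENNReal.ofReal α := by
  rw [← lintegral_sum_cptProb_permuteX hp ν R hR (measurable_rejectProb hp M α hT).ennreal_ofReal]
  calc _ ≤ ∫⁻ _ : Sample dX dY dZ n, ENNReal.ofReal α ∂Measure.pi (fun _ => R) := by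
        refine lintegral_mono fun D => ?_
        simp_rw [← ENNReal.ofReal_mul (cptProb_nonneg D _)]
        rw [← ENNReal.ofReal_sum_of_nonneg fun π _ =>
          mul_nonneg (cptProb_nonneg D π) (rejectProb_nonneg _ _ _ _)]
        exact ENNReal.ofReal_le_ofReal (sum_cptProb_mul_rejectProb_le M hα T D)
    _ = ENNReal.ofReal α := by simp

end PermutationLaw

/-! ### The law of the observations and its marginals -/

section Law

variable {dX dY dZ : ℕ}

/-- `P` has the measurable density `p ≥ 0`; the density and its marginals are at most `C`. -/
structure HasBoundedDensity (p : Rd dX → Rd dY → Rd dZ → ℝ)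
    (P : Measure (Rd dX × Rd dY × Rd dZ)) (C : ℝ≥0) : Prop where
  measurable : Measurable fun w : Rd dX × Rd dY × Rd dZ => p w.1 w.2.1 w.2.2
  nonneg : ∀ x y z, 0 ≤ p x y z
  law : P = volume.withDensity fun w => ENNReal.ofReal (p w.1 w.2.1 w.2.2)
  le : ∀ x y z, p x y z ≤ C
  margXZ_le : ∀ x z, margXZ p x z ≤ C
  margYZ_le : ∀ y z, margYZ p y z ≤ C
  margZ_le : ∀ z, margZ p z ≤ C

variable {p : Rd dX → Rd dY → Rd dZ → ℝ} {P : Measure (Rd dX × Rd dY × Rd dZ)} {C : ℝ≥0}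

/-- The law under which `(Y, Z)` has its law under `p`, and `X` has conditional density
`p(x | z)` given `(Y, Z) = (y, z)`. -/
def condProduct (p : Rd dX → Rd dY → Rd dZ → ℝ) : Measure (Rd dX × Rd dY × Rd dZ) :=
  ((volume : Measure (Rd dX)).prod
    (volume.withDensity fun v : Rd dY × Rd dZ => margYZ p v.1 v.2)).withDensity
    fun w => ENNReal.ofReal (condDensity p w.1 w.2.2)

namespace HasBoundedDensity

theorem lintegral_eq (h : HasBoundedDensity p P C) {H : Rd dX × Rd dY × Rd dZ → ℝ≥0∞}
    (hH : Measurable H) :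
    ∫⁻ w, H w ∂P = ∫⁻ x, ∫⁻ y, ∫⁻ z, ENNReal.ofReal (p x y z) * H (x, y, z) := by
  have hm := h.measurable.ennreal_ofReal
  rw [h.law, lintegral_withDensity_eq_lintegral_mul _ hm hH, Measure.volume_eq_prod,
    lintegral_prod _ (hm.mul hH).aemeasurable]
  refine lintegral_congr fun x => ?_
  have h1 : Measurable fun v : Rd dY × Rd dZ =>
      ((fun w : Rd dX × Rd dY × Rd dZ => ENNReal.ofReal (p w.1 w.2.1 w.2.2)) * H) (x, v) :=
    (hm.mul hH).comp (measurable_const.prodMk measurable_id)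
  rw [Measure.volume_eq_prod, lintegral_prod _ h1.aemeasurable]
  rfl

theorem lintegral_XZ (h : HasBoundedDensity p P C) {H : Rd dX × Rd dZ → ℝ≥0∞}
    (hH : Measurable H) :
    ∫⁻ w, H (w.1, w.2.2) ∂P = ∫⁻ x, ∫⁻ z, margXZ p x z * H (x, z) := by
  have hm := h.measurable.ennreal_ofReal
  rw [h.lintegral_eq (H := fun w => H (w.1, w.2.2))
    (hH.comp (measurable_fst.prodMk measurable_snd.snd))]
  refine lintegral_congr fun x => ?_
  have h1 : Measurable fun v : Rd dY × Rd dZ => ENNReal.ofReal (p x v.1 v.2) :=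
    hm.comp (measurable_const.prodMk measurable_id)
  have h2 : Measurable fun v : Rd dY × Rd dZ => H (x, v.2) :=
    hH.comp (measurable_const.prodMk measurable_snd)
  rw [lintegral_lintegral_swap (h1.mul h2).aemeasurable]
  refine lintegral_congr fun z => ?_
  have h3 : Measurable fun y => ENNReal.ofReal (p x y z) :=
    h1.comp (measurable_id.prodMk measurable_const)
  dsimp only
  rw [lintegral_mul_const _ h3]
  rfl

theorem lintegral_YZ (h : HasBoundedDensity p P C) {H : Rd dY × Rd dZ → ℝ≥0∞}
    (hH : Measurable H) :
    ∫⁻ w, H w.2 ∂P = ∫⁻ v : Rd dY × Rd dZ, margYZ p v.1 v.2 * H v := by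
  have hm := h.measurable.ennreal_ofReal
  have h2 : Measurable fun w : Rd dX × Rd dY × Rd dZ => H w.2 := hH.comp measurable_snd
  rw [h.law, lintegral_withDensity_eq_lintegral_mul _ hm h2,
    Measure.volume_eq_prod, lintegral_prod_symm _ (hm.mul h2).aemeasurable]
  refine lintegral_congr fun v => ?_
  have h3 : Measurable fun x => ENNReal.ofReal (p x v.1 v.2) :=
    hm.comp (measurable_id.prodMk measurable_const)
  simp only [Pi.mul_apply]
  rw [lintegral_mul_const _ h3]
  rfl

theorem lintegral_Z (h : HasBoundedDensity p P C) {H : Rd dZ → ℝ≥0∞} (hH : Measurable H) :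
    ∫⁻ w, H w.2.2 ∂P = ∫⁻ z, margZ p z * H z := by
  have hm := measurable_margXZ h.measurable
  rw [h.lintegral_XZ (H := fun w => H w.2) (hH.comp measurable_snd),
    lintegral_lintegral_swap (hm.mul (hH.comp measurable_snd)).aemeasurable]
  refine lintegral_congr fun z => ?_
  have h3 : Measurable fun x => margXZ p x z :=
    hm.comp (measurable_id.prodMk measurable_const)
  dsimp only
  rw [lintegral_mul_const _ h3]
  rfl

theorem map_snd (h : HasBoundedDensity p P C) :
    P.map Prod.snd = volume.withDensity fun v : Rd dY × Rd dZ => margYZ p v.1 v.2 := by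
  refine Measure.ext_of_lintegral _ fun f hf => ?_
  rw [lintegral_map hf measurable_snd, h.lintegral_YZ hf,
    lintegral_withDensity_eq_lintegral_mul _ (measurable_margYZ h.measurable) hf]
  rfl

/-- The exceptional null set is needed only where `p_Z` vanishes: the conditional density is then
zero by convention, while `p_{X,Z}(·, z)` is known to vanish only almost everywhere. -/
theorem margZ_mul_condDensity (h : HasBoundedDensity p P C) (z : Rd dZ) :
    ∀ᵐ x, margZ p z * ENNReal.ofReal (condDensity p x z) = margXZ p x z := by
  have hZ : margZ p z ≠ ∞ := ((h.margZ_le z).trans_lt ENNReal.coe_lt_top).ne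
  by_cases h0 : margZ p z = 0
  · have hm : Measurable fun x => margXZ p x z :=
      (measurable_margXZ h.measurable).comp (measurable_id.prodMk measurable_const)
    have h1 : ∫⁻ x, margXZ p x z = 0 := h0
    filter_upwards [(lintegral_eq_zero_iff hm).1 h1] with x hx
    simp only [Pi.zero_apply] at hx
    rw [hx, h0, zero_mul]
  · refine Eventually.of_forall fun x => ?_
    have hXZ : margXZ p x z ≠ ∞ := ((h.margXZ_le x z).trans_lt ENNReal.coe_lt_top).ne
    rw [condDensity, ENNReal.ofReal_div_of_pos (ENNReal.toReal_pos h0 hZ),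
      ENNReal.ofReal_toReal hXZ, ENNReal.ofReal_toReal hZ, ENNReal.mul_div_cancel h0 hZ]

theorem lintegral_condProduct (h : HasBoundedDensity p P C)
    {H : Rd dX × Rd dY × Rd dZ → ℝ≥0∞} (hH : Measurable H) :
    ∫⁻ w, H w ∂condProduct p =
      ∫⁻ w, (∫⁻ x, ENNReal.ofReal (condDensity p x w.2.2) * H (x, w.2)) ∂P := by
  have hc : Measurable fun w : Rd dX × Rd dY × Rd dZ =>
      ENNReal.ofReal (condDensity p w.1 w.2.2) :=
    ((measurable_condDensity h.measurable).comp
      (measurable_fst.prodMk measurable_snd.snd)).ennreal_ofReal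
  have hν : SFinite (volume.withDensity fun v : Rd dY × Rd dZ => margYZ p v.1 v.2) := inferInstance
  rw [condProduct, lintegral_withDensity_eq_lintegral_mul _ hc hH,
    lintegral_prod_symm _ (hc.mul hH).aemeasurable, ← h.map_snd,
    lintegral_map (hc.mul hH).lintegral_prod_left' measurable_snd]
  rfl

/-- Redrawing `X` from its law given `Z` does not change the joint law of `X` and `Z`. Thus facts
about the permutation law, which ignores `Y`, can be moved to `condProduct p` without assuming
conditional independence. -/
theorem lintegral_condProduct_XZ (h : HasBoundedDensity p P C) {H : Rd dX × Rd dZ → ℝ≥0∞}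
    (hH : Measurable H) :
    ∫⁻ w, H (w.1, w.2.2) ∂condProduct p = ∫⁻ w, H (w.1, w.2.2) ∂P := by
  have hc : Measurable fun w : Rd dX × Rd dZ => ENNReal.ofReal (condDensity p w.1 w.2) :=
    (measurable_condDensity h.measurable).ennreal_ofReal
  have h1 : Measurable fun w : Rd dX × Rd dY × Rd dZ => H (w.1, w.2.2) :=
    hH.comp (measurable_fst.prodMk measurable_snd.snd)
  have h2 : Measurable fun z => ∫⁻ x, ENNReal.ofReal (condDensity p x z) * H (x, z) :=
    (hc.mul hH).lintegral_prod_left'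
  have h4 : ∫⁻ w, H (w.1, w.2.2) ∂condProduct p =
      ∫⁻ w, (∫⁻ x, ENNReal.ofReal (condDensity p x w.2.2) * H (x, w.2.2)) ∂P :=
    h.lintegral_condProduct (H := fun w => H (w.1, w.2.2)) h1
  have h5 : Measurable fun w : Rd dX × Rd dZ => margXZ p w.1 w.2 * H w :=
    (measurable_margXZ h.measurable).mul hH
  rw [h4, h.lintegral_XZ hH, h.lintegral_Z h2]
  rw [lintegral_lintegral_swap h5.aemeasurable]
  refine lintegral_congr fun z => ?_
  have hz : Measurable fun x : Rd dX => (x, z) := measurable_id.prodMk measurable_const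
  have h3 : Measurable fun x => ENNReal.ofReal (condDensity p x z) * H (x, z) :=
    (hc.comp hz).mul (hH.comp hz)
  have h6 : ∫⁻ x, margZ p z * (ENNReal.ofReal (condDensity p x z) * H (x, z)) =
      ∫⁻ x, margXZ p x z * H (x, z) := by
    refine lintegral_congr_ae ?_
    filter_upwards [h.margZ_mul_condDensity z] with x hx
    rw [← mul_assoc, hx]
  rw [← lintegral_const_mul _ h3]
  exact h6

theorem map_XZ_condProduct (h : HasBoundedDensity p P C) :
    (condProduct p).map (fun w => (w.1, w.2.2)) = P.map fun w => (w.1, w.2.2) := by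
  refine Measure.ext_of_lintegral _ fun f hf => ?_
  rw [lintegral_map hf (by fun_prop), lintegral_map hf (by fun_prop),
    h.lintegral_condProduct_XZ hf]

theorem isProbabilityMeasure_condProduct [IsProbabilityMeasure P]
    (h : HasBoundedDensity p P C) : IsProbabilityMeasure (condProduct p) := by
  constructor
  have := h.lintegral_condProduct_XZ (H := fun _ => 1) measurable_const
  simpa using this

theorem lintegral_condDensity_le_one (h : HasBoundedDensity p P C) (z : Rd dZ) :
    ∫⁻ x, ENNReal.ofReal (condDensity p x z) ≤ 1 := by
  have hZ : margZ p z ≠ ∞ := ((h.margZ_le z).trans_lt ENNReal.coe_lt_top).ne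
  by_cases h0 : margZ p z = 0
  -- Here the quotient is zero by convention and the total mass is zero rather than one, so only `≤
  -- 1` holds at every `z`.
  · simp [condDensity, h0]
  · have hm : Measurable fun x => ENNReal.ofReal (condDensity p x z) :=
      ((measurable_condDensity h.measurable).comp
        (measurable_id.prodMk measurable_const)).ennreal_ofReal
    have h1 : margZ p z * ∫⁻ x, ENNReal.ofReal (condDensity p x z) = margZ p z * 1 := by
      rw [← lintegral_const_mul _ hm, lintegral_congr_ae (h.margZ_mul_condDensity z), mul_one]
      rfl
    exact ((ENNReal.mul_right_inj h0 hZ).1 h1).le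

/-- The conditional law of `X` given `Z`. -/
def condKernel (h : HasBoundedDensity p P C) : Kernel (Rd dZ) (Rd dX) where
  toFun z := volume.withDensity fun x => ENNReal.ofReal (condDensity p x z)
  measurable' := by
    refine Measure.measurable_of_measurable_coe _ fun s hs => ?_
    simp_rw [withDensity_apply _ hs]
    exact Measurable.lintegral_prod_left'
      (f := fun w : Rd dX × Rd dZ => ENNReal.ofReal (condDensity p w.1 w.2))
      (measurable_condDensity h.measurable).ennreal_ofReal

theorem isFiniteKernel_condKernel (h : HasBoundedDensity p P C) : IsFiniteKernel h.condKernel :=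
  ⟨1, ENNReal.one_lt_top, fun z => by
    change (volume.withDensity fun x => ENNReal.ofReal (condDensity p x z)) Set.univ ≤ 1
    rw [withDensity_apply _ .univ, Measure.restrict_univ]
    exact h.lintegral_condDensity_le_one z⟩

theorem lintegral_condKernel (h : HasBoundedDensity p P C) (z : Rd dZ) {f : Rd dX → ℝ≥0∞}
    (hf : Measurable f) :
    ∫⁻ x, f x ∂h.condKernel z = ∫⁻ x, ENNReal.ofReal (condDensity p x z) * f x := by
  change ∫⁻ x, f x ∂(volume.withDensity fun x => ENNReal.ofReal (condDensity p x z)) = _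
  rw [lintegral_withDensity_eq_lintegral_mul _ _ hf]
  · rfl
  · exact ((measurable_condDensity h.measurable).comp
      (measurable_id.prodMk measurable_const)).ennreal_ofReal

/-- `X` and `Y` are conditionally independent given `Z` iff `X` has conditional density
`p(x | z)` given `(Y, Z)`. -/
theorem condIndep_iff [IsProbabilityMeasure P] (h : HasBoundedDensity p P C) :
    CondIndepXYgivenZ P ↔ P = condProduct p := by
  have hfin := h.isFiniteKernel_condKernel
  have hprob := h.isProbabilityMeasure_condProduct
  have hX : Measurable fun w : Rd dX × Rd dY × Rd dZ => w.1 := measurable_fst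
  have hY : Measurable fun w : Rd dX × Rd dY × Rd dZ => w.2.1 := by fun_prop
  have hZ : Measurable fun w : Rd dX × Rd dY × Rd dZ => w.2.2 := by fun_prop
  have hZY : Measurable fun w : Rd dX × Rd dY × Rd dZ => (w.2.2, w.2.1) := by fun_prop
  -- The conditional law given `Z` is `h.condKernel`, because integrating that kernel gives
  -- `condProduct p`, whose `(X, Z)` marginal is that of `P`.
  have h1 : condDistrib (fun w : Rd dX × Rd dY × Rd dZ => w.1) (fun w => w.2.2) P
      =ᵐ[P.map fun w => w.2.2] h.condKernel := by
    rw [condDistrib_ae_eq_iff_measure_eq_compProd _ hX.aemeasurable]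
    refine Measure.ext_of_lintegral _ fun f hf => ?_
    have hf' : Measurable fun w : Rd dX × Rd dZ => f (w.2, w.1) := hf.comp measurable_swap
    rw [Measure.lintegral_compProd hf, lintegral_map hf (by fun_prop),
      lintegral_map hf.lintegral_kernel_prod_right' hZ,
      ← h.lintegral_condProduct_XZ hf',
      h.lintegral_condProduct (H := fun w => f (w.2.2, w.1)) (by fun_prop)]
    refine lintegral_congr fun w => ?_
    have hfw : Measurable fun x => f (w.2.2, x) := hf.comp (measurable_const.prodMk measurable_id)
    rw [h.lintegral_condKernel _ hfw]
  have h2 : (condDistrib (fun w : Rd dX × Rd dY × Rd dZ => w.1) (fun w => w.2.2) P).prodMkRight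
      (Rd dY) =ᵐ[P.map fun w => (w.2.2, w.2.1)] h.condKernel.prodMkRight (Rd dY) := by
    have h3 : ∀ᵐ v ∂(P.map fun w : Rd dX × Rd dY × Rd dZ => (w.2.2, w.2.1)),
        condDistrib (fun w : Rd dX × Rd dY × Rd dZ => w.1) (fun w => w.2.2) P v.1 =
          h.condKernel v.1 := by
      have : P.map (fun w : Rd dX × Rd dY × Rd dZ => w.2.2) =
          (P.map fun w => (w.2.2, w.2.1)).map Prod.fst := by
        rw [Measure.map_map measurable_fst hZY]; rfl
      rw [this] at h1
      exact ae_of_ae_map measurable_fst.aemeasurable h1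
    filter_upwards [h3] with v hv
    simpa [Kernel.prodMkRight_apply] using hv
  have h4 : CondIndepXYgivenZ P ↔
      condDistrib (fun w : Rd dX × Rd dY × Rd dZ => w.1) (fun w => (w.2.2, w.2.1)) P
        =ᵐ[P.map fun w => (w.2.2, w.2.1)] h.condKernel.prodMkRight (Rd dY) := by
    refine Iff.trans ⟨fun hc => CondIndepFun.symm hc, fun hc => CondIndepFun.symm hc⟩
      ((condIndepFun_iff_condDistrib_prod_ae_eq_prodMkRight hX hY hZ).trans
        ⟨fun hc => hc.trans h2, fun hc => hc.trans h2.symm⟩)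
  rw [h4, condDistrib_ae_eq_iff_measure_eq_compProd _ hX.aemeasurable]
  have he : Measurable fun w : Rd dX × Rd dY × Rd dZ => ((w.2.2, w.2.1), w.1) := by fun_prop
  -- Attaching the kernel that ignores `Y` to the law of `(Z, Y)` produces `condProduct p` with its
  -- coordinates reordered, so conditional independence becomes an equality of two measures.
  have h5 : (P.map fun w : Rd dX × Rd dY × Rd dZ => (w.2.2, w.2.1)) ⊗ₘ
      h.condKernel.prodMkRight (Rd dY) = (condProduct p).map fun w => ((w.2.2, w.2.1), w.1) := by
    refine Measure.ext_of_lintegral _ fun f hf => ?_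
    rw [Measure.lintegral_compProd hf, lintegral_map hf he,
      lintegral_map hf.lintegral_kernel_prod_right' hZY,
      h.lintegral_condProduct (H := fun w => f ((w.2.2, w.2.1), w.1)) (by fun_prop)]
    refine lintegral_congr fun w => ?_
    have hfw : Measurable fun x => f ((w.2.2, w.2.1), x) :=
      hf.comp (measurable_const.prodMk measurable_id)
    rw [Kernel.prodMkRight_apply, h.lintegral_condKernel _ hfw]
  rw [h5]
  refine ⟨fun heq => ?_, fun heq => by rw [← heq]⟩
  have hinv : Measurable fun q : (Rd dZ × Rd dY) × Rd dX => (q.2, q.1.2, q.1.1) := by fun_prop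
  have := congrArg (Measure.map fun q : (Rd dZ × Rd dY) × Rd dX => (q.2, q.1.2, q.1.1)) heq
  rw [Measure.map_map hinv he, Measure.map_map hinv he] at this
  simpa [Function.comp_def] using this

end HasBoundedDensity

end Law

/-! ### The ball divergence of weighted empirical measures -/

section BallSum

variable {E : Type*} [PseudoMetricSpace E] {n : ℕ}

/-- The indicator of `x i ∈ B̄(x b, ρ(x a, x b))`. -/
def ballIndicator (x : Fin n → E) (a b i : Fin n) : ℝ :=
  open Classical in if dist (x i) (x b) ≤ dist (x a) (x b) then 1 else 0

/-- The difference of the masses that the weights `w` and `v` give to `B̄(x b, ρ(x a, x b))`. -/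
def ballDiff (x : Fin n → E) (w v : Fin n → ℝ) (a b : Fin n) : ℝ :=
  ∑ i, (w i - v i) * ballIndicator x a b i

/-- The ball divergence of the discrete measures with weights `w` and `v` on the points `x`. -/
def ballSum (x : Fin n → E) (w v : Fin n → ℝ) : ℝ :=
  ∑ a, ∑ b, (w a * w b + v a * v b) * ballDiff x w v a b ^ 2

theorem ballIndicator_nonneg (x : Fin n → E) (a b i : Fin n) : 0 ≤ ballIndicator x a b i := by
  unfold ballIndicator; split_ifs <;> norm_num

theorem ballIndicator_le_one (x : Fin n → E) (a b i : Fin n) : ballIndicator x a b i ≤ 1 := by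
  unfold ballIndicator; split_ifs <;> norm_num

theorem abs_ballDiff_le {w v : Fin n → ℝ} (hw : ∀ i, 0 ≤ w i) (hv : ∀ i, 0 ≤ v i)
    (hw1 : ∑ i, w i ≤ 1) (hv1 : ∑ i, v i ≤ 1) (x : Fin n → E) (a b : Fin n) :
    |ballDiff x w v a b| ≤ 1 := by
  have h1 : ∀ u : Fin n → ℝ, (∀ i, 0 ≤ u i) → ∑ i, u i ≤ 1 →
      0 ≤ ∑ i, u i * ballIndicator x a b i ∧ ∑ i, u i * ballIndicator x a b i ≤ 1 := by
    intro u hu hu1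
    refine ⟨Finset.sum_nonneg fun i _ => mul_nonneg (hu i) (ballIndicator_nonneg _ _ _ _),
      le_trans (Finset.sum_le_sum fun i _ => ?_) hu1⟩
    exact mul_le_of_le_one_right (hu i) (ballIndicator_le_one _ _ _ _)
  obtain ⟨h2, h3⟩ := h1 w hw hw1
  obtain ⟨h4, h5⟩ := h1 v hv hv1
  unfold ballDiff
  simp_rw [sub_mul, Finset.sum_sub_distrib]
  rw [abs_le]
  constructor <;> linarith

theorem ballSum_nonneg {w v : Fin n → ℝ} (hw : ∀ i, 0 ≤ w i) (hv : ∀ i, 0 ≤ v i)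
    (x : Fin n → E) : 0 ≤ ballSum x w v :=
  Finset.sum_nonneg fun a _ => Finset.sum_nonneg fun b _ =>
    mul_nonneg (add_nonneg (mul_nonneg (hw a) (hw b)) (mul_nonneg (hv a) (hv b))) (sq_nonneg _)

theorem sum_sum_weights (w v : Fin n → ℝ) :
    ∑ a, ∑ b, (w a * w b + v a * v b) = (∑ a, w a) ^ 2 + (∑ a, v a) ^ 2 := by
  simp_rw [Finset.sum_add_distrib, ← Finset.mul_sum, ← Finset.sum_mul]
  ring

theorem ballSum_le_two {w v : Fin n → ℝ} (hw : ∀ i, 0 ≤ w i) (hv : ∀ i, 0 ≤ v i)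
    (hw1 : ∑ i, w i ≤ 1) (hv1 : ∑ i, v i ≤ 1) (x : Fin n → E) : ballSum x w v ≤ 2 := by
  calc ballSum x w v ≤ ∑ a, ∑ b, (w a * w b + v a * v b) := by
        refine Finset.sum_le_sum fun a _ => Finset.sum_le_sum fun b _ => ?_
        refine mul_le_of_le_one_right
          (add_nonneg (mul_nonneg (hw a) (hw b)) (mul_nonneg (hv a) (hv b))) ?_
        rw [sq_le_one_iff_abs_le_one]
        exact abs_ballDiff_le hw hv hw1 hv1 x a b
    _ = (∑ a, w a) ^ 2 + (∑ a, v a) ^ 2 := sum_sum_weights w v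
    _ ≤ 1 + 1 := add_le_add (pow_le_one₀ (Finset.sum_nonneg fun i _ => hw i) hw1)
        (pow_le_one₀ (Finset.sum_nonneg fun i _ => hv i) hv1)
    _ = 2 := by norm_num

/-- With both masses equal to one, a difference of means is the mean difference over a pair `(i, j)`
drawn from `w ⊗ v`. The point of this form is that each term changes sign when `i` and `j` are
exchanged. -/
theorem ballDiff_eq_sum_sum {w v : Fin n → ℝ} (hw1 : ∑ i, w i = 1) (hv1 : ∑ i, v i = 1)
    (x : Fin n → E) (a b : Fin n) :
    ballDiff x w v a b =
      ∑ i, ∑ j, w i * v j * (ballIndicator x a b i - ballIndicator x a b j) := by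
  have h1 : ∀ i j, w i * v j * (ballIndicator x a b i - ballIndicator x a b j) =
      v j * (w i * ballIndicator x a b i) - w i * (v j * ballIndicator x a b j) :=
    fun i j => by ring
  simp_rw [h1, Finset.sum_sub_distrib, ← Finset.mul_sum, ← Finset.sum_mul, hw1, hv1]
  simp [ballDiff, sub_mul]

theorem ballIndicator_comp (x : Fin n → E) (τ : Equiv.Perm (Fin n)) {a b : Fin n}
    (ha : τ a = a) (hb : τ b = b) (l : Fin n) :
    ballIndicator (fun i => x (τ i)) a b l = ballIndicator x a b (τ l) := by
  simp [ballIndicator, ha, hb]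

/-- The ball is fixed by `a` and `b`, which the transposition does not move, so only the
contributions of `i` and `j` change. -/
theorem ballDiff_comp_swap {w v : Fin n → ℝ} (x : Fin n → E) {a b i j : Fin n} (hij : i ≠ j)
    (hia : a ≠ i) (hja : a ≠ j) (hib : b ≠ i) (hjb : b ≠ j) :
    ballDiff (fun l => x (Equiv.swap i j l)) w v a b = ballDiff x w v a b -
      ((w i - v i) - (w j - v j)) * (ballIndicator x a b i - ballIndicator x a b j) := by
  have h1 : ∀ l, ballIndicator (fun l => x (Equiv.swap i j l)) a b l =
      ballIndicator x a b (Equiv.swap i j l) :=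
    ballIndicator_comp x _ (Equiv.swap_apply_of_ne_of_ne hia hja)
      (Equiv.swap_apply_of_ne_of_ne hib hjb)
  have h2 : ballDiff (fun l => x (Equiv.swap i j l)) w v a b - ballDiff x w v a b =
      ∑ l, (w l - v l) *
        (ballIndicator x a b (Equiv.swap i j l) - ballIndicator x a b l) := by
    simp only [ballDiff, h1, mul_sub, Finset.sum_sub_distrib]
  have h3 : ∑ l, (w l - v l) *
        (ballIndicator x a b (Equiv.swap i j l) - ballIndicator x a b l) =
      ∑ l ∈ {i, j}, (w l - v l) *
        (ballIndicator x a b (Equiv.swap i j l) - ballIndicator x a b l) := by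
    refine (Finset.sum_subset (Finset.subset_univ _) fun l _ hl => ?_).symm
    simp only [Finset.mem_insert, Finset.mem_singleton, not_or] at hl
    rw [Equiv.swap_apply_of_ne_of_ne hl.1 hl.2, sub_self, mul_zero]
  rw [Finset.sum_pair hij, Equiv.swap_apply_left, Equiv.swap_apply_right] at h3
  linarith

/-- The total variation distance (times `2`) between the law `q` on permutations and its image
under the transposition of `i` and `j`. -/
def swapDist (q : Equiv.Perm (Fin n) → ℝ) (i j : Fin n) : ℝ :=
  ∑ π, |q π - q (π * Equiv.swap i j)|

theorem swapDist_nonneg (q : Equiv.Perm (Fin n) → ℝ) (i j : Fin n) : 0 ≤ swapDist q i j :=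
  Finset.sum_nonneg fun _ _ => abs_nonneg _

theorem swapDist_self (q : Equiv.Perm (Fin n) → ℝ) (i : Fin n) : swapDist q i i = 0 := by
  simp [swapDist, Equiv.swap_self, ← Equiv.Perm.one_def]

theorem swapDist_le_two {q : Equiv.Perm (Fin n) → ℝ} (hq : ∀ π, 0 ≤ q π) (hq1 : ∑ π, q π ≤ 1)
    (i j : Fin n) : swapDist q i j ≤ 2 := by
  have h1 : ∑ π, q (π * Equiv.swap i j) = ∑ π, q π :=
    Equiv.sum_comp (Equiv.mulRight (Equiv.swap i j)) q
  calc swapDist q i j ≤ ∑ π, (q π + q (π * Equiv.swap i j)) := by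
        refine Finset.sum_le_sum fun π _ => (abs_sub _ _).trans ?_
        rw [abs_of_nonneg (hq _), abs_of_nonneg (hq _)]
    _ ≤ 2 := by rw [Finset.sum_add_distrib, h1]; linarith

variable {q : Equiv.Perm (Fin n) → ℝ} {w v : Fin n → ℝ} {m : ℝ}

/-- Let `F π` be the factor of `q π` and `G` its first factor. Under the transposition `G` changes
sign and the ball difference loses `G` times `(w i - v i) - (w j - v j) ≤ 2 m`, so `F π + F (π τ) ≤
2 m`. An invariant law would thus give at most `m`; lack of invariance costs at most half of
`swapDist`. -/
theorem sum_mul_swap_term_le (hq : ∀ π, 0 ≤ q π) (hq1 : ∑ π, q π ≤ 1)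
    (hw : ∀ i, 0 ≤ w i) (hv : ∀ i, 0 ≤ v i) (hw1 : ∑ i, w i = 1) (hv1 : ∑ i, v i = 1)
    (hwm : ∀ i, w i ≤ m) (hvm : ∀ i, v i ≤ m) (x : Fin n → E) {a b i j : Fin n}
    (hia : a ≠ i) (hja : a ≠ j) (hib : b ≠ i) (hjb : b ≠ j) :
    ∑ π, q π * ((ballIndicator (fun l => x (π l)) a b i -
        ballIndicator (fun l => x (π l)) a b j) * ballDiff (fun l => x (π l)) w v a b) ≤
      swapDist q i j / 2 + m := by
  have hm : 0 ≤ m := (hw a).trans (hwm a)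
  rcases eq_or_ne i j with rfl | hij
  · simp only [sub_self, zero_mul, mul_zero, Finset.sum_const_zero]
    have := swapDist_nonneg q i i
    linarith
  set τ := Equiv.swap i j
  set F : Equiv.Perm (Fin n) → ℝ := fun π => (ballIndicator (fun l => x (π l)) a b i -
    ballIndicator (fun l => x (π l)) a b j) * ballDiff (fun l => x (π l)) w v a b with hF
  have hg : ∀ π : Equiv.Perm (Fin n), |ballIndicator (fun l => x (π l)) a b i -
      ballIndicator (fun l => x (π l)) a b j| ≤ 1 := by
    intro π
    have h1 := ballIndicator_nonneg (fun l => x (π l)) a b i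
    have h2 := ballIndicator_nonneg (fun l => x (π l)) a b j
    have h3 := ballIndicator_le_one (fun l => x (π l)) a b i
    have h4 := ballIndicator_le_one (fun l => x (π l)) a b j
    rw [abs_le]; constructor <;> linarith
  have hF1 : ∀ π, |F π| ≤ 1 := by
    intro π
    rw [hF, abs_mul]
    exact mul_le_one₀ (hg π) (abs_nonneg _) (abs_ballDiff_le hw hv hw1.le hv1.le _ _ _)
  have hF2 : ∀ π, F π + F (π * τ) ≤ 2 * m := by
    intro π
    have h1 := ballDiff_comp_swap (w := w) (v := v) (fun l => x (π l)) hij hia hja hib hjb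
    have h2 := fun l => ballIndicator_comp (fun l => x (π l)) τ
      (Equiv.swap_apply_of_ne_of_ne hia hja) (Equiv.swap_apply_of_ne_of_ne hib hjb) l
    have h3 : F (π * τ) = (ballIndicator (fun l => x (π l)) a b j -
        ballIndicator (fun l => x (π l)) a b i) * (ballDiff (fun l => x (π l)) w v a b -
          ((w i - v i) - (w j - v j)) * (ballIndicator (fun l => x (π l)) a b i -
            ballIndicator (fun l => x (π l)) a b j)) := by
      rw [← h1]
      have h4 := h2 i
      have h5 := h2 j
      rw [Equiv.swap_apply_left] at h4
      rw [Equiv.swap_apply_right] at h5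
      rw [← h4, ← h5]
      rfl
    rw [h3]
    simp only [hF]
    set G := ballIndicator (fun l => x (π l)) a b i - ballIndicator (fun l => x (π l)) a b j with hG
    have h6 : G ^ 2 ≤ 1 := by
      rw [sq_le_one_iff_abs_le_one]; exact hg π
    have h7 : ((w i - v i) - (w j - v j)) ≤ 2 * m := by
      have := hwm i; have := hv i; have := hvm j; have := hw j
      linarith
    have h8 : ballIndicator (fun l => x (π l)) a b j - ballIndicator (fun l => x (π l)) a b i = -G := by
      rw [hG]; ring
    rw [h8]
    have h9 : G ^ 2 * ((w i - v i) - (w j - v j)) ≤ G ^ 2 * (2 * m) :=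
      mul_le_mul_of_nonneg_left h7 (sq_nonneg _)
    nlinarith
  have hre : ∀ f : Equiv.Perm (Fin n) → ℝ, ∑ π, f (π * τ) = ∑ π, f π := fun f =>
    Equiv.sum_comp (Equiv.mulRight τ) f
  -- Average the sum with its image under `π ↦ π τ`: the first part measures the lack of invariance,
  -- the second contains the cancellation.
  have h1 : ∑ π, q π * F π = 1 / 2 * ∑ π, (q π - q (π * τ)) * F π +
      1 / 2 * ∑ π, q (π * τ) * (F π + F (π * τ)) := by
    have h2 := hre fun π => q π * F π
    simp only [sub_mul, mul_add, Finset.sum_sub_distrib, Finset.sum_add_distrib]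
    linarith
  have h3 : ∑ π, (q π - q (π * τ)) * F π ≤ swapDist q i j := by
    refine Finset.sum_le_sum fun π _ => (le_abs_self _).trans ?_
    rw [abs_mul]
    exact mul_le_of_le_one_right (abs_nonneg _) (hF1 π)
  have h4 : ∑ π, q (π * τ) * (F π + F (π * τ)) ≤ 2 * m := by
    calc _ ≤ ∑ π, q (π * τ) * (2 * m) :=
          Finset.sum_le_sum fun π _ => mul_le_mul_of_nonneg_left (hF2 π) (hq _)
      _ = (∑ π, q π) * (2 * m) := by rw [← Finset.sum_mul, hre]
      _ ≤ 1 * (2 * m) := by gcongr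
      _ = 2 * m := one_mul _
  change ∑ π, q π * F π ≤ _
  rw [h1]
  linarith

/-- The crude bound, for pairs whose transposition moves the ball because `i` or `j` is one of `a`,
`b`. -/
theorem sum_mul_swap_term_le_one (hq : ∀ π, 0 ≤ q π) (hq1 : ∑ π, q π ≤ 1)
    (hw : ∀ i, 0 ≤ w i) (hv : ∀ i, 0 ≤ v i) (hw1 : ∑ i, w i = 1) (hv1 : ∑ i, v i = 1)
    (x : Fin n → E) (a b i j : Fin n) :
    ∑ π, q π * ((ballIndicator (fun l => x (π l)) a b i -
        ballIndicator (fun l => x (π l)) a b j) * ballDiff (fun l => x (π l)) w v a b) ≤ 1 := by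
  refine le_trans (Finset.sum_le_sum fun π _ => mul_le_of_le_one_right (hq π) ?_) hq1
  refine (le_abs_self _).trans ?_
  rw [abs_mul]
  refine mul_le_one₀ ?_ (abs_nonneg _) (abs_ballDiff_le hw hv hw1.le hv1.le _ _ _)
  have h1 := ballIndicator_nonneg (fun l => x (π l)) a b i
  have h2 := ballIndicator_nonneg (fun l => x (π l)) a b j
  have h3 := ballIndicator_le_one (fun l => x (π l)) a b i
  have h4 := ballIndicator_le_one (fun l => x (π l)) a b j
  rw [abs_le]; constructor <;> linarith

/-- The mean ball divergence under random relabelling is small if the relabelling law is almost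
invariant under the transpositions of the points that carry the weights. -/
theorem sum_mul_ballSum_le (hq : ∀ π, 0 ≤ q π) (hq1 : ∑ π, q π ≤ 1)
    (hw : ∀ i, 0 ≤ w i) (hv : ∀ i, 0 ≤ v i) (hw1 : ∑ i, w i = 1) (hv1 : ∑ i, v i = 1)
    (hwm : ∀ i, w i ≤ m) (hvm : ∀ i, v i ≤ m) (x : Fin n → E) :
    ∑ π, q π * ballSum (fun l => x (π l)) w v ≤
      ∑ i, ∑ j, w i * v j * swapDist q i j + 10 * m := by
  -- `e` pays for the coincidences of `i` or `j` with `a` or `b`; averaged over `w ⊗ v`, the four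
  -- terms give `w a + v a + w b + v b ≤ 4 m`.
  set e : Fin n → Fin n → ℝ := fun i j => if i = j then 1 else 0
  have he : ∀ i j, 0 ≤ e i j := fun i j => by simp only [e]; split_ifs <;> norm_num
  have hterm : ∀ a b i j, ∑ π, q π * ((ballIndicator (fun l => x (π l)) a b i -
      ballIndicator (fun l => x (π l)) a b j) * ballDiff (fun l => x (π l)) w v a b) ≤
      swapDist q i j / 2 + m + e a i + e a j + e b i + e b j := by
    intro a b i j
    have hm : 0 ≤ m := (hw a).trans (hwm a)
    have h0 := swapDist_nonneg q i j
    have h1 := he a i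
    have h2 := he a j
    have h3 := he b i
    have h4 := he b j
    by_cases hc : a = i ∨ a = j ∨ b = i ∨ b = j
    · refine (sum_mul_swap_term_le_one hq hq1 hw hv hw1 hv1 x a b i j).trans ?_
      rcases hc with h | h | h | h
      · have : e a i = 1 := if_pos h
        linarith
      · have : e a j = 1 := if_pos h
        linarith
      · have : e b i = 1 := if_pos h
        linarith
      · have : e b j = 1 := if_pos h
        linarith
    · simp only [not_or] at hc
      have := sum_mul_swap_term_le hq hq1 hw hv hw1 hv1 hwm hvm x hc.1 hc.2.1 hc.2.2.1 hc.2.2.2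
      linarith
  set S := ∑ i, ∑ j, w i * v j * swapDist q i j
  -- Expand only one of the two factors of the square. The error is `m` from `sum_mul_swap_term_le`
  -- and `4 m` from the coincidences; the final sum over `a`, `b` has total weight `2`, whence `10
  -- m`.
  have hab : ∀ a b, ∑ π, q π * ballDiff (fun l => x (π l)) w v a b ^ 2 ≤ S / 2 + 5 * m := by
    intro a b
    have h1 : ∀ π : Equiv.Perm (Fin n), q π * ballDiff (fun l => x (π l)) w v a b ^ 2 =
        ∑ i, ∑ j, w i * v j * (q π * ((ballIndicator (fun l => x (π l)) a b i -
          ballIndicator (fun l => x (π l)) a b j) * ballDiff (fun l => x (π l)) w v a b)) := by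
      intro π
      rw [sq]
      nth_rewrite 1 [ballDiff_eq_sum_sum hw1 hv1]
      simp only [Finset.sum_mul, Finset.mul_sum]
      refine Finset.sum_congr rfl fun i _ => Finset.sum_congr rfl fun j _ => ?_
      ring
    have h2 : ∑ π, q π * ballDiff (fun l => x (π l)) w v a b ^ 2 =
        ∑ i, ∑ j, w i * v j * ∑ π, (q π * ((ballIndicator (fun l => x (π l)) a b i -
          ballIndicator (fun l => x (π l)) a b j) * ballDiff (fun l => x (π l)) w v a b)) := by
      simp_rw [h1, Finset.mul_sum]
      rw [Finset.sum_comm]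
      exact Finset.sum_congr rfl fun i _ => Finset.sum_comm
    have hsw : ∀ c, ∑ i, ∑ j, w i * v j * e c i = w c := by
      intro c
      simp_rw [mul_right_comm (w _) (v _), ← Finset.mul_sum, hv1]
      simp [e]
    have hsv : ∀ c, ∑ i, ∑ j, w i * v j * e c j = v c := by
      intro c
      simp_rw [mul_assoc, ← Finset.mul_sum, ← Finset.sum_mul, hw1]
      simp [e]
    have h3 : ∑ i, ∑ j, w i * v j *
        (swapDist q i j / 2 + m + e a i + e a j + e b i + e b j) =
        S / 2 + m + w a + v a + w b + v b := by
      have h4 : ∀ i j, w i * v j * (swapDist q i j / 2 + m + e a i + e a j + e b i + e b j) =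
          w i * v j * swapDist q i j * (1 / 2) + w i * v j * m + w i * v j * e a i +
            w i * v j * e a j + w i * v j * e b i + w i * v j * e b j := fun i j => by ring
      simp_rw [h4, Finset.sum_add_distrib, hsw, hsv, ← Finset.sum_mul, ← Finset.mul_sum, hv1,
        ← Finset.sum_mul, mul_one, hw1]
      ring
    rw [h2]
    refine (Finset.sum_le_sum fun i _ => Finset.sum_le_sum fun j _ =>
      mul_le_mul_of_nonneg_left (hterm a b i j) (mul_nonneg (hw i) (hv j))).trans ?_
    rw [h3]
    have := hwm a; have := hwm b; have := hvm a; have := hvm b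
    linarith
  have h5 : ∑ π, q π * ballSum (fun l => x (π l)) w v =
      ∑ a, ∑ b, (w a * w b + v a * v b) *
        ∑ π, q π * ballDiff (fun l => x (π l)) w v a b ^ 2 := by
    simp_rw [ballSum, Finset.mul_sum]
    rw [Finset.sum_comm]
    refine Finset.sum_congr rfl fun a _ => ?_
    rw [Finset.sum_comm]
    exact Finset.sum_congr rfl fun b _ => Finset.sum_congr rfl fun π _ => by ring
  rw [h5]
  calc _ ≤ ∑ a, ∑ b, (w a * w b + v a * v b) * (S / 2 + 5 * m) :=
        Finset.sum_le_sum fun a _ => Finset.sum_le_sum fun b _ =>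
          mul_le_mul_of_nonneg_left (hab a b)
            (add_nonneg (mul_nonneg (hw a) (hw b)) (mul_nonneg (hv a) (hv b)))
    _ = S + 10 * m := by
        simp_rw [← Finset.sum_mul]
        rw [sum_sum_weights, hw1, hv1]
        ring

/-- The bound `sum_mul_ballSum_le` with the transpositions of a given point `s` left out. -/
theorem sum_mul_ballSum_le_of_ne (hq : ∀ π, 0 ≤ q π) (hq1 : ∑ π, q π ≤ 1)
    (hw : ∀ i, 0 ≤ w i) (hv : ∀ i, 0 ≤ v i) (hw1 : ∑ i, w i = 1) (hv1 : ∑ i, v i = 1)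
    (hwm : ∀ i, w i ≤ m) (hvm : ∀ i, v i ≤ m) (x : Fin n → E) (s : Fin n) :
    ∑ π, q π * ballSum (fun l => x (π l)) w v ≤
      ∑ i, ∑ j, (if i ≠ s ∧ j ≠ s ∧ i ≠ j then w i * v j * swapDist q i j else 0) + 14 * m := by
  refine (sum_mul_ballSum_le hq hq1 hw hv hw1 hv1 hwm hvm x).trans ?_
  -- The pairs that involve `s` cost at most `2 w s + 2 v s ≤ 4 m`, which raises `10 m` to `14 m`.
  -- The remaining indices `s`, `i`, `j` are distinct, so these observations are independent.
  have h1 : ∀ i j, w i * v j * swapDist q i j ≤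
      (if i ≠ s ∧ j ≠ s ∧ i ≠ j then w i * v j * swapDist q i j else 0) +
        (if i = s then 2 * (w i * v j) else 0) + (if j = s then 2 * (w i * v j) else 0) := by
    intro i j
    have h0 : 0 ≤ w i * v j := mul_nonneg (hw i) (hv j)
    have h2 : w i * v j * swapDist q i j ≤ 2 * (w i * v j) := by
      rw [mul_comm 2]
      exact mul_le_mul_of_nonneg_left (swapDist_le_two hq hq1 i j) h0
    by_cases hi : i = s
    · simp only [hi, ne_eq, not_true, false_and, if_false, if_true, zero_add]
      rw [hi] at h2 h0
      split_ifs <;> linarith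
    by_cases hj : j = s
    · simp only [hi, hj, ne_eq, not_true, false_and, and_false, if_false, if_true, zero_add]
      rw [hj] at h2
      linarith
    by_cases hij : i = j
    · subst hij
      simp [swapDist_self, hi]
    · simp [hi, hj, hij]
  have h2 : ∑ i, ∑ j, w i * v j * swapDist q i j ≤
      ∑ i, ∑ j, (if i ≠ s ∧ j ≠ s ∧ i ≠ j then w i * v j * swapDist q i j else 0) +
        2 * w s + 2 * v s := by
    refine (Finset.sum_le_sum fun i _ => Finset.sum_le_sum fun j _ => h1 i j).trans (le_of_eq ?_)
    simp_rw [Finset.sum_add_distrib]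
    congr 1
    · congr 1
      rw [Finset.sum_comm]
      simp [← Finset.mul_sum, hv1]
    · simp [← Finset.mul_sum, ← Finset.sum_mul, hw1]
  have := hwm s; have := hvm s
  linarith

end BallSum

/-! ### Ball divergences of discrete measures as finite sums -/

section BallDivergenceFormula

variable {n : ℕ}

theorem integral_weightedEmpirical {E : Type*} [MeasurableSpace E] [MeasurableSingletonClass E] (x : Fin n → E) {W : Fin n → ℝ} (hW : ∀ i, 0 ≤ W i)
    (f : E → ℝ) :
    ∫ u, f u ∂weightedEmpirical x W = ∑ i, W i / (∑ k, W k) * f (x i) := by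
  have h0 : ∀ i, 0 ≤ W i / ∑ k, W k := fun i =>
    div_nonneg (hW i) (Finset.sum_nonneg fun k _ => hW k)
  rw [weightedEmpirical, integral_finsetSum_measure fun i _ =>
    (integrable_dirac (by simp)).smul_measure ENNReal.ofReal_ne_top]
  refine Finset.sum_congr rfl fun i _ => ?_
  rw [integral_smul_measure, integral_dirac, ENNReal.toReal_ofReal (h0 i), smul_eq_mul]

variable {E : Type*} [PseudoMetricSpace E] [MeasurableSpace E] [MeasurableSingletonClass E]
  [OpensMeasurableSpace E]

theorem weightedEmpirical_real_closedBall (x : Fin n → E) {W : Fin n → ℝ} (hW : ∀ i, 0 ≤ W i)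
    (a b : Fin n) :
    (weightedEmpirical x W).real (Metric.closedBall (x b) (dist (x a) (x b))) =
      ∑ i, W i / (∑ k, W k) * ballIndicator x a b i := by
  classical
  rw [← integral_indicator_one Metric.isClosed_closedBall.measurableSet,
    integral_weightedEmpirical x hW]
  refine Finset.sum_congr rfl fun i _ => ?_
  simp [ballIndicator, Set.indicator_apply]

/-- No positivity of the total weights is needed: if a total is zero, the measure and the normalised
weights are both zero. -/
theorem ballDivergence_weightedEmpirical (x : Fin n → E) {W V : Fin n → ℝ} (hW : ∀ i, 0 ≤ W i)
    (hV : ∀ i, 0 ≤ V i) :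
    ballDivergence (weightedEmpirical x W) (weightedEmpirical x V) =
      ballSum x (fun i => W i / ∑ k, W k) (fun i => V i / ∑ k, V k) := by
  rw [ballDivergence, integral_weightedEmpirical x hW, integral_weightedEmpirical x hV]
  simp_rw [integral_weightedEmpirical x hW, integral_weightedEmpirical x hV,
    weightedEmpirical_real_closedBall x hW, weightedEmpirical_real_closedBall x hV,
    ← Finset.sum_sub_distrib, ← sub_mul, Finset.mul_sum, ← Finset.sum_add_distrib]
  rw [ballSum]
  refine Finset.sum_congr rfl fun a _ => Finset.sum_congr rfl fun b _ => ?_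
  rw [ballDiff]
  ring

end BallDivergenceFormula

/-! ### Kernel averages of independent observations -/

section KernelAverage

theorem enorm_sub_le_of_ofReal_le {a b : ℝ} {A : ℝ≥0∞} (ha : 0 ≤ a) (hb : 0 ≤ b)
    (h1 : ENNReal.ofReal a ≤ ENNReal.ofReal b + A) (h2 : ENNReal.ofReal b ≤ ENNReal.ofReal a + A) :
    ‖a - b‖ₑ ≤ A := by
  rcases eq_or_ne A ∞ with rfl | hA
  · exact le_top
  lift A to ℝ≥0 using hA
  rw [← ENNReal.ofReal_coe_nnreal, ← ENNReal.ofReal_add hb A.coe_nonneg,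
    ENNReal.ofReal_le_ofReal_iff (by positivity)] at h1
  rw [← ENNReal.ofReal_coe_nnreal, ← ENNReal.ofReal_add ha A.coe_nonneg,
    ENNReal.ofReal_le_ofReal_iff (by positivity)] at h2
  rw [Real.enorm_eq_ofReal_abs, ← ENNReal.ofReal_coe_nnreal]
  refine ENNReal.ofReal_le_ofReal ?_
  rw [abs_le]
  constructor <;> linarith

theorem ofReal_le_ofReal_add_enorm_sub (a b : ℝ) :
    ENNReal.ofReal a ≤ ENNReal.ofReal b + ‖a - b‖ₑ := by
  rw [Real.enorm_eq_ofReal_abs]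
  refine le_trans (ENNReal.ofReal_le_ofReal ?_) ENNReal.ofReal_add_le
  linarith [le_abs_self (a - b)]

/-- For large `n` the kernel lives where `ω ≤ ε`, and its mass is at most one. -/
theorem tendsto_lintegral_kernel_mul {V : Type*} [TopologicalSpace V] [Zero V] [MeasurableSpace V]
    {μ : Measure V} {ω : V → ℝ≥0∞} (hω : Tendsto ω (𝓝 0) (𝓝 0)) {k : ℕ → V → ℝ≥0∞}
    (hk : ∀ n, Measurable (k n)) (hint : ∀ n, ∫⁻ u, k n u ∂μ ≤ 1)
    (hsupp : ∀ U ∈ 𝓝 (0 : V), ∀ᶠ n in atTop, ∀ u, u ∉ U → k n u = 0) :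
    Tendsto (fun n => ∫⁻ u, k n u * ω u ∂μ) atTop (𝓝 0) := by
  rw [ENNReal.tendsto_nhds_zero]
  intro ε hε
  have hU : {u | ω u ≤ ε} ∈ 𝓝 (0 : V) := (ENNReal.tendsto_nhds_zero.1 hω) ε hε
  filter_upwards [hsupp _ hU] with n hn
  calc ∫⁻ u, k n u * ω u ∂μ ≤ ∫⁻ u, k n u * ε ∂μ := by
        refine lintegral_mono fun u => ?_
        by_cases hu : ω u ≤ ε
        · exact mul_le_mul_right hu _
        · simp [hn u hu]
    _ = (∫⁻ u, k n u ∂μ) * ε := lintegral_mul_const _ (hk n)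
    _ ≤ 1 * ε := mul_le_mul_left (hint n) _
    _ = ε := one_mul ε

variable {S V : Type*} [MeasurableSpace S] {P : Measure S} [IsProbabilityMeasure P]
  [AddCommGroup V] [MeasurableSpace V] [MeasurableAdd₂ V] [MeasurableNeg V]
  {μ : Measure V} [SigmaFinite μ] [μ.IsAddLeftInvariant] [μ.IsNegInvariant]
  {vm : S → V} {k : V → ℝ} {φ : S → ℝ} {ψ : V → ℝ} {B : ℝ} {C : ℝ≥0}

/-- The bias of the kernel average: its mean is the convolution of `k` with `ψ`, and `ψ v` is the
average of the constant `ψ v` against the same kernel. -/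
theorem enorm_integral_kernel_sub_le (hvm : Measurable vm) (hk : Measurable k)
    (hk0 : ∀ u, 0 ≤ k u) (hkB : ∀ u, k u ≤ B) (hk1 : ∫⁻ u, ENNReal.ofReal (k u) ∂μ = 1)
    (hφ : Measurable φ) (hφ0 : ∀ w, 0 ≤ φ w) (hφ1 : ∀ w, φ w ≤ 1)
    (hψ : Measurable ψ) (hψ0 : ∀ v, 0 ≤ ψ v)
    (hlaw : ∀ H : V → ℝ≥0∞, Measurable H →
      ∫⁻ w, ENNReal.ofReal (φ w) * H (vm w) ∂P = ∫⁻ v, ENNReal.ofReal (ψ v) * H v ∂μ) (v : V) :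
    ‖∫ w, k (v - vm w) * φ w ∂P - ψ v‖ₑ ≤
      ∫⁻ u, ENNReal.ofReal (k u) * ‖ψ (v - u) - ψ v‖ₑ ∂μ := by
  have hkv : Measurable fun v' => k (v - v') := hk.comp (measurable_id.const_sub v)
  have hnn : ∀ w, 0 ≤ k (v - vm w) * φ w := fun w => mul_nonneg (hk0 _) (hφ0 w)
  have hmeas : Measurable fun w => k (v - vm w) * φ w := (hkv.comp hvm).mul hφ
  have hint : Integrable (fun w => k (v - vm w) * φ w) P := by
    refine Integrable.of_bound hmeas.aestronglyMeasurable B (Eventually.of_forall fun w => ?_)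
    rw [Real.norm_of_nonneg (hnn w)]
    exact (mul_le_of_le_one_right (hk0 _) (hφ1 w)).trans (hkB _)
  have hm : ENNReal.ofReal (∫ w, k (v - vm w) * φ w ∂P) =
      ∫⁻ u, ENNReal.ofReal (k u) * ENNReal.ofReal (ψ (v - u)) ∂μ := by
    rw [ofReal_integral_eq_lintegral_ofReal hint (Eventually.of_forall hnn)]
    have h1 : ∀ w, ENNReal.ofReal (k (v - vm w) * φ w) =
        ENNReal.ofReal (φ w) * ENNReal.ofReal (k (v - vm w)) := fun w => by
      rw [mul_comm, ENNReal.ofReal_mul (hφ0 w)]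
    simp_rw [h1]
    rw [hlaw (fun v' => ENNReal.ofReal (k (v - v'))) hkv.ennreal_ofReal,
      ← lintegral_sub_left_eq_self _ v]
    refine lintegral_congr fun u => ?_
    rw [sub_sub_cancel, mul_comm]
  have hkm := hk.ennreal_ofReal
  have hψv : Measurable fun u => ψ (v - u) := hψ.comp (measurable_id.const_sub v)
  have hψ1 : ENNReal.ofReal (ψ v) = ∫⁻ u, ENNReal.ofReal (k u) * ENNReal.ofReal (ψ v) ∂μ := by
    rw [lintegral_mul_const _ hkm, hk1, one_mul]
  refine enorm_sub_le_of_ofReal_le (integral_nonneg hnn) (hψ0 v) ?_ ?_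
  · rw [hm, hψ1, ← lintegral_add_left (hkm.mul_const _)]
    refine lintegral_mono fun u => ?_
    rw [← mul_add]
    exact mul_le_mul_right (ofReal_le_ofReal_add_enorm_sub _ _) _
  · have hmul : Measurable fun u => ENNReal.ofReal (k u) * ENNReal.ofReal (ψ (v - u)) :=
      hkm.mul hψv.ennreal_ofReal
    rw [hm, hψ1, ← lintegral_add_left hmul]
    refine lintegral_mono fun u => ?_
    rw [← mul_add, enorm_sub_rev]
    exact mul_le_mul_right (ofReal_le_ofReal_add_enorm_sub _ _) _

/-- A law of large numbers in mean. As `0 ≤ X ≤ B`, the variance of `X` is at most `B` times its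
mean, hence at most `B C`; keeping the mean instead of another factor `B` is what makes the bound
useful for kernels of height `h⁻ᵈ`. -/
theorem lintegral_enorm_average_sub_le {n : ℕ} (hn : 0 < n) {X : S → ℝ} (hX : Measurable X)
    (hX0 : ∀ w, 0 ≤ X w) (hXB : ∀ w, X w ≤ B) {C : ℝ} (hXC : ∫ w, X w ∂P ≤ C) {δ : ℝ}
    (hδ : 0 < δ) :
    ∫⁻ D, ‖(1 / (n : ℝ)) * ∑ i, X (D i) - ∫ w, X w ∂P‖ₑ ∂Measure.pi (fun _ : Fin n => P) ≤
      ENNReal.ofReal (δ + B * C / (n * δ)) := by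
  have hn' : (0 : ℝ) < n := Nat.cast_pos.2 hn
  have hB : ∀ w, ‖X w‖ ≤ B := fun w => by rw [Real.norm_of_nonneg (hX0 w)]; exact hXB w
  obtain ⟨w0⟩ : Nonempty S := nonempty_of_isProbabilityMeasure P
  have hB0 : 0 ≤ B := (hX0 w0).trans (hXB w0)
  have hLp : MemLp X 2 P := MemLp.of_bound hX.aestronglyMeasurable B (Eventually.of_forall hB)
  have hint : Integrable X P := hLp.integrable (by norm_num)
  set Q : Measure (Fin n → S) := Measure.pi fun _ : Fin n => P
  set m := ∫ w, X w ∂P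
  set f : (Fin n → S) → ℝ := ∑ i : Fin n, fun D => X (D i) with hf
  have hfD : ∀ D, f D = ∑ i, X (D i) := fun D => by simp [hf]
  have hXi : ∀ i : Fin n, MeasurePreserving (fun D : Fin n → S => D i) Q P := fun i =>
    measurePreserving_eval (fun _ : Fin n => P) i
  have hfLp : MemLp f 2 Q := by
    rw [hf]
    exact memLp_finsetSum' _ fun i _ => hLp.comp_measurePreserving (hXi i)
  have hvar : variance f Q ≤ n * (B * C) := by
    have h1 : variance f Q = ∑ _i : Fin n, variance X P :=
      variance_sum_pi (μ := fun _ : Fin n => P) (X := fun _ => X) fun _ => hLp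
    have h2 : variance X P ≤ B * C := by
      refine (variance_le_expectation_sq hX.aestronglyMeasurable).trans ?_
      calc ∫ w, (X ^ 2) w ∂P ≤ ∫ w, B * X w ∂P := by
            refine integral_mono hLp.integrable_sq (hint.const_mul B) fun w => ?_
            simp only [Pi.pow_apply]
            rw [sq]
            exact mul_le_mul_of_nonneg_right (hXB w) (hX0 w)
        _ = B * m := integral_const_mul _ _
        _ ≤ B * C := mul_le_mul_of_nonneg_left hXC hB0
    rw [h1]
    simp only [Finset.sum_const, Finset.card_univ, Fintype.card_fin, nsmul_eq_mul]
    exact mul_le_mul_of_nonneg_left h2 hn'.le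
  have hmean : ∫ D, f D ∂Q = n * m := by
    simp_rw [hfD]
    have hXint : ∀ i : Fin n, Integrable (fun D : Fin n → S => X (D i)) Q := fun i =>
      (hXi i).integrable_comp_of_integrable hint
    rw [integral_finsetSum _ fun i _ => hXint i]
    have : ∀ i : Fin n, ∫ D, X (D i) ∂Q = m := fun i =>
      integral_comp_eval (μ := fun _ : Fin n => P) hX.aestronglyMeasurable
    simp [this]
  have hsq : Integrable (fun D => (f D - n * m) ^ 2) Q :=
    (hfLp.sub (memLp_const (n * m))).integrable_sq
  have hvar' : ∫ D, (f D - n * m) ^ 2 ∂Q ≤ n * (B * C) := by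
    rw [← hmean, ← variance_eq_integral hfLp.aestronglyMeasurable.aemeasurable]
    exact hvar
  calc ∫⁻ D, ‖(1 / (n : ℝ)) * ∑ i, X (D i) - m‖ₑ ∂Q
      ≤ ∫⁻ D, ENNReal.ofReal (δ + (f D - n * m) ^ 2 / (n ^ 2 * δ)) ∂Q := by
        refine lintegral_mono fun D => ?_
        rw [Real.enorm_eq_ofReal_abs, ← hfD]
        refine ENNReal.ofReal_le_ofReal ?_
        set t := 1 / (n : ℝ) * f D - m with ht
        have h1 : f D - n * m = n * t := by rw [ht]; field_simp
        rw [h1, mul_pow, mul_div_mul_left _ _ (by positivity)]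
        -- That is `|t| ≤ δ + t² / δ`, which bounds the first moment by the second without a square
        -- root.
        have h2 : |t| * δ ≤ δ * δ + t ^ 2 := by nlinarith [sq_nonneg (|t| - δ), sq_abs t, abs_nonneg t]
        rw [← sub_nonneg] at h2 ⊢
        have h3 : δ + t ^ 2 / δ - |t| = (δ * δ + t ^ 2 - |t| * δ) / δ := by field_simp
        rw [h3]
        exact div_nonneg h2 hδ.le
    _ = ENNReal.ofReal (∫ D, (δ + (f D - n * m) ^ 2 / (n ^ 2 * δ)) ∂Q) := by
        have hint' : Integrable (fun D => δ + (f D - n * m) ^ 2 / (n ^ 2 * δ)) Q :=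
          (integrable_const _).add (hsq.div_const _)
        rw [ofReal_integral_eq_lintegral_ofReal hint']
        exact Eventually.of_forall fun D => by positivity
    _ ≤ ENNReal.ofReal (δ + B * C / (n * δ)) := by
        refine ENNReal.ofReal_le_ofReal ?_
        rw [integral_add (integrable_const _) (hsq.div_const _), integral_div]
        simp only [integral_const, probReal_univ, one_smul]
        have h3 : (∫ D, (f D - n * m) ^ 2 ∂Q) / (n ^ 2 * δ) ≤ n * (B * C) / (n ^ 2 * δ) := by
          gcongr
        have h4 : n * (B * C) / ((n : ℝ) ^ 2 * δ) = B * C / (n * δ) := by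
          field_simp
        linarith

/-- The kernel average `(1/n) ∑ i, k(v_s - v_i) φ_i` at the `s`-th observation. -/
def kernelAverage (vm : S → V) (k : V → ℝ) (φ : S → ℝ) {n : ℕ} (D : Fin n → S) (s : Fin n) : ℝ :=
  (1 / (n : ℝ)) * ∑ i, k (vm (D s) - vm (D i)) * φ (D i)

/-- The mean distance of the kernel average at an observation from the density `ψ`. -/
theorem lintegral_kernelAverage_sub_le (hvm : Measurable vm) (hk : Measurable k)
    (hk0 : ∀ u, 0 ≤ k u) (hkB : ∀ u, k u ≤ B) (hk1 : ∫⁻ u, ENNReal.ofReal (k u) ∂μ = 1)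
    (hφ : Measurable φ) (hφ0 : ∀ w, 0 ≤ φ w) (hφ1 : ∀ w, φ w ≤ 1)
    (hψ : Measurable ψ) (hψ0 : ∀ v, 0 ≤ ψ v)
    (hlaw : ∀ H : V → ℝ≥0∞, Measurable H →
      ∫⁻ w, ENNReal.ofReal (φ w) * H (vm w) ∂P = ∫⁻ v, ENNReal.ofReal (ψ v) * H v ∂μ)
    (hC : ∀ H : V → ℝ≥0∞, Measurable H → ∫⁻ w, H (vm w) ∂P ≤ C * ∫⁻ v, H v ∂μ)
    {n : ℕ} (s : Fin n) {δ : ℝ} (hδ : 0 < δ) :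
    ∫⁻ D, ‖kernelAverage vm k φ D s - ψ (vm (D s))‖ₑ ∂Measure.pi (fun _ : Fin n => P) ≤
      ENNReal.ofReal (B / n) + ENNReal.ofReal (δ + B * C / (n * δ)) +
        C * ∫⁻ u, ENNReal.ofReal (k u) * ∫⁻ v, ‖ψ (v - u) - ψ v‖ₑ ∂μ ∂μ := by
  have hn : 0 < n := s.pos
  have hn' : (0 : ℝ) < n := Nat.cast_pos.2 hn
  have hkv : ∀ v : V, Measurable fun w => k (v - vm w) := fun v =>
    hk.comp (hvm.const_sub v)
  have hvi : ∀ i : Fin n, Measurable fun D : Fin n → S => vm (D i) := fun i =>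
    hvm.comp (measurable_pi_apply i)
  have hmeas : Measurable fun D : Fin n → S => ‖kernelAverage vm k φ D s - ψ (vm (D s))‖ₑ := by
    refine Measurable.enorm (Measurable.sub ?_ (hψ.comp (hvi s)))
    refine (Finset.measurable_sum _ fun i _ => Measurable.mul ?_
      (hφ.comp (measurable_pi_apply i))).const_mul _
    exact hk.comp ((hvi s).sub (hvi i))
  have hmean : ∀ v, ∫ w, k (v - vm w) * φ w ∂P ≤ C := by
    intro v
    have hnn : ∀ w, 0 ≤ k (v - vm w) * φ w := fun w => mul_nonneg (hk0 _) (hφ0 w)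
    rw [integral_eq_lintegral_of_nonneg_ae (Eventually.of_forall hnn)
      ((hkv v).mul hφ).aestronglyMeasurable]
    refine ENNReal.toReal_le_coe_of_le_coe ?_
    calc ∫⁻ w, ENNReal.ofReal (k (v - vm w) * φ w) ∂P
        ≤ ∫⁻ w, ENNReal.ofReal (k (v - vm w)) ∂P :=
          lintegral_mono fun w => ENNReal.ofReal_le_ofReal
            (mul_le_of_le_one_right (hk0 _) (hφ1 w))
      _ ≤ C * ∫⁻ v', ENNReal.ofReal (k (v - v')) ∂μ :=
          hC (fun v' => ENNReal.ofReal (k (v - v')))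
            (hk.comp (measurable_id.const_sub v)).ennreal_ofReal
      _ = C := by
          rw [lintegral_sub_left_eq_self (fun u => ENNReal.ofReal (k u)) v, hk1, mul_one]
  have hmod : Measurable fun q : V × V => ENNReal.ofReal (k q.2) * ‖ψ (q.1 - q.2) - ψ q.1‖ₑ :=
    (hk.comp measurable_snd).ennreal_ofReal.mul
      (((hψ.comp (measurable_fst.sub measurable_snd)).sub (hψ.comp measurable_fst)).enorm)
  have hmod' : Measurable fun v => ∫⁻ u, ENNReal.ofReal (k u) * ‖ψ (v - u) - ψ v‖ₑ ∂μ :=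
    hmod.lintegral_prod_right'
  -- The evaluation point is itself an observation. Resampling coordinate `s` makes it independent
  -- of the sample, at the price `B / n` for the single term `i = s`; what remains splits into
  -- fluctuation and bias at a fixed point.
  have hupd : ∀ (D : Fin n → S) (w : S),
      ‖kernelAverage vm k φ (Function.update D s w) s - ψ (vm w)‖ₑ ≤
        ENNReal.ofReal (B / n) + (‖(1 / (n : ℝ)) * ∑ i, k (vm w - vm (D i)) * φ (D i) -
          ∫ w', k (vm w - vm w') * φ w' ∂P‖ₑ +
          ∫⁻ u, ENNReal.ofReal (k u) * ‖ψ (vm w - u) - ψ (vm w)‖ₑ ∂μ) := by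
    intro D w
    have h1 : |kernelAverage vm k φ (Function.update D s w) s -
        (1 / (n : ℝ)) * ∑ i, k (vm w - vm (D i)) * φ (D i)| ≤ B / n := by
      have h2 : kernelAverage vm k φ (Function.update D s w) s -
          (1 / (n : ℝ)) * ∑ i, k (vm w - vm (D i)) * φ (D i) =
          1 / n * (k (vm w - vm w) * φ w - k (vm w - vm (D s)) * φ (D s)) := by
        rw [kernelAverage, ← mul_sub, ← Finset.sum_sub_distrib]
        congr 1
        rw [Finset.sum_eq_single s]
        · simp
        · intro i _ hi
          simp [Function.update_of_ne hi]
        · simp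
      have h3 : ∀ w', 0 ≤ k (vm w - vm w') * φ w' ∧ k (vm w - vm w') * φ w' ≤ B := fun w' =>
        ⟨mul_nonneg (hk0 _) (hφ0 _), (mul_le_of_le_one_right (hk0 _) (hφ1 w')).trans (hkB _)⟩
      have h4 : |k (vm w - vm w) * φ w - k (vm w - vm (D s)) * φ (D s)| ≤ B := by
        have h5 := h3 w
        have h6 := h3 (D s)
        rw [abs_le]
        constructor <;> linarith
      rw [h2, abs_mul, abs_of_pos (by positivity), one_div_mul_eq_div]
      gcongr
    set a1 := kernelAverage vm k φ (Function.update D s w) s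
    set a2 := (1 / (n : ℝ)) * ∑ i, k (vm w - vm (D i)) * φ (D i)
    set a3 := ∫ w', k (vm w - vm w') * φ w' ∂P
    calc ‖a1 - ψ (vm w)‖ₑ = ‖(a1 - a2) + ((a2 - a3) + (a3 - ψ (vm w)))‖ₑ := by congr 1; ring
      _ ≤ ‖a1 - a2‖ₑ + ‖(a2 - a3) + (a3 - ψ (vm w))‖ₑ := enorm_add_le _ _
      _ ≤ ‖a1 - a2‖ₑ + (‖a2 - a3‖ₑ + ‖a3 - ψ (vm w)‖ₑ) := add_le_add le_rfl (enorm_add_le _ _)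
      _ ≤ _ := by
          refine add_le_add ?_ (add_le_add le_rfl ?_)
          · rw [Real.enorm_eq_ofReal_abs]
            exact ENNReal.ofReal_le_ofReal h1
          · exact enorm_integral_kernel_sub_le hvm hk hk0 hkB hk1 hφ hφ0 hφ1 hψ hψ0 hlaw (vm w)
  have hG : Measurable fun q : (Fin n → S) × S =>
      ‖kernelAverage vm k φ (Function.update q.1 s q.2) s - ψ (vm q.2)‖ₑ := by
    have hu : Measurable fun q : (Fin n → S) × S => Function.update q.1 s q.2 := by
      refine measurable_pi_lambda _ fun i => ?_
      rcases eq_or_ne i s with rfl | hi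
      · simpa using measurable_snd
      · simpa [Function.update_of_ne hi, Function.comp_def] using
          (measurable_pi_apply i).comp (measurable_fst (α := Fin n → S) (β := S))
    have := hmeas.comp hu
    simpa [Function.comp_def] using this
  rw [lintegral_pi_update (fun _ : Fin n => P) s hmeas]
  simp only [Function.update_self]
  rw [lintegral_lintegral_swap hG.aemeasurable]
  calc _ ≤ ∫⁻ w, (ENNReal.ofReal (B / n) + (ENNReal.ofReal (δ + B * C / (n * δ)) +
          ∫⁻ u, ENNReal.ofReal (k u) * ‖ψ (vm w - u) - ψ (vm w)‖ₑ ∂μ)) ∂P := by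
        refine lintegral_mono fun w => ?_
        refine (lintegral_mono fun D => hupd D w).trans ?_
        have hA : Measurable fun D : Fin n → S =>
            ‖(1 / (n : ℝ)) * ∑ i, k (vm w - vm (D i)) * φ (D i) -
              ∫ w', k (vm w - vm w') * φ w' ∂P‖ₑ := by
          refine Measurable.enorm (Measurable.sub_const (Measurable.const_mul ?_ _) _)
          exact Finset.measurable_sum _ fun i _ =>
            (((hkv (vm w)).mul hφ).comp (measurable_pi_apply i))
        rw [lintegral_add_left measurable_const, lintegral_add_left hA]
        simp only [lintegral_const, measure_univ, mul_one]
        gcongr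
        exact lintegral_enorm_average_sub_le hn ((hkv (vm w)).mul hφ)
          (fun w' => mul_nonneg (hk0 _) (hφ0 w'))
          (fun w' => (mul_le_of_le_one_right (hk0 _) (hφ1 w')).trans (hkB _)) (hmean (vm w)) hδ
    _ = ENNReal.ofReal (B / n) + ENNReal.ofReal (δ + B * C / (n * δ)) +
          ∫⁻ w, (∫⁻ u, ENNReal.ofReal (k u) * ‖ψ (vm w - u) - ψ (vm w)‖ₑ ∂μ) ∂P := by
        rw [lintegral_add_left measurable_const, lintegral_add_left measurable_const]
        simp only [lintegral_const, measure_univ, mul_one, add_assoc]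
    _ ≤ _ := by
        gcongr
        -- The bound on the density of `vm` allows the bias to be integrated against `μ`, where it
        -- becomes an `L¹` modulus of continuity of `ψ`.
        refine (hC _ hmod').trans ?_
        rw [lintegral_lintegral_swap hmod.aemeasurable]
        refine mul_le_mul_right (le_of_eq ?_) _
        refine lintegral_congr fun u => ?_
        rw [lintegral_const_mul]
        exact ((hψ.comp (measurable_id.sub_const u)).sub hψ).enorm

end KernelAverage

/-! ### Scaled kernels -/

section ScaledKernel

/-- The kernel `z ↦ h⁻ᵈ K(‖z‖ / h)` on `ℝ^d`. -/
def kernelZ {dZ : ℕ} (K : ℝ → ℝ) (h : ℝ) (z : Rd dZ) : ℝ := (h ^ dZ)⁻¹ * K (‖z‖ / h)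

/-- The kernel `(y, z) ↦ h⁻ᵈ K(‖(y, z)‖ / h)` on `ℝ^{dY} × ℝ^{dZ}`. -/
def kernelYZ {dY dZ : ℕ} (K : ℝ → ℝ) (h : ℝ) (v : Rd dY × Rd dZ) : ℝ :=
  (h ^ (dY + dZ))⁻¹ * K (‖(WithLp.toLp 2 v : RdPair dY dZ)‖ / h)

variable {d dY dZ : ℕ} {K : ℝ → ℝ} {h : ℝ}

/-- The kernel is radial, so its integral is the same on every Euclidean space of dimension `d`;
this covers both `Rd d` and `RdPair`. -/
theorem KernelAssumption.integral_scaled (hK : KernelAssumption d K) (hh : 0 < h)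
    {E : Type*} [NormedAddCommGroup E] [InnerProductSpace ℝ E] [FiniteDimensional ℝ E]
    [MeasurableSpace E] [BorelSpace E] (hE : Module.finrank ℝ E = d) :
    Integrable (fun u : E => (h ^ d)⁻¹ * K (‖u‖ / h)) ∧
      ∫ u : E, (h ^ d)⁻¹ * K (‖u‖ / h) = 1 := by
  have h1 : ∫ u : E, (h ^ d)⁻¹ * K (‖u‖ / h) = 1 := by
    let e : E ≃ₗᵢ[ℝ] Rd d := ((stdOrthonormalBasis ℝ E).reindex (finCongr hE)).repr
    have he : MeasurePreserving e :=
      ((stdOrthonormalBasis ℝ E).reindex (finCongr hE)).measurePreserving_repr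
    have h2 : ∫ u : E, K ‖u‖ = 1 := by
      rw [← hK.integral_eq_one,
        ← he.integral_comp e.toHomeomorph.measurableEmbedding (fun u : Rd d => K ‖u‖)]
      simp
    have h3 := Measure.integral_comp_inv_smul (volume : Measure E) (fun u => K ‖u‖) h
    rw [h2, hE, abs_of_pos (pow_pos hh d)] at h3
    rw [integral_const_mul]
    have h4 : ∀ u : E, K (‖u‖ / h) = K ‖h⁻¹ • u‖ := fun u => by
      rw [norm_smul, norm_inv, Real.norm_of_nonneg hh.le, div_eq_inv_mul]
    simp_rw [h4]
    rw [h3, smul_eq_mul, mul_one, inv_mul_cancel₀ (pow_pos hh d).ne']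
  refine ⟨?_, h1⟩
  -- Integrability is read off the value: the integral of a non-integrable function is zero by
  -- convention, not one.
  by_contra hcon
  rw [integral_undef hcon] at h1
  exact zero_ne_one h1

theorem KernelAssumption.exists_support (hK : KernelAssumption d K) :
    ∃ R : ℝ, 0 < R ∧ ∀ r, R < r → K r = 0 := by
  obtain ⟨R, hR⟩ := hK.compact_support.isCompact.isBounded.subset_closedBall 0
  refine ⟨max R 1, by positivity, fun r hr => ?_⟩
  by_contra hne
  have h1 := hR (subset_tsupport K hne)
  rw [mem_closedBall_zero_iff, Real.norm_eq_abs] at h1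
  have := le_abs_self r
  have := le_max_left R 1
  linarith

theorem measurable_kernelZ (hK : Measurable K) : Measurable (kernelZ K h : Rd dZ → ℝ) :=
  (hK.comp (measurable_norm.div_const h)).const_mul _

theorem measurable_kernelYZ (hK : Measurable K) :
    Measurable (kernelYZ K h : Rd dY × Rd dZ → ℝ) :=
  (hK.comp ((measurable_norm.comp (WithLp.prod_continuous_toLp 2 _ _).measurable).div_const
    h)).const_mul _

theorem kernelZ_nonneg (hK : ∀ r, 0 ≤ K r) (hh : 0 < h) (z : Rd dZ) : 0 ≤ kernelZ K h z :=
  mul_nonneg (by positivity) (hK _)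

theorem kernelYZ_nonneg (hK : ∀ r, 0 ≤ K r) (hh : 0 < h) (v : Rd dY × Rd dZ) :
    0 ≤ kernelYZ K h v :=
  mul_nonneg (by positivity) (hK _)

theorem lintegral_kernelZ (hK : KernelAssumption dZ K) (hh : 0 < h) :
    ∫⁻ z : Rd dZ, ENNReal.ofReal (kernelZ K h z) = 1 := by
  obtain ⟨h1, h2⟩ := hK.integral_scaled hh (E := Rd dZ) (by simp)
  rw [← ENNReal.ofReal_one, ← h2, ofReal_integral_eq_lintegral_ofReal h1
    (Eventually.of_forall fun z => kernelZ_nonneg hK.nonneg hh z)]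
  rfl

theorem lintegral_kernelYZ (hK : KernelAssumption (dY + dZ) K) (hh : 0 < h) :
    ∫⁻ v : Rd dY × Rd dZ, ENNReal.ofReal (kernelYZ K h v) = 1 := by
  obtain ⟨h1, h2⟩ := hK.integral_scaled hh (E := RdPair dY dZ)
    (by rw [(WithLp.linearEquiv 2 ℝ (Rd dY × Rd dZ)).finrank_eq]; simp)
  have hm : Measurable fun u : RdPair dY dZ =>
      ENNReal.ofReal ((h ^ (dY + dZ))⁻¹ * K (‖u‖ / h)) :=
    ((hK.measurable.comp (measurable_norm.div_const h)).const_mul _).ennreal_ofReal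
  have h3 := (WithLp.volume_preserving_toLp (Rd dY) (Rd dZ)).lintegral_comp hm
  refine h3.trans ?_
  rw [← ofReal_integral_eq_lintegral_ofReal h1
    (Eventually.of_forall fun u => mul_nonneg (by positivity) (hK.nonneg _)), h2,
    ENNReal.ofReal_one]

/-- The kernel on `ℝ^{dZ}` obtained from `kernelYZ` by integration over `y`. -/
def kernelYZMarg {dY dZ : ℕ} (K : ℝ → ℝ) (h : ℝ) (z : Rd dZ) : ℝ≥0∞ :=
  ∫⁻ y : Rd dY, ENNReal.ofReal (kernelYZ K h (y, z))

theorem measurable_kernelYZMarg (hK : Measurable K) :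
    Measurable (kernelYZMarg (dY := dY) K h : Rd dZ → ℝ≥0∞) :=
  (measurable_kernelYZ hK).ennreal_ofReal.lintegral_prod_left'

theorem lintegral_kernelYZMarg (hK : KernelAssumption (dY + dZ) K) (hh : 0 < h) :
    ∫⁻ z : Rd dZ, kernelYZMarg (dY := dY) K h z = 1 := by
  rw [← lintegral_kernelYZ hK hh, Measure.volume_eq_prod, lintegral_prod_symm _
    (measurable_kernelYZ hK.measurable).ennreal_ofReal.aemeasurable]
  rfl

theorem kernelZ_eq_zero {R : ℝ} (hR : ∀ r, R < r → K r = 0) (hh : 0 < h) {z : Rd dZ}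
    (hz : R * h < ‖z‖) : kernelZ K h z = 0 := by
  rw [kernelZ, hR _ ((lt_div_iff₀ hh).2 hz), mul_zero]

theorem kernelYZ_eq_zero {R : ℝ} (hR : ∀ r, R < r → K r = 0) (hh : 0 < h) {v : Rd dY × Rd dZ}
    (hv : R * h < ‖v‖) : kernelYZ K h v = 0 := by
  -- The product carries the sup norm, while the kernel uses the larger Euclidean norm, so the
  -- support is still inside the sup-norm ball.
  have h1 : ‖v‖ ≤ ‖(WithLp.toLp 2 v : RdPair dY dZ)‖ := by
    exact max_le (WithLp.norm_fst_le (p := 2) _ (WithLp.toLp 2 v : RdPair dY dZ))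
      (WithLp.norm_snd_le (p := 2) _ (WithLp.toLp 2 v : RdPair dY dZ))
  rw [kernelYZ, hR _ ((lt_div_iff₀ hh).2 (hv.trans_le h1)), mul_zero]

theorem kernelYZMarg_eq_zero {R : ℝ} (hR : ∀ r, R < r → K r = 0) (hh : 0 < h) {z : Rd dZ}
    (hz : R * h < ‖z‖) : kernelYZMarg (dY := dY) K h z = 0 := by
  have : ∀ y : Rd dY, kernelYZ K h (y, z) = 0 := fun y =>
    kernelYZ_eq_zero hR hh (hz.trans_le (norm_snd_le (y, z)))
  simp [kernelYZMarg, this]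

theorem eventually_forall_notMem_of_support {V β : Type*} [SeminormedAddCommGroup V] [Zero β]
    {k : ℕ → V → β} {R : ℝ} {h : ℕ → ℝ} (hlim : Tendsto h atTop (𝓝 0))
    (hk : ∀ n v, R * h n < ‖v‖ → k n v = 0) :
    ∀ U ∈ 𝓝 (0 : V), ∀ᶠ n in atTop, ∀ u, u ∉ U → k n u = 0 := by
  intro U hU
  obtain ⟨ε, hε, hεU⟩ := Metric.mem_nhds_iff.1 hU
  have h1 : Tendsto (fun n => R * h n) atTop (𝓝 0) := by simpa using hlim.const_mul R
  filter_upwards [h1.eventually (gt_mem_nhds hε)] with n hn u hu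
  refine hk n u (hn.trans_le ?_)
  by_contra hcon
  exact hu (hεU (by simpa using hcon))

end ScaledKernel

/-! ### Bandwidths -/

section Bandwidth

/-- The quotient of the two conditions is `h ^ 4`, which therefore tends to zero. -/
theorem tendsto_zero_of_bandwidth {d : ℕ} {h : ℕ → ℝ} (hpos : ∀ n, 0 < h n)
    (hlarge : Tendsto (fun n : ℕ => (n : ℝ) * h n ^ d) atTop atTop)
    (hsmall : Tendsto (fun n : ℕ => (n : ℝ) * h n ^ (d + 4)) atTop (𝓝 0)) :
    Tendsto h atTop (𝓝 0) := by
  have h1 : Tendsto (fun n => h n ^ 4) atTop (𝓝 0) := by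
    refine (hsmall.div_atTop hlarge).congr' ?_
    filter_upwards [eventually_gt_atTop 0] with n hn
    have hn' : (0 : ℝ) < n := Nat.cast_pos.2 hn
    have := hpos n
    rw [pow_add]
    field_simp
  have h2 := h1.sqrt.sqrt
  simp only [Real.sqrt_zero] at h2
  refine h2.congr fun n => ?_
  have h3 := (hpos n).le
  rw [show h n ^ 4 = (h n ^ 2) ^ 2 by ring, Real.sqrt_sq (by positivity), Real.sqrt_sq h3]

theorem tendsto_kernel_bound_div {d : ℕ} {h : ℕ → ℝ}
    (hlarge : Tendsto (fun n : ℕ => (n : ℝ) * h n ^ d) atTop atTop) (c : ℝ) :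
    Tendsto (fun n : ℕ => (h n ^ d)⁻¹ * c / n) atTop (𝓝 0) := by
  refine ((tendsto_inv_atTop_zero.comp hlarge).mul_const c).congr (fun n => ?_) |>.trans
    (by simp)
  simp only [Function.comp_apply, mul_inv]
  ring

end Bandwidth

/-! ### Consistency of kernel averages -/

section Consistency

/-- Kernel averages converge in mean, uniformly over the observations. -/
theorem eventually_lintegral_kernelAverage_sub_le {S V : Type*} [MeasurableSpace S]
    {P : Measure S} [IsProbabilityMeasure P]
    [NormedAddCommGroup V] [MeasurableSpace V] [BorelSpace V] [SecondCountableTopology V]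
    [LocallyCompactSpace V] {μ : Measure V} [μ.IsAddHaarMeasure] [μ.InnerRegularCompactLTTop]
    [SigmaFinite μ] [μ.IsNegInvariant]
    {vm : S → V} {k : ℕ → V → ℝ} {φ : S → ℝ} {ψ : V → ℝ} {B : ℕ → ℝ} {C : ℝ≥0}
    (hvm : Measurable vm) (hk : ∀ n, Measurable (k n)) (hk0 : ∀ n u, 0 ≤ k n u)
    (hkB : ∀ n u, k n u ≤ B n) (hk1 : ∀ n, ∫⁻ u, ENNReal.ofReal (k n u) ∂μ = 1)
    (hB : Tendsto (fun n : ℕ => B n / n) atTop (𝓝 0))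
    (hsupp : ∀ U ∈ 𝓝 (0 : V), ∀ᶠ n in atTop, ∀ u, u ∉ U → k n u = 0)
    (hφ : Measurable φ) (hφ0 : ∀ w, 0 ≤ φ w) (hφ1 : ∀ w, φ w ≤ 1)
    (hψ : Measurable ψ) (hψ0 : ∀ v, 0 ≤ ψ v) (hψint : Integrable ψ μ)
    (hlaw : ∀ H : V → ℝ≥0∞, Measurable H →
      ∫⁻ w, ENNReal.ofReal (φ w) * H (vm w) ∂P = ∫⁻ v, ENNReal.ofReal (ψ v) * H v ∂μ)
    (hC : ∀ H : V → ℝ≥0∞, Measurable H → ∫⁻ w, H (vm w) ∂P ≤ C * ∫⁻ v, H v ∂μ)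
    {ε : ℝ≥0∞} (hε : 0 < ε) :
    ∀ᶠ n in atTop, ∀ s : Fin n,
      ∫⁻ D, ‖kernelAverage vm (k n) φ D s - ψ (vm (D s))‖ₑ ∂Measure.pi (fun _ : Fin n => P)
        ≤ ε := by
  have hω : Tendsto (fun u => ∫⁻ v, ‖ψ (v - u) - ψ v‖ₑ ∂μ) (𝓝 0) (𝓝 0) := by
    have h1 := (tendsto_lintegral_enorm_translate_sub μ hψint).comp
      (show Tendsto (fun u : V => -u) (𝓝 0) (𝓝 0) by simpa using (continuous_neg (G := V)).tendsto 0)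
    simpa [Function.comp_def, neg_add_eq_sub] using h1
  have h2 := tendsto_lintegral_kernel_mul hω (fun n => (hk n).ennreal_ofReal)
    (fun n => (hk1 n).le) (fun U hU => (hsupp U hU).mono fun n hn u hu => by simp [hn u hu])
  -- As `n` grows the bound tends to `δ` itself, so it is chosen below `ε`, independently of `n`.
  obtain ⟨δ, hδ, hδε⟩ : ∃ δ : ℝ, 0 < δ ∧ ENNReal.ofReal δ < ε := by
    rcases eq_or_ne ε ∞ with rfl | hε'
    · exact ⟨1, one_pos, ENNReal.ofReal_lt_top⟩
    · have hp := ENNReal.toReal_pos hε.ne' hε'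
      refine ⟨ε.toReal / 2, by positivity, ?_⟩
      rw [ENNReal.ofReal_lt_iff_lt_toReal (by positivity) hε']
      linarith
  have h3 : Tendsto (fun n : ℕ => ENNReal.ofReal (B n / n) +
      ENNReal.ofReal (δ + B n * C / (n * δ)) + C * ∫⁻ u, ENNReal.ofReal (k n u) *
        ∫⁻ v, ‖ψ (v - u) - ψ v‖ₑ ∂μ ∂μ) atTop
      (𝓝 (ENNReal.ofReal 0 + ENNReal.ofReal (δ + 0 * (C / δ)) + C * 0)) := by
    refine ((ENNReal.tendsto_ofReal hB).add (ENNReal.tendsto_ofReal ?_)).add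
      (ENNReal.Tendsto.const_mul h2 (Or.inr ENNReal.coe_ne_top))
    refine (tendsto_const_nhds.add (hB.mul_const (C / δ))).congr fun n => ?_
    rw [div_mul_div_comm]
  simp only [ENNReal.ofReal_zero, zero_mul, add_zero, zero_add, mul_zero] at h3
  filter_upwards [h3.eventually (gt_mem_nhds hδε)] with n hn s
  exact (lintegral_kernelAverage_sub_le hvm (hk n) (hk0 n) (hkB n) (hk1 n) hφ hφ0 hφ1 hψ hψ0
    hlaw hC s hδ).trans hn.le

end Consistency

/-! ### Transpositions of neighbouring observations -/

section Analytic

variable {X Z : Type*} [MeasurableSpace X] {lam : Measure X} [SigmaFinite lam]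
  [AddCommGroup Z] [MeasurableSpace Z] [MeasurableAdd₂ Z] [MeasurableNeg Z]
  {μ : Measure Z} [SigmaFinite μ] [μ.IsAddLeftInvariant] [μ.IsNegInvariant]

/-- The `L¹` modulus of continuity of `F` in its second variable. -/
def l1Modulus (lam : Measure X) (μ : Measure Z) (F : X × Z → ℝ) (u : Z) : ℝ≥0∞ :=
  ∫⁻ t, ∫⁻ x, ‖F (x, t - u) - F (x, t)‖ₑ ∂lam ∂μ

theorem lintegral_kernel_mul_l1Dist {F : X × Z → ℝ} (hF : Measurable F) {b : Z → ℝ≥0∞}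
    (hb : Measurable b) :
    ∫⁻ t, ∫⁻ z, b (t - z) * ∫⁻ x, ‖F (x, z) - F (x, t)‖ₑ ∂lam ∂μ ∂μ =
      ∫⁻ u, b u * l1Modulus lam μ F u ∂μ := by
  have hE : Measurable fun q : Z × Z => ∫⁻ x, ‖F (x, q.1 - q.2) - F (x, q.1)‖ₑ ∂lam :=
    Measurable.lintegral_prod_right'
      (f := fun q : (Z × Z) × X => ‖F (q.2, q.1.1 - q.1.2) - F (q.2, q.1.1)‖ₑ) (by fun_prop)
  have h1 : ∀ t, ∫⁻ z, b (t - z) * ∫⁻ x, ‖F (x, z) - F (x, t)‖ₑ ∂lam ∂μ =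
      ∫⁻ u, b u * ∫⁻ x, ‖F (x, t - u) - F (x, t)‖ₑ ∂lam ∂μ := by
    intro t
    rw [← lintegral_sub_left_eq_self _ t]
    simp only [sub_sub_cancel]
  simp_rw [h1]
  have h2 : Measurable fun q : Z × Z =>
      b q.2 * ∫⁻ x, ‖F (x, q.1 - q.2) - F (x, q.1)‖ₑ ∂lam := (hb.comp measurable_snd).mul hE
  rw [lintegral_lintegral_swap h2.aemeasurable]
  refine lintegral_congr fun u => ?_
  have h3 : Measurable fun t => ∫⁻ x, ‖F (x, t - u) - F (x, t)‖ₑ ∂lam :=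
    hE.comp (measurable_id.prodMk measurable_const)
  rw [lintegral_const_mul _ h3, l1Modulus]

/-- Telescoping: at `z = z' = t` the two products have the same integrand, so the four factors are
replaced by their values at `t` one at a time. Each step costs one `L¹` distance times a mass of at
most `C`. -/
theorem lintegral_lintegral_enorm_mul_sub_mul_le {F : X × Z → ℝ} (hF : Measurable F)
    (hF0 : ∀ q, 0 ≤ F q) {C : ℝ≥0∞} (hC : ∀ z, ∫⁻ x, ENNReal.ofReal (F (x, z)) ∂lam ≤ C)
    (t z z' : Z) :
    ∫⁻ x, ∫⁻ x', ‖F (x, z) * F (x', z') - F (x', z) * F (x, z')‖ₑ ∂lam ∂lam ≤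
      2 * C * (∫⁻ x, ‖F (x, z) - F (x, t)‖ₑ ∂lam + ∫⁻ x, ‖F (x, z') - F (x, t)‖ₑ ∂lam) := by
  have hen : ∀ q, ‖F q‖ₑ = ENNReal.ofReal (F q) := fun q => Real.enorm_of_nonneg (hF0 q)
  have hb : ∀ x x', ‖F (x, z) * F (x', z') - F (x', z) * F (x, z')‖ₑ ≤
      ENNReal.ofReal (F (x, z)) * ‖F (x', z') - F (x', t)‖ₑ +
      (‖F (x, z) - F (x, t)‖ₑ * ENNReal.ofReal (F (x', t)) +
      (ENNReal.ofReal (F (x, t)) * ‖F (x', z) - F (x', t)‖ₑ +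
      ‖F (x, z') - F (x, t)‖ₑ * ENNReal.ofReal (F (x', z)))) := by
    intro x x'
    have h1 : F (x, z) * F (x', z') - F (x', z) * F (x, z') =
        F (x, z) * (F (x', z') - F (x', t)) + ((F (x, z) - F (x, t)) * F (x', t) +
          (F (x, t) * (F (x', t) - F (x', z)) + (F (x, t) - F (x, z')) * F (x', z))) := by ring
    rw [h1]
    refine (enorm_add_le _ _).trans (add_le_add (by rw [enorm_mul, hen]) ?_)
    refine (enorm_add_le _ _).trans (add_le_add (by rw [enorm_mul, hen]) ?_)
    refine (enorm_add_le _ _).trans (add_le_add (by rw [enorm_mul, hen, enorm_sub_rev]) ?_)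
    rw [enorm_mul, hen, enorm_sub_rev]
  have hm : ∀ y, Measurable fun x => ENNReal.ofReal (F (x, y)) := fun y => by fun_prop
  have hd : ∀ y y', Measurable fun x => ‖F (x, y) - F (x, y')‖ₑ := fun y y' => by fun_prop
  calc _ ≤ ∫⁻ x, ∫⁻ x', (ENNReal.ofReal (F (x, z)) * ‖F (x', z') - F (x', t)‖ₑ +
      (‖F (x, z) - F (x, t)‖ₑ * ENNReal.ofReal (F (x', t)) +
      (ENNReal.ofReal (F (x, t)) * ‖F (x', z) - F (x', t)‖ₑ +
      ‖F (x, z') - F (x, t)‖ₑ * ENNReal.ofReal (F (x', z))))) ∂lam ∂lam :=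
        lintegral_mono fun x => lintegral_mono fun x' => hb x x'
    _ = (∫⁻ x, ENNReal.ofReal (F (x, z)) ∂lam) * ∫⁻ x, ‖F (x, z') - F (x, t)‖ₑ ∂lam +
        ((∫⁻ x, ‖F (x, z) - F (x, t)‖ₑ ∂lam) * ∫⁻ x, ENNReal.ofReal (F (x, t)) ∂lam +
        ((∫⁻ x, ENNReal.ofReal (F (x, t)) ∂lam) * ∫⁻ x, ‖F (x, z) - F (x, t)‖ₑ ∂lam +
        (∫⁻ x, ‖F (x, z') - F (x, t)‖ₑ ∂lam) * ∫⁻ x, ENNReal.ofReal (F (x, z)) ∂lam)) := by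
        have h2 : ∀ x, ∫⁻ x', (ENNReal.ofReal (F (x, z)) * ‖F (x', z') - F (x', t)‖ₑ +
            (‖F (x, z) - F (x, t)‖ₑ * ENNReal.ofReal (F (x', t)) +
            (ENNReal.ofReal (F (x, t)) * ‖F (x', z) - F (x', t)‖ₑ +
            ‖F (x, z') - F (x, t)‖ₑ * ENNReal.ofReal (F (x', z))))) ∂lam =
            ENNReal.ofReal (F (x, z)) * ∫⁻ x', ‖F (x', z') - F (x', t)‖ₑ ∂lam +
            (‖F (x, z) - F (x, t)‖ₑ * ∫⁻ x', ENNReal.ofReal (F (x', t)) ∂lam +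
            (ENNReal.ofReal (F (x, t)) * ∫⁻ x', ‖F (x', z) - F (x', t)‖ₑ ∂lam +
            ‖F (x, z') - F (x, t)‖ₑ * ∫⁻ x', ENNReal.ofReal (F (x', z)) ∂lam)) := by
          intro x
          rw [lintegral_add_left ((hd z' t).const_mul _), lintegral_const_mul _ (hd z' t),
            lintegral_add_left ((hm t).const_mul _), lintegral_const_mul _ (hm t),
            lintegral_add_left ((hd z t).const_mul _), lintegral_const_mul _ (hd z t),
            lintegral_const_mul _ (hm z)]
        simp_rw [h2]
        rw [lintegral_add_left ((hm z).mul_const _), lintegral_mul_const _ (hm z),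
          lintegral_add_left ((hd z t).mul_const _), lintegral_mul_const _ (hd z t),
          lintegral_add_left ((hm t).mul_const _), lintegral_mul_const _ (hm t),
          lintegral_mul_const _ (hd z' t)]
    _ ≤ C * ∫⁻ x, ‖F (x, z') - F (x, t)‖ₑ ∂lam + ((∫⁻ x, ‖F (x, z) - F (x, t)‖ₑ ∂lam) * C +
        (C * ∫⁻ x, ‖F (x, z) - F (x, t)‖ₑ ∂lam + (∫⁻ x, ‖F (x, z') - F (x, t)‖ₑ ∂lam) * C)) := by
        gcongr <;> apply hC
    _ = _ := by ring

/-- For fixed `t`, the kernel attached to the variable that does not occur in a given `L¹` distance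
integrates to one; integrating over `t` then turns the distances into moduli of continuity. -/
theorem lintegral_kernel_kernel_enorm_le {F : X × Z → ℝ} (hF : Measurable F)
    (hF0 : ∀ q, 0 ≤ F q) {C : ℝ≥0∞} (hC : ∀ z, ∫⁻ x, ENNReal.ofReal (F (x, z)) ∂lam ≤ C)
    {b k : Z → ℝ≥0∞} (hb : Measurable b) (hk : Measurable k) (hb1 : ∫⁻ u, b u ∂μ = 1)
    (hk1 : ∫⁻ u, k u ∂μ = 1) :
    ∫⁻ t, ∫⁻ z, ∫⁻ z', b (t - z) * k (t - z') *
        ∫⁻ x, ∫⁻ x', ‖F (x, z) * F (x', z') - F (x', z) * F (x, z')‖ₑ ∂lam ∂lam ∂μ ∂μ ∂μ ≤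
      2 * C * (∫⁻ u, b u * l1Modulus lam μ F u ∂μ + ∫⁻ u, k u * l1Modulus lam μ F u ∂μ) := by
  set E : Z → Z → ℝ≥0∞ := fun t z => ∫⁻ x, ‖F (x, z) - F (x, t)‖ₑ ∂lam with hE
  have hEm : Measurable fun q : Z × Z => E q.1 q.2 :=
    Measurable.lintegral_prod_right'
      (f := fun q : (Z × Z) × X => ‖F (q.2, q.1.2) - F (q.2, q.1.1)‖ₑ) (by fun_prop)
  have hEt : ∀ t, Measurable (E t) := fun t => hEm.comp (measurable_const.prodMk measurable_id)
  have hkt : ∀ t, Measurable fun z => k (t - z) := fun t => hk.comp (measurable_id.const_sub t)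
  have hbt : ∀ t, Measurable fun z => b (t - z) := fun t => hb.comp (measurable_id.const_sub t)
  have hkt1 : ∀ t, ∫⁻ z, k (t - z) ∂μ = 1 := fun t => by
    rw [lintegral_sub_left_eq_self k t, hk1]
  have hbt1 : ∀ t, ∫⁻ z, b (t - z) ∂μ = 1 := fun t => by
    rw [lintegral_sub_left_eq_self b t, hb1]
  have hin : ∀ t, ∫⁻ z, ∫⁻ z', b (t - z) * k (t - z') *
        ∫⁻ x, ∫⁻ x', ‖F (x, z) * F (x', z') - F (x', z) * F (x, z')‖ₑ ∂lam ∂lam ∂μ ∂μ ≤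
      2 * C * (∫⁻ z, b (t - z) * E t z ∂μ + ∫⁻ z, k (t - z) * E t z ∂μ) := by
    intro t
    have hkE : Measurable fun z => k (t - z) * E t z := (hkt t).mul (hEt t)
    have hbE : Measurable fun z => b (t - z) * E t z := (hbt t).mul (hEt t)
    have h1 : ∀ z, ∫⁻ z', b (t - z) * k (t - z') *
        ∫⁻ x, ∫⁻ x', ‖F (x, z) * F (x', z') - F (x', z) * F (x, z')‖ₑ ∂lam ∂lam ∂μ ≤
        2 * C * (b (t - z) * E t z + b (t - z) * ∫⁻ z', k (t - z') * E t z' ∂μ) := by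
      intro z
      calc _ ≤ ∫⁻ z', (2 * C * (b (t - z) * E t z)) * k (t - z') +
            (2 * C * b (t - z)) * (k (t - z') * E t z') ∂μ := by
            refine lintegral_mono fun z' => ?_
            refine (mul_le_mul_right
              (lintegral_lintegral_enorm_mul_sub_mul_le hF hF0 hC t z z') _).trans (le_of_eq ?_)
            simp only [hE]
            ring
        _ = _ := by
            rw [lintegral_add_left ((hkt t).const_mul _), lintegral_const_mul _ (hkt t), hkt1,
              lintegral_const_mul _ hkE]
            ring
    refine (lintegral_mono h1).trans (le_of_eq ?_)
    have hsum : Measurable fun z => b (t - z) * E t z +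
        b (t - z) * ∫⁻ z', k (t - z') * E t z' ∂μ := hbE.add ((hbt t).mul_const _)
    rw [lintegral_const_mul _ hsum,
      lintegral_add_left hbE, lintegral_mul_const _ (hbt t), hbt1, one_mul]
  refine (lintegral_mono hin).trans (le_of_eq ?_)
  have hbE : Measurable fun t => ∫⁻ z, b (t - z) * E t z ∂μ :=
    Measurable.lintegral_prod_right' (f := fun q : Z × Z => b (q.1 - q.2) * E q.1 q.2)
      ((hb.comp (measurable_fst.sub measurable_snd)).mul hEm)
  have hkE : Measurable fun t => ∫⁻ z, k (t - z) * E t z ∂μ :=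
    Measurable.lintegral_prod_right' (f := fun q : Z × Z => k (q.1 - q.2) * E q.1 q.2)
      ((hk.comp (measurable_fst.sub measurable_snd)).mul hEm)
  have hsum : Measurable fun t => ∫⁻ z, b (t - z) * E t z ∂μ + ∫⁻ z, k (t - z) * E t z ∂μ :=
    hbE.add hkE
  rw [lintegral_const_mul _ hsum, lintegral_add_left hbE,
    lintegral_kernel_mul_l1Dist hF hb, lintegral_kernel_mul_l1Dist hF hk]

end Analytic

/-! ### Likelihood ratios of transpositions -/

section SwapRatio

variable {dX dY dZ n : ℕ} {p : Rd dX → Rd dY → Rd dZ → ℝ}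

/-- The density of `(X, Z)` as a real-valued function. -/
def densityXZ (p : Rd dX → Rd dY → Rd dZ → ℝ) (q : Rd dX × Rd dZ) : ℝ :=
  (margXZ p q.1 q.2).toReal

theorem densityXZ_nonneg (p : Rd dX → Rd dY → Rd dZ → ℝ) (q : Rd dX × Rd dZ) :
    0 ≤ densityXZ p q := ENNReal.toReal_nonneg

/-- The positive part of one minus the likelihood ratio of the transposition of `x` and `x'`. -/
def swapDefect (p : Rd dX → Rd dY → Rd dZ → ℝ) (q q' : Rd dX × Rd dZ) : ℝ :=
  max 0 (1 - densityXZ p (q'.1, q.2) * densityXZ p (q.1, q'.2) /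
    (densityXZ p q * densityXZ p q'))

/-- The `(X, Z)` part of an observation. -/
def obsXZ (w : Rd dX × Rd dY × Rd dZ) : Rd dX × Rd dZ := (w.1, w.2.2)

theorem measurable_obsXZ : Measurable (obsXZ : Rd dX × Rd dY × Rd dZ → Rd dX × Rd dZ) :=
  measurable_fst.prodMk measurable_snd.snd

/-- Integrating the defect against the law of the two observations clears its denominator, so
neighbourhoods where the density is small need no separate treatment here. -/
theorem densityXZ_mul_swapDefect_le (p : Rd dX → Rd dY → Rd dZ → ℝ) (q q' : Rd dX × Rd dZ) :
    densityXZ p q * densityXZ p q' * swapDefect p q q' ≤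
      |densityXZ p q * densityXZ p q' - densityXZ p (q'.1, q.2) * densityXZ p (q.1, q'.2)| := by
  have h1 := densityXZ_nonneg p q
  have h2 := densityXZ_nonneg p q'
  rcases (mul_nonneg h1 h2).eq_or_lt with h0 | h0
  · rw [← h0, zero_mul]; exact abs_nonneg _
  · rw [swapDefect, mul_max_of_nonneg _ _ h0.le, mul_zero]
    refine max_le (abs_nonneg _) ?_
    rw [mul_sub, mul_one, mul_div_cancel₀ _ h0.ne']
    exact le_abs_self _

/-- Only two factors of the likelihood change, and `p_Z` cancels because the values of `Z` stay in
place. -/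
theorem condLikelihood_permuteX_swap {D : Sample dX dY dZ n} (hD : condLikelihood p D ≠ 0)
    {i j : Fin n} (hij : i ≠ j) :
    condLikelihood p (permuteX (Equiv.swap i j) D) = condLikelihood p D *
      (densityXZ p ((D j).1, (D i).2.2) * densityXZ p ((D i).1, (D j).2.2) /
        (densityXZ p (obsXZ (D i)) * densityXZ p (obsXZ (D j)))) := by
  have hprod : ∀ D' : Sample dX dY dZ n, condLikelihood p D' =
      condDensity p (D' i).1 (D' i).2.2 * (condDensity p (D' j).1 (D' j).2.2 *
        ∏ l ∈ (Finset.univ.erase i).erase j, condDensity p (D' l).1 (D' l).2.2) := by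
    intro D'
    rw [condLikelihood, ← Finset.mul_prod_erase _ _ (Finset.mem_univ i),
      ← Finset.mul_prod_erase _ _ (Finset.mem_erase.2 ⟨hij.symm, Finset.mem_univ j⟩)]
  have hrest : ∏ l ∈ (Finset.univ.erase i).erase j,
      condDensity p (permuteX (Equiv.swap i j) D l).1 (permuteX (Equiv.swap i j) D l).2.2 =
      ∏ l ∈ (Finset.univ.erase i).erase j, condDensity p (D l).1 (D l).2.2 := by
    refine Finset.prod_congr rfl fun l hl => ?_
    simp only [Finset.mem_erase, Finset.mem_univ, and_true] at hl
    simp only [permuteX, Equiv.swap_apply_of_ne_of_ne hl.2 hl.1]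
  have hi : condDensity p (D i).1 (D i).2.2 ≠ 0 := fun h => hD (by rw [hprod, h, zero_mul])
  have hj : condDensity p (D j).1 (D j).2.2 ≠ 0 := fun h => hD (by
    rw [hprod, h, zero_mul, mul_zero])
  rw [hprod (permuteX _ D), hrest, hprod D]
  simp only [permuteX, Equiv.swap_apply_left, Equiv.swap_apply_right]
  simp only [condDensity, div_ne_zero_iff] at hi hj
  obtain ⟨hi1, hi2⟩ := hi
  obtain ⟨hj1, hj2⟩ := hj
  simp only [condDensity, densityXZ, obsXZ]
  field_simp

/-- A law and its translate have the same total, so their `L¹` distance is twice the positive part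
of the difference. Relative to `q π` this part is the defect of the likelihood ratio at the data
permuted by `π`. -/
theorem swapDist_cptProb_le (D : Sample dX dY dZ n) {i j : Fin n} (hij : i ≠ j) :
    swapDist (cptProb p D) i j ≤ ∑ π, cptProb p D π *
      (2 * swapDefect p (obsXZ (permuteX π D i)) (obsXZ (permuteX π D j))) := by
  set τ := Equiv.swap i j
  have h1 : ∑ π, cptProb p D (π * τ) = ∑ π, cptProb p D π :=
    Equiv.sum_comp (Equiv.mulRight τ) (cptProb p D)
  have h2 : swapDist (cptProb p D) i j =
      ∑ π, 2 * max 0 (cptProb p D π - cptProb p D (π * τ)) := by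
    have h3 : ∀ π, 2 * max 0 (cptProb p D π - cptProb p D (π * τ)) =
        |cptProb p D π - cptProb p D (π * τ)| + (cptProb p D π - cptProb p D (π * τ)) := by
      intro π
      rcases le_total 0 (cptProb p D π - cptProb p D (π * τ)) with h | h
      · rw [max_eq_right h, abs_of_nonneg h]; ring
      · rw [max_eq_left h, abs_of_nonpos h]; ring
    simp_rw [h3]
    rw [Finset.sum_add_distrib, Finset.sum_sub_distrib, h1, sub_self, add_zero]
    rfl
  rw [h2]
  refine Finset.sum_le_sum fun π _ => ?_
  rw [mul_left_comm]
  refine mul_le_mul_of_nonneg_left ?_ zero_le_two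
  have h0 := cptProb_nonneg (p := p) D π
  have h0' := cptProb_nonneg (p := p) D (π * τ)
  rw [swapDefect, mul_max_of_nonneg _ _ h0, mul_zero]
  rcases h0.eq_or_lt with hz | hpos
  · rw [← hz, zero_sub, zero_mul]
    exact max_le_max le_rfl (by linarith)
  · refine le_of_eq ?_
    congr 1
    have hL : condLikelihood p (permuteX π D) ≠ 0 := by
      intro h
      rw [cptProb_eq_condLikelihood, h, zero_div] at hpos
      exact lt_irrefl _ hpos
    have h4 := condLikelihood_permuteX_swap hL hij
    rw [permuteX_permuteX] at h4
    rw [cptProb_eq_condLikelihood, cptProb_eq_condLikelihood, h4]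
    simp only [obsXZ]
    ring

end SwapRatio

/-! ### Integrals over a few coordinates -/

section Coordinates

theorem lintegral_pi_triple {S : Type*} [MeasurableSpace S] (P : Measure S)
    [IsProbabilityMeasure P] {n : ℕ} {i j k : Fin n} (hij : i ≠ j) (hik : i ≠ k) (hjk : j ≠ k)
    {f : S → S → S → ℝ≥0∞} (hf : Measurable fun q : S × S × S => f q.1 q.2.1 q.2.2) :
    ∫⁻ D, f (D i) (D j) (D k) ∂Measure.pi (fun _ : Fin n => P) =
      ∫⁻ w, ∫⁻ w', ∫⁻ w'', f w w' w'' ∂P ∂P ∂P := by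
  have h3 : Measurable fun q : S × S => ∫⁻ w'', f q.1 q.2 w'' ∂P :=
    Measurable.lintegral_prod_right' (f := fun q : (S × S) × S => f q.1.1 q.1.2 q.2)
      (hf.comp (measurable_fst.fst.prodMk (measurable_fst.snd.prodMk measurable_snd)))
  have h2 : Measurable fun w : S => ∫⁻ w', ∫⁻ w'', f w w' w'' ∂P ∂P :=
    Measurable.lintegral_prod_right' (f := fun q : S × S => ∫⁻ w'', f q.1 q.2 w'' ∂P) h3
  have m1 : Measurable fun D : Fin n → S => f (D i) (D j) (D k) :=
    have := hf.comp ((measurable_pi_apply (X := fun _ : Fin n => S) i).prodMk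
      ((measurable_pi_apply (X := fun _ : Fin n => S) j).prodMk (measurable_pi_apply k)))
    this
  have m2 : Measurable fun D : Fin n → S => ∫⁻ w'', f (D i) (D j) w'' ∂P :=
    h3.comp ((measurable_pi_apply (X := fun _ : Fin n => S) i).prodMk (measurable_pi_apply j))
  have m3 : Measurable fun D : Fin n → S => ∫⁻ w', ∫⁻ w'', f (D i) w' w'' ∂P ∂P :=
    h2.comp (measurable_pi_apply i)
  rw [lintegral_pi_update (fun _ : Fin n => P) k m1]
  simp only [Function.update_self, Function.update_of_ne hik, Function.update_of_ne hjk]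
  rw [lintegral_pi_update (fun _ : Fin n => P) j m2]
  simp only [Function.update_self, Function.update_of_ne hij]
  rw [lintegral_pi_update (fun _ : Fin n => P) i m3]
  simp only [Function.update_self, lintegral_const, measure_univ, mul_one]

/-- Continuity from above along the thresholds `1 / (n + 1)`. -/
theorem exists_measure_lt_le {S : Type*} [MeasurableSpace S] (P : Measure S) [IsFiniteMeasure P]
    {g : S → ℝ} (hg : Measurable g) (h0 : P {w | g w ≤ 0} = 0) {ε : ℝ≥0∞} (hε : 0 < ε) :
    ∃ η : ℝ, 0 < η ∧ P {w | g w < η} ≤ ε := by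
  have h1 : Tendsto (fun n : ℕ => P {w | g w < 1 / ((n : ℝ) + 1)}) atTop
      (𝓝 (P (⋂ n : ℕ, {w | g w < 1 / ((n : ℝ) + 1)}))) := by
    refine tendsto_measure_iInter_atTop
      (fun n => (measurableSet_lt hg measurable_const).nullMeasurableSet) ?_
      ⟨0, measure_ne_top _ _⟩
    intro m n hmn w hw
    have h2 : (1 : ℝ) / ((n : ℝ) + 1) ≤ 1 / ((m : ℝ) + 1) :=
      one_div_le_one_div_of_le (by positivity) (by exact_mod_cast Nat.succ_le_succ hmn)
    exact lt_of_lt_of_le hw h2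
  have h2 : P (⋂ n : ℕ, {w | g w < 1 / ((n : ℝ) + 1)}) = 0 := by
    refine measure_mono_null (fun w hw => ?_) h0
    refine ge_of_tendsto' (tendsto_one_div_add_atTop_nhds_zero_nat (𝕜 := ℝ)) fun n => ?_
    exact (Set.mem_iInter.1 hw n).le
  rw [h2] at h1
  obtain ⟨n, hn⟩ := (h1.eventually (gt_mem_nhds hε)).exists
  exact ⟨1 / ((n : ℝ) + 1), by positivity, hn.le⟩

end Coordinates

/-! ### The mean defect as an integral of densities -/

section DefectMean

variable {X Z : Type*} [MeasurableSpace X] {lam : Measure X} [SigmaFinite lam]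
  [MeasurableSpace Z] {μ : Measure Z} [SigmaFinite μ]

/-- Writing both laws through `F` produces the factor `F q * F q'`, exactly what `hle` needs to
replace `ρ` by the difference of products. -/
theorem lintegral_kernel_kernel_mul_le {F : X × Z → ℝ} (hF : Measurable F)
    {Q : Measure (X × Z)} [SFinite Q]
    (hQ : ∀ H : X × Z → ℝ≥0∞, Measurable H →
      ∫⁻ q, H q ∂Q = ∫⁻ z, ∫⁻ x, ENNReal.ofReal (F (x, z)) * H (x, z) ∂lam ∂μ)
    {b k : Z → ℝ≥0∞} (hb : Measurable b) (hk : Measurable k)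
    {ρ : X × Z → X × Z → ℝ≥0∞} (hρ : Measurable fun q : (X × Z) × (X × Z) => ρ q.1 q.2)
    (hle : ∀ q q', ENNReal.ofReal (F q) * ENNReal.ofReal (F q') * ρ q q' ≤
      ‖F q * F q' - F (q'.1, q.2) * F (q.1, q'.2)‖ₑ) :
    ∫⁻ q, ∫⁻ q', b q.2 * k q'.2 * ρ q q' ∂Q ∂Q ≤
      ∫⁻ z, ∫⁻ z', b z * k z' *
        ∫⁻ x, ∫⁻ x', ‖F (x, z) * F (x', z') - F (x', z) * F (x, z')‖ₑ ∂lam ∂lam ∂μ ∂μ := by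
  have hm : Measurable fun q : (X × Z) × (X × Z) => b q.1.2 * k q.2.2 * ρ q.1 q.2 :=
    ((hb.comp measurable_fst.snd).mul (hk.comp measurable_snd.snd)).mul hρ
  have hm1 : Measurable fun q => ∫⁻ q', b q.2 * k q'.2 * ρ q q' ∂Q := hm.lintegral_prod_right'
  have hmq : ∀ q, Measurable fun q' : X × Z => b q.2 * k q'.2 * ρ q q' := fun q =>
    hm.comp measurable_prodMk_left
  rw [hQ _ hm1]
  refine lintegral_mono fun z => ?_
  have e1 : ∀ x, ∫⁻ q', b z * k q'.2 * ρ (x, z) q' ∂Q = ∫⁻ z', ∫⁻ x', ENNReal.ofReal (F (x', z')) *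
      (b z * k z' * ρ (x, z) (x', z')) ∂lam ∂μ := fun x => hQ _ (hmq (x, z))
  simp only [e1]
  have hg : Measurable fun q : (X × Z) × X => ENNReal.ofReal (F (q.2, q.1.2)) *
      (b z * k q.1.2 * ρ (q.1.1, z) (q.2, q.1.2)) := by
    have h1 : Measurable fun q : (X × Z) × X => ρ (q.1.1, z) (q.2, q.1.2) :=
      hρ.comp (f := fun q : (X × Z) × X => ((q.1.1, z), (q.2, q.1.2))) (by fun_prop)
    fun_prop
  have hd : Measurable fun q : (X × Z) × X =>
      ‖F (q.1.1, z) * F (q.2, q.1.2) - F (q.2, z) * F (q.1.1, q.1.2)‖ₑ := by fun_prop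
  have hd1 : ∀ z', Measurable fun x => ∫⁻ x', ‖F (x, z) * F (x', z') - F (x', z) * F (x, z')‖ₑ ∂lam :=
    fun z' => hd.lintegral_prod_right'.comp measurable_prodMk_right
  have hd2 : ∀ x z', Measurable fun x' => ‖F (x, z) * F (x', z') - F (x', z) * F (x, z')‖ₑ :=
    fun x z' => hd.comp (measurable_prodMk_left (x := (x, z')))
  have hg1 : Measurable fun q : X × Z => ∫⁻ x', ENNReal.ofReal (F (x', q.2)) *
      (b z * k q.2 * ρ (q.1, z) (x', q.2)) ∂lam := hg.lintegral_prod_right'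
  have hg2 : ∀ x z', Measurable fun x' => ENNReal.ofReal (F (x', z')) *
      (b z * k z' * ρ (x, z) (x', z')) :=
    fun x z' => hg.comp (measurable_prodMk_left (x := (x, z')))
  have hg3 : ∀ x, Measurable fun z' => ∫⁻ x', ENNReal.ofReal (F (x', z')) *
      (b z * k z' * ρ (x, z) (x', z')) ∂lam := fun x => hg1.comp measurable_prodMk_left
  have hg4 : Measurable fun q : X × Z => ENNReal.ofReal (F (q.1, z)) *
      ∫⁻ x', ENNReal.ofReal (F (x', q.2)) * (b z * k q.2 * ρ (q.1, z) (x', q.2)) ∂lam :=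
    (hF.comp (by fun_prop : Measurable fun q : X × Z => (q.1, z))).ennreal_ofReal.mul hg1
  have e2 : ∀ x, ENNReal.ofReal (F (x, z)) * ∫⁻ z', ∫⁻ x', ENNReal.ofReal (F (x', z')) *
      (b z * k z' * ρ (x, z) (x', z')) ∂lam ∂μ = ∫⁻ z', ENNReal.ofReal (F (x, z)) *
      ∫⁻ x', ENNReal.ofReal (F (x', z')) * (b z * k z' * ρ (x, z) (x', z')) ∂lam ∂μ :=
    fun x => (lintegral_const_mul _ (hg3 x)).symm
  simp only [e2]
  rw [lintegral_lintegral_swap hg4.aemeasurable]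
  refine lintegral_mono fun z' => ?_
  rw [← lintegral_const_mul _ (hd1 z')]
  refine lintegral_mono fun x => ?_
  dsimp only
  rw [← lintegral_const_mul _ (hd2 x z'), ← lintegral_const_mul _ (hg2 x z')]
  refine lintegral_mono fun x' => ?_
  refine le_trans (le_of_eq ?_) (mul_le_mul_right (hle (x, z) (x', z')) (b z * k z'))
  ring

end DefectMean

/-! ### The effect of a transposition on the permutation law -/

section SwapMean

variable {dX dY dZ n : ℕ} {p : Rd dX → Rd dY → Rd dZ → ℝ}
  {P : Measure (Rd dX × Rd dY × Rd dZ)} {C : ℝ≥0}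

theorem measurable_densityXZ (hp : Measurable fun w : Rd dX × Rd dY × Rd dZ => p w.1 w.2.1 w.2.2) :
    Measurable (densityXZ p) := (measurable_margXZ hp).ennreal_toReal

theorem measurable_swapDefect
    (hp : Measurable fun w : Rd dX × Rd dY × Rd dZ => p w.1 w.2.1 w.2.2) :
    Measurable fun q : (Rd dX × Rd dZ) × (Rd dX × Rd dZ) => swapDefect p q.1 q.2 := by
  have h := measurable_densityXZ hp
  exact measurable_const.max (measurable_const.sub
    (((h.comp (measurable_snd.fst.prodMk measurable_fst.snd)).mul
      (h.comp (measurable_fst.fst.prodMk measurable_snd.snd))).div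
        ((h.comp measurable_fst).mul (h.comp measurable_snd))))

theorem measurable_swapDist_cptProb
    (hp : Measurable fun w : Rd dX × Rd dY × Rd dZ => p w.1 w.2.1 w.2.2) (i j : Fin n) :
    Measurable fun D : Sample dX dY dZ n => swapDist (cptProb p D) i j :=
  Finset.measurable_sum _ fun π _ =>
    ((measurable_cptProb hp π).sub (measurable_cptProb hp _)).abs

/-- A data set with given `(X, Z)` parts. -/
def ofXZ (q : Fin n → Rd dX × Rd dZ) : Sample dX dY dZ n := fun i => ((q i).1, 0, (q i).2)

theorem measurable_ofXZ :
    Measurable (ofXZ : (Fin n → Rd dX × Rd dZ) → Sample dX dY dZ n) :=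
  measurable_pi_lambda _ fun i =>
    (measurable_pi_apply i).fst.prodMk (measurable_const.prodMk (measurable_pi_apply i).snd)

/-- The permutation law does not see `Y`, so the value `0` put in its place is immaterial. -/
theorem cptProb_ofXZ (D : Sample dX dY dZ n) :
    cptProb p (ofXZ (dY := dY) fun i => obsXZ (D i)) = cptProb p D := rfl

namespace HasBoundedDensity

theorem ofReal_densityXZ (h : HasBoundedDensity p P C) (q : Rd dX × Rd dZ) :
    ENNReal.ofReal (densityXZ p q) = margXZ p q.1 q.2 :=
  ENNReal.ofReal_toReal ((h.margXZ_le _ _).trans_lt ENNReal.coe_lt_top).ne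

theorem lintegral_obsXZ (h : HasBoundedDensity p P C) {H : Rd dX × Rd dZ → ℝ≥0∞}
    (hH : Measurable H) :
    ∫⁻ w, H (obsXZ w) ∂P = ∫⁻ z, ∫⁻ x, ENNReal.ofReal (densityXZ p (x, z)) * H (x, z) := by
  have h1 := h.lintegral_XZ hH
  simp_rw [h.ofReal_densityXZ]
  rw [lintegral_lintegral_swap ((measurable_margXZ h.measurable).mul hH).aemeasurable] at h1
  exact h1

theorem measure_densityXZ_le_zero (h : HasBoundedDensity p P C) :
    P {w | densityXZ p (obsXZ w) ≤ 0} = 0 := by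
  have hs : MeasurableSet {q : Rd dX × Rd dZ | densityXZ p q ≤ 0} :=
    measurableSet_le (measurable_densityXZ h.measurable) measurable_const
  have h1 := h.lintegral_obsXZ (H := Set.indicator {q | densityXZ p q ≤ 0} 1)
    (measurable_one.indicator hs)
  have h2 : ∀ q : Rd dX × Rd dZ, ENNReal.ofReal (densityXZ p q) *
      Set.indicator {q | densityXZ p q ≤ 0} (1 : Rd dX × Rd dZ → ℝ≥0∞) q = 0 := by
    intro q
    by_cases hq : densityXZ p q ≤ 0
    · rw [ENNReal.ofReal_of_nonpos hq, zero_mul]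
    · rw [Set.indicator_of_notMem (show q ∉ {q | densityXZ p q ≤ 0} from hq), mul_zero]
  simp only [h2, lintegral_zero] at h1
  have h3 := lintegral_indicator_one (μ := P) (measurable_obsXZ hs)
  exact h3.symm.trans h1

theorem lintegral_snd_le (h : HasBoundedDensity p P C) {H : Rd dY × Rd dZ → ℝ≥0∞}
    (hH : Measurable H) : ∫⁻ w, H w.2 ∂P ≤ C * ∫⁻ v, H v := by
  rw [h.lintegral_YZ hH, ← lintegral_const_mul _ hH]
  exact lintegral_mono fun v => mul_le_mul_left (h.margYZ_le _ _) _

theorem lintegral_Z_le (h : HasBoundedDensity p P C) {H : Rd dZ → ℝ≥0∞}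
    (hH : Measurable H) : ∫⁻ w, H w.2.2 ∂P ≤ C * ∫⁻ z, H z := by
  rw [h.lintegral_Z hH, ← lintegral_const_mul _ hH]
  exact lintegral_mono fun v => mul_le_mul_left (h.margZ_le _) _

/-- Where the density of `(X, Z)` is at least `η`, a kernel in `(Y, Z)` may be integrated over its
first argument. -/
theorem lintegral_kernel_obsXZ_le (h : HasBoundedDensity p P C) {k : Rd dY × Rd dZ → ℝ≥0∞}
    (hk : Measurable k) {H : Rd dX × Rd dZ → ℝ≥0∞} (hH : Measurable H) {η : ℝ} (hη : 0 < η)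
    (hHη : ∀ q, densityXZ p q < η → H q = 0) (v : Rd dY × Rd dZ) :
    ∫⁻ w, k (v - w.2) * H (obsXZ w) ∂P ≤
      ENNReal.ofReal (C / η) * ∫⁻ w, (∫⁻ y, k (y, v.2 - w.2.2)) * H (obsXZ w) ∂P := by
  have hkv : Measurable fun v' => k (v - v') := hk.comp (measurable_id.const_sub v)
  have hb : Measurable fun z => ∫⁻ y, k (y, z) := hk.lintegral_prod_left'
  have hm1 : Measurable fun w : Rd dX × Rd dY × Rd dZ => k (v - w.2) * H (obsXZ w) :=
    (hkv.comp measurable_snd).mul (hH.comp measurable_obsXZ)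
  have hm2 : Measurable fun q : Rd dX × Rd dZ => (∫⁻ y, k (y, v.2 - q.2)) * H q :=
    (hb.comp (measurable_snd.const_sub v.2)).mul hH
  have hm3 : Measurable fun q : Rd dX × Rd dZ => margXZ p q.1 q.2 *
      ((∫⁻ y, k (y, v.2 - q.2)) * H q) := (measurable_margXZ h.measurable).mul hm2
  have hm4 : Measurable fun x => ∫⁻ z, margXZ p x z * ((∫⁻ y, k (y, v.2 - z)) * H (x, z)) :=
    hm3.lintegral_prod_right'
  have e1 := h.lintegral_XZ (H := fun q => (∫⁻ y, k (y, v.2 - q.2)) * H q) hm2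
  have e2 : ∫⁻ w, (∫⁻ y, k (y, v.2 - w.2.2)) * H (obsXZ w) ∂P =
      ∫⁻ x, ∫⁻ z, margXZ p x z * ((∫⁻ y, k (y, v.2 - z)) * H (x, z)) := e1
  rw [h.lintegral_eq hm1, e2, ← lintegral_const_mul _ hm4]
  refine lintegral_mono fun x => ?_
  have hHx : Measurable fun z => H (x, z) := hH.comp (measurable_const.prodMk measurable_id)
  have hm5 : Measurable fun z => margXZ p x z * ((∫⁻ y, k (y, v.2 - z)) * H (x, z)) :=
    hm3.comp (measurable_const.prodMk measurable_id)
  have hpx : Measurable fun q : Rd dY × Rd dZ => ENNReal.ofReal (p x q.1 q.2) :=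
    h.measurable.ennreal_ofReal.comp (measurable_const.prodMk measurable_id)
  have hm6 : Measurable fun q : Rd dY × Rd dZ =>
      ENNReal.ofReal (p x q.1 q.2) * (k (v - q) * H (x, q.2)) :=
    hpx.mul (hkv.mul (hHx.comp measurable_snd))
  rw [← lintegral_const_mul _ hm5]
  change ∫⁻ y, ∫⁻ z, ENNReal.ofReal (p x y z) * (k (v - (y, z)) * H (x, z)) ≤ _
  rw [lintegral_lintegral_swap hm6.aemeasurable]
  refine lintegral_mono fun z => ?_
  have hkz : Measurable fun y => k (v - (y, z)) :=
    hkv.comp (measurable_id.prodMk measurable_const)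
  have hbz : ∫⁻ y, k (v - (y, z)) = ∫⁻ y, k (y, v.2 - z) :=
    lintegral_sub_left_eq_self (fun y => k (y, v.2 - z)) v.1
  calc ∫⁻ y, ENNReal.ofReal (p x y z) * (k (v - (y, z)) * H (x, z))
      ≤ ∫⁻ y, C * H (x, z) * k (v - (y, z)) := by
        refine lintegral_mono fun y => ?_
        rw [mul_comm (k _), ← mul_assoc]
        gcongr
        exact ENNReal.ofReal_le_of_le_toReal (h.le x y z)
    _ = C * H (x, z) * ∫⁻ y, k (y, v.2 - z) := by rw [lintegral_const_mul _ hkz, hbz]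
    -- Where `H` does not vanish, `p_{X,Z} ≥ η`, so the bound `C` on the joint density is at most
    -- `(C / η) p_{X,Z}`.
    _ ≤ ENNReal.ofReal (C / η) * margXZ p x z * H (x, z) * ∫⁻ y, k (y, v.2 - z) := by
        gcongr ?_ * _
        by_cases hq : densityXZ p (x, z) < η
        · rw [hHη _ hq]; simp
        · gcongr
          rw [← h.ofReal_densityXZ (x, z), ← ENNReal.ofReal_mul (by positivity),
            ← ENNReal.ofReal_coe_nnreal]
          refine ENNReal.ofReal_le_ofReal ?_
          rw [div_mul_eq_mul_div, le_div_iff₀ hη]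
          exact mul_le_mul_of_nonneg_left (not_lt.1 hq) C.coe_nonneg
    _ = _ := by ring

/-- The two laws have the same `(X, Z)` marginal, and this passes to products. -/
theorem lintegral_pi_obsXZ [IsProbabilityMeasure P] (h : HasBoundedDensity p P C)
    {H : (Fin n → Rd dX × Rd dZ) → ℝ≥0∞} (hH : Measurable H) :
    ∫⁻ D, H (fun i => obsXZ (D i)) ∂Measure.pi (fun _ : Fin n => P) =
      ∫⁻ D, H (fun i => obsXZ (D i)) ∂Measure.pi (fun _ : Fin n => condProduct p) := by
  have hprob := h.isProbabilityMeasure_condProduct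
  have hmeas : Measurable fun (D : Sample dX dY dZ n) i => obsXZ (D i) :=
    measurable_pi_lambda _ fun i => measurable_obsXZ.comp (measurable_pi_apply i)
  rw [← lintegral_map hH hmeas, ← lintegral_map hH hmeas]
  have hpr1 : IsProbabilityMeasure (P.map obsXZ) :=
    Measure.isProbabilityMeasure_map measurable_obsXZ.aemeasurable
  have hpr2 : IsProbabilityMeasure ((condProduct p).map obsXZ) :=
    Measure.isProbabilityMeasure_map measurable_obsXZ.aemeasurable
  rw [Measure.pi_map_pi (fun _ => measurable_obsXZ.aemeasurable),
    Measure.pi_map_pi (fun _ => measurable_obsXZ.aemeasurable)]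
  have h1 : (condProduct p).map obsXZ = P.map obsXZ := h.map_XZ_condProduct
  rw [h1]

/-- A function of the `(X, Z)` parts that is bounded by the conditional mean of another one over
the permutations has the smaller mean. -/
theorem lintegral_le_of_le_sum_cptProb [IsProbabilityMeasure P] (h : HasBoundedDensity p P C)
    {H₁ H₂ : (Fin n → Rd dX × Rd dZ) → ℝ≥0∞} (hH₁ : Measurable H₁) (hH₂ : Measurable H₂)
    (hle : ∀ D : Sample dX dY dZ n, H₁ (fun i => obsXZ (D i)) ≤
      ∑ π, ENNReal.ofReal (cptProb p D π) * H₂ (fun i => obsXZ (permuteX π D i))) :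
    ∫⁻ D, H₁ (fun i => obsXZ (D i)) ∂Measure.pi (fun _ : Fin n => P) ≤
      ∫⁻ D, H₂ (fun i => obsXZ (D i)) ∂Measure.pi (fun _ : Fin n => P) := by
  have hprob := h.isProbabilityMeasure_condProduct
  have hmeas : Measurable fun (D : Sample dX dY dZ n) i => obsXZ (D i) :=
    measurable_pi_lambda _ fun i => measurable_obsXZ.comp (measurable_pi_apply i)
  have hH₃ : Measurable fun D : Sample dX dY dZ n => H₂ fun i => obsXZ (D i) := hH₂.comp hmeas
  have hnu : IsFiniteMeasure (volume.withDensity fun v : Rd dY × Rd dZ => margYZ p v.1 v.2) := by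
    rw [← h.map_snd]; infer_instance
  rw [h.lintegral_pi_obsXZ hH₁, h.lintegral_pi_obsXZ hH₂,
    -- After the passage to `condProduct p` the invariance of the resampling absorbs the mean over
    -- the permutations.
    ← lintegral_sum_cptProb_permuteX h.measurable _ (condProduct p) rfl hH₃]
  exact lintegral_mono hle

/-- A general form of the bound on the mean transposition defect. -/
theorem lintegral_kernel_kernel_defect_le [SFinite P] (h : HasBoundedDensity p P C)
    {b k : Rd dZ → ℝ≥0∞} (hb : Measurable b) (hk : Measurable k) (hb1 : ∫⁻ u, b u = 1)
    (hk1 : ∫⁻ u, k u = 1) {ρ : Rd dX × Rd dZ → Rd dX × Rd dZ → ℝ≥0∞}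
    (hρ : Measurable fun q : (Rd dX × Rd dZ) × (Rd dX × Rd dZ) => ρ q.1 q.2)
    (hle : ∀ q q', ENNReal.ofReal (densityXZ p q) * ENNReal.ofReal (densityXZ p q') * ρ q q' ≤
      ‖densityXZ p q * densityXZ p q' - densityXZ p (q'.1, q.2) * densityXZ p (q.1, q'.2)‖ₑ) :
    ∫⁻ w₀, (∫⁻ w, (∫⁻ w', b (w₀.2.2 - w.2.2) * k (w₀.2.2 - w'.2.2) *
        ρ (obsXZ w) (obsXZ w') ∂P) ∂P) ∂P ≤
      C * (2 * C * ((∫⁻ u, b u * l1Modulus volume volume (densityXZ p) u) +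
        ∫⁻ u, k u * l1Modulus volume volume (densityXZ p) u)) := by
  set Q : Measure (Rd dX × Rd dZ) := P.map obsXZ with hQdef
  have hF := measurable_densityXZ h.measurable
  have hQ : ∀ H : Rd dX × Rd dZ → ℝ≥0∞, Measurable H →
      ∫⁻ q, H q ∂Q = ∫⁻ z, ∫⁻ x, ENNReal.ofReal (densityXZ p (x, z)) * H (x, z) := fun H hH => by
    rw [hQdef, lintegral_map hH measurable_obsXZ, h.lintegral_obsXZ hH]
  have hC : ∀ z, ∫⁻ x, ENNReal.ofReal (densityXZ p (x, z)) ≤ C := fun z => by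
    simp_rw [h.ofReal_densityXZ]
    exact h.margZ_le z
  have hm : Measurable fun q : Rd dZ × (Rd dX × Rd dZ) × (Rd dX × Rd dZ) =>
      b (q.1 - q.2.1.2) * k (q.1 - q.2.2.2) * ρ q.2.1 q.2.2 :=
    ((hb.comp (measurable_fst.sub measurable_snd.fst.snd)).mul
      (hk.comp (measurable_fst.sub measurable_snd.snd.snd))).mul (hρ.comp measurable_snd)
  have hm0 : Measurable fun q : (Rd dZ × (Rd dX × Rd dZ)) × (Rd dX × Rd dZ) =>
      b (q.1.1 - q.1.2.2) * k (q.1.1 - q.2.2) * ρ q.1.2 q.2 :=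
    hm.comp (measurable_fst.fst.prodMk (measurable_fst.snd.prodMk measurable_snd))
  have hm1 : Measurable fun q : Rd dZ × (Rd dX × Rd dZ) =>
      ∫⁻ q', b (q.1 - q.2.2) * k (q.1 - q'.2) * ρ q.2 q' ∂Q := hm0.lintegral_prod_right'
  have hm2 : Measurable fun t : Rd dZ =>
      ∫⁻ q, ∫⁻ q', b (t - q.2) * k (t - q'.2) * ρ q q' ∂Q ∂Q := hm1.lintegral_prod_right'
  have e1 : ∀ t, ∫⁻ q, ∫⁻ q', b (t - q.2) * k (t - q'.2) * ρ q q' ∂Q ∂Q =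
      ∫⁻ w, (∫⁻ w', b (t - w.2.2) * k (t - w'.2.2) * ρ (obsXZ w) (obsXZ w') ∂P) ∂P := by
    intro t
    have h1 : Measurable fun q => ∫⁻ q', b (t - q.2) * k (t - q'.2) * ρ q q' ∂Q :=
      hm1.comp measurable_prodMk_left
    have h2 : ∀ q, Measurable fun q' : Rd dX × Rd dZ => b (t - q.2) * k (t - q'.2) * ρ q q' :=
      fun q => hm0.comp (measurable_prodMk_left (x := (t, q)))
    rw [hQdef, lintegral_map (hQdef ▸ h1) measurable_obsXZ]
    refine lintegral_congr fun w => ?_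
    rw [lintegral_map (h2 _) measurable_obsXZ]
    rfl
  calc _ = ∫⁻ w₀, (∫⁻ q, ∫⁻ q', b (w₀.2.2 - q.2) * k (w₀.2.2 - q'.2) * ρ q q' ∂Q ∂Q) ∂P :=
        lintegral_congr fun w₀ => (e1 _).symm
    -- The bound on `p_Z` replaces the observed centre by Lebesgue measure in `t`.
    _ ≤ C * ∫⁻ t, ∫⁻ q, ∫⁻ q', b (t - q.2) * k (t - q'.2) * ρ q q' ∂Q ∂Q := h.lintegral_Z_le hm2
    _ ≤ _ := mul_le_mul_right ((lintegral_mono fun t => lintegral_kernel_kernel_mul_le hF hQ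
        (hb.comp (measurable_id.const_sub t)) (hk.comp (measurable_id.const_sub t)) hρ hle).trans
          (lintegral_kernel_kernel_enorm_le hF (densityXZ_nonneg p) hC hb hk hb1 hk1)) _

end HasBoundedDensity

end SwapMean

/-! ### Transposition distances weighted by two kernels -/

section WeightedSwap

variable {dX dY dZ n : ℕ} {p : Rd dX → Rd dY → Rd dZ → ℝ}
  {P : Measure (Rd dX × Rd dY × Rd dZ)} {C : ℝ≥0}

namespace HasBoundedDensity

/-- The kernel `k₁` contains `Y`, so `lintegral_le_of_le_sum_cptProb` does not apply to it directly.
Where `p_{X,Z}` at observation `i` is at least `η`, the kernel is first integrated over `y`; where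
it is smaller, `Δ ≤ 2` and the two kernels contribute a factor `C` each. -/
theorem lintegral_kernel_kernel_obs_le [IsProbabilityMeasure P] (h : HasBoundedDensity p P C)
    {k₁ : Rd dY × Rd dZ → ℝ≥0∞} {k₂ : Rd dZ → ℝ≥0∞} (hk₁ : Measurable k₁) (hk₂ : Measurable k₂)
    (hk₁1 : ∫⁻ v, k₁ v = 1) (hk₂1 : ∫⁻ z, k₂ z = 1)
    {Δ : (Fin n → Rd dX × Rd dZ) → ℝ≥0∞} (hΔ : Measurable Δ) (hΔ2 : ∀ q, Δ q ≤ 2)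
    {ρ : Rd dX × Rd dZ → Rd dX × Rd dZ → ℝ≥0∞}
    (hρ : Measurable fun q : (Rd dX × Rd dZ) × (Rd dX × Rd dZ) => ρ q.1 q.2)
    (hle : ∀ q q', ENNReal.ofReal (densityXZ p q) * ENNReal.ofReal (densityXZ p q') * ρ q q' ≤
      ‖densityXZ p q * densityXZ p q' - densityXZ p (q'.1, q.2) * densityXZ p (q.1, q'.2)‖ₑ)
    {s i j : Fin n} (his : i ≠ s) (hjs : j ≠ s) (hij : i ≠ j)
    (hΔρ : ∀ D : Sample dX dY dZ n, Δ (fun l => obsXZ (D l)) ≤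
      ∑ π, ENNReal.ofReal (cptProb p D π) *
        (2 * ρ (obsXZ (permuteX π D i)) (obsXZ (permuteX π D j))))
    {η : ℝ} (hη : 0 < η) :
    ∫⁻ D, k₁ ((D s).2 - (D i).2) * k₂ ((D s).2.2 - (D j).2.2) * Δ (fun l => obsXZ (D l))
        ∂Measure.pi (fun _ : Fin n => P) ≤
      2 * C * C * P {w | densityXZ p (obsXZ w) < η} + ENNReal.ofReal (C / η) * (2 * (C * (2 * C *
        ((∫⁻ u, (∫⁻ y, k₁ (y, u)) * l1Modulus volume volume (densityXZ p) u) +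
          ∫⁻ u, k₂ u * l1Modulus volume volume (densityXZ p) u)))) := by
  have hinv : (volume : Measure (Rd dY × Rd dZ)).IsAddLeftInvariant := by
    rw [Measure.volume_eq_prod]; infer_instance
  set Q := Measure.pi fun _ : Fin n => P
  set b : Rd dZ → ℝ≥0∞ := fun u => ∫⁻ y, k₁ (y, u) with hbdef
  have hb : Measurable b := hk₁.lintegral_prod_left'
  have hb1 : ∫⁻ u, b u = 1 := by
    rw [← hk₁1, Measure.volume_eq_prod, lintegral_prod_symm _ hk₁.aemeasurable]
  set S : Set (Rd dX × Rd dZ) := {q | densityXZ p q < η}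
  have hS : MeasurableSet S := measurableSet_lt (measurable_densityXZ h.measurable) measurable_const
  have hobs : Measurable fun (D : Sample dX dY dZ n) l => obsXZ (D l) :=
    measurable_pi_lambda _ fun l => measurable_obsXZ.comp (measurable_pi_apply l)
  have hΔD : Measurable fun D : Sample dX dY dZ n => Δ fun l => obsXZ (D l) := hΔ.comp hobs
  have hmk1 : Measurable fun D : Sample dX dY dZ n => k₁ ((D s).2 - (D i).2) :=
    hk₁.comp ((measurable_pi_apply s).snd.sub (measurable_pi_apply i).snd)
  have hmk2 : Measurable fun D : Sample dX dY dZ n => k₂ ((D s).2.2 - (D j).2.2) :=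
    hk₂.comp ((measurable_pi_apply s).snd.snd.sub (measurable_pi_apply j).snd.snd)
  have hmb : Measurable fun D : Sample dX dY dZ n => b ((D s).2.2 - (D i).2.2) :=
    hb.comp ((measurable_pi_apply s).snd.snd.sub (measurable_pi_apply i).snd.snd)
  have hS1 : Measurable fun w : Rd dX × Rd dY × Rd dZ => S.indicator (1 : Rd dX × Rd dZ → ℝ≥0∞) (obsXZ w) :=
    (measurable_one.indicator hS).comp measurable_obsXZ
  have hSc : Measurable (Sᶜ.indicator (1 : Rd dX × Rd dZ → ℝ≥0∞)) := measurable_one.indicator hS.compl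
  have hSc1 : Measurable fun D : Sample dX dY dZ n =>
      Sᶜ.indicator (1 : Rd dX × Rd dZ → ℝ≥0∞) (obsXZ (D i)) :=
    (hSc.comp measurable_obsXZ).comp (measurable_pi_apply i)
  have htrans1 : ∀ v, Measurable fun w : Rd dX × Rd dY × Rd dZ => k₁ (w.2 - v) := fun v =>
    hk₁.comp (measurable_snd.sub_const v)
  -- the part with small density
  have hA : ∫⁻ D, S.indicator 1 (obsXZ (D i)) * (k₁ ((D s).2 - (D i).2) *
      (2 * k₂ ((D s).2.2 - (D j).2.2))) ∂Q ≤ 2 * C * C * P {w | densityXZ p (obsXZ w) < η} := by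
    have hm : Measurable fun q : (Rd dX × Rd dY × Rd dZ) × (Rd dX × Rd dY × Rd dZ) ×
        (Rd dX × Rd dY × Rd dZ) => S.indicator (1 : Rd dX × Rd dZ → ℝ≥0∞) (obsXZ q.1) * (k₁ (q.2.1.2 - q.1.2) *
          (2 * k₂ (q.2.1.2.2 - q.2.2.2.2))) :=
      (hS1.comp measurable_fst).mul ((hk₁.comp (measurable_snd.fst.snd.sub measurable_fst.snd)).mul
        ((hk₂.comp (measurable_snd.fst.snd.snd.sub measurable_snd.snd.snd.snd)).const_mul 2))
    rw [lintegral_pi_triple P his hij hjs.symm (f := fun w w₀ w' =>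
      S.indicator (1 : Rd dX × Rd dZ → ℝ≥0∞) (obsXZ w) * (k₁ (w₀.2 - w.2) * (2 * k₂ (w₀.2.2 - w'.2.2)))) hm]
    have h1 : ∀ w w₀ : Rd dX × Rd dY × Rd dZ, ∫⁻ w', S.indicator (1 : Rd dX × Rd dZ → ℝ≥0∞) (obsXZ w) *
        (k₁ (w₀.2 - w.2) * (2 * k₂ (w₀.2.2 - w'.2.2))) ∂P ≤
        S.indicator (1 : Rd dX × Rd dZ → ℝ≥0∞) (obsXZ w) * (2 * C) * k₁ (w₀.2 - w.2) := by
      intro w w₀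
      have hk : Measurable fun z => k₂ (w₀.2.2 - z) := hk₂.comp (measurable_id.const_sub _)
      have hk' : Measurable fun w' : Rd dX × Rd dY × Rd dZ => k₂ (w₀.2.2 - w'.2.2) :=
        hk.comp measurable_snd.snd
      have h2 : ∫⁻ w', k₂ (w₀.2.2 - w'.2.2) ∂P ≤ C := by
        refine (h.lintegral_Z_le hk).trans ?_
        rw [lintegral_sub_left_eq_self k₂, hk₂1, mul_one]
      calc _ = ∫⁻ w', (S.indicator (1 : Rd dX × Rd dZ → ℝ≥0∞) (obsXZ w) * k₁ (w₀.2 - w.2) * 2) *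
            k₂ (w₀.2.2 - w'.2.2) ∂P := by congr 1; ext w'; ring
        _ ≤ (S.indicator (1 : Rd dX × Rd dZ → ℝ≥0∞) (obsXZ w) * k₁ (w₀.2 - w.2) * 2) * C := by
            rw [lintegral_const_mul _ hk']
            exact mul_le_mul_right h2 _
        _ = _ := by ring
    calc _ ≤ ∫⁻ w, (∫⁻ w₀, S.indicator (1 : Rd dX × Rd dZ → ℝ≥0∞) (obsXZ w) * (2 * C) * k₁ (w₀.2 - w.2) ∂P) ∂P :=
          lintegral_mono fun w => lintegral_mono fun w₀ => h1 w w₀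
      _ ≤ ∫⁻ w, (2 * C * C) * S.indicator (1 : Rd dX × Rd dZ → ℝ≥0∞) (obsXZ w) ∂P := by
          refine lintegral_mono fun w => ?_
          have h3 : ∫⁻ w₀, k₁ (w₀.2 - w.2) ∂P ≤ C := by
            refine (h.lintegral_snd_le (H := fun v => k₁ (v - w.2))
              (hk₁.comp (measurable_id.sub_const _))).trans ?_
            rw [lintegral_sub_right_eq_self k₁, hk₁1, mul_one]
          dsimp only
          rw [lintegral_const_mul _ (htrans1 _)]
          refine (mul_le_mul_right h3 _).trans (le_of_eq ?_)
          ring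
      _ = _ := by
          rw [lintegral_const_mul _ hS1]
          congr 1
          exact lintegral_indicator_one (measurable_obsXZ hS)
  -- the part with large density
  have hB : ∫⁻ D, k₁ ((D s).2 - (D i).2) * (k₂ ((D s).2.2 - (D j).2.2) *
      Δ (fun l => obsXZ (D l)) * Sᶜ.indicator 1 (obsXZ (D i))) ∂Q ≤
      ENNReal.ofReal (C / η) * ∫⁻ D, b ((D s).2.2 - (D i).2.2) * (k₂ ((D s).2.2 - (D j).2.2) *
        Δ (fun l => obsXZ (D l))) ∂Q := by
    have hm1 : Measurable fun D : Sample dX dY dZ n => k₁ ((D s).2 - (D i).2) *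
        (k₂ ((D s).2.2 - (D j).2.2) * Δ (fun l => obsXZ (D l)) *
          Sᶜ.indicator 1 (obsXZ (D i))) := hmk1.mul ((hmk2.mul hΔD).mul hSc1)
    have hm2 : Measurable fun D : Sample dX dY dZ n => b ((D s).2.2 - (D i).2.2) *
        (k₂ ((D s).2.2 - (D j).2.2) * Δ (fun l => obsXZ (D l)) *
          Sᶜ.indicator 1 (obsXZ (D i))) := hmb.mul ((hmk2.mul hΔD).mul hSc1)
    have h1 : ∫⁻ D, k₁ ((D s).2 - (D i).2) * (k₂ ((D s).2.2 - (D j).2.2) *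
        Δ (fun l => obsXZ (D l)) * Sᶜ.indicator 1 (obsXZ (D i))) ∂Q ≤
        ENNReal.ofReal (C / η) * ∫⁻ D, b ((D s).2.2 - (D i).2.2) * (k₂ ((D s).2.2 - (D j).2.2) *
          Δ (fun l => obsXZ (D l)) * Sᶜ.indicator 1 (obsXZ (D i))) ∂Q := by
      -- With the other observations frozen, `Δ` is a function of `(X_i, Z_i)` alone, so `Y_i` can
      -- be integrated out of `k₁`.
      rw [lintegral_pi_update (fun _ : Fin n => P) i hm1,
        lintegral_pi_update (fun _ : Fin n => P) i hm2, ← lintegral_const_mul']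
      · refine lintegral_mono fun D => ?_
        have hupd : ∀ w, (fun l => obsXZ (Function.update D i w l)) =
            Function.update (fun l => obsXZ (D l)) i (obsXZ w) := by
          intro w
          ext1 l
          rcases eq_or_ne l i with rfl | hl
          · simp
          · simp [Function.update_of_ne hl]
        simp only [Function.update_self, Function.update_of_ne his.symm,
          Function.update_of_ne hij.symm, hupd]
        have hH : Measurable fun q => k₂ ((D s).2.2 - (D j).2.2) *
            Δ (Function.update (fun l => obsXZ (D l)) i q) * Sᶜ.indicator 1 q :=
          ((hΔ.comp (measurable_update _)).const_mul _).mul hSc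
        refine h.lintegral_kernel_obsXZ_le hk₁ hH hη (fun q hq => ?_) (D s).2
        rw [Set.indicator_of_notMem (show q ∉ Sᶜ from fun h' => h' hq), mul_zero]
      · exact ENNReal.ofReal_ne_top
    refine h1.trans (mul_le_mul_right (lintegral_mono fun D => ?_) _)
    refine mul_le_mul_right (mul_le_of_le_one_right' ?_) _
    exact Set.indicator_le_self' (fun _ _ => zero_le_one) _
  have hD : ∫⁻ D, b ((D s).2.2 - (D i).2.2) * (k₂ ((D s).2.2 - (D j).2.2) *
        Δ (fun l => obsXZ (D l))) ∂Q ≤ 2 * (C * (2 * C *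
        ((∫⁻ u, b u * l1Modulus volume volume (densityXZ p) u) +
          ∫⁻ u, k₂ u * l1Modulus volume volume (densityXZ p) u))) := by
    have hg : Measurable fun q : Fin n → Rd dX × Rd dZ =>
        b ((q s).2 - (q i).2) * k₂ ((q s).2 - (q j).2) :=
      (hb.comp ((measurable_pi_apply s).snd.sub (measurable_pi_apply i).snd)).mul
        (hk₂.comp ((measurable_pi_apply s).snd.sub (measurable_pi_apply j).snd))
    have hr : Measurable fun q : Fin n → Rd dX × Rd dZ => ρ (q i) (q j) :=
      hρ.comp ((measurable_pi_apply (X := fun _ : Fin n => Rd dX × Rd dZ) i).prodMk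
        (measurable_pi_apply j))
    have hH1 : Measurable fun q : Fin n → Rd dX × Rd dZ =>
        b ((q s).2 - (q i).2) * k₂ ((q s).2 - (q j).2) * Δ q := hg.mul hΔ
    have hH2 : Measurable fun q : Fin n → Rd dX × Rd dZ =>
        b ((q s).2 - (q i).2) * k₂ ((q s).2 - (q j).2) * (2 * ρ (q i) (q j)) :=
      hg.mul (hr.const_mul 2)
    have hH3 : Measurable fun D : Sample dX dY dZ n => b ((D s).2.2 - (D i).2.2) *
        k₂ ((D s).2.2 - (D j).2.2) * ρ (obsXZ (D i)) (obsXZ (D j)) := (hg.mul hr).comp hobs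
    have hm : Measurable fun q : (Rd dX × Rd dY × Rd dZ) × (Rd dX × Rd dY × Rd dZ) ×
        (Rd dX × Rd dY × Rd dZ) => b (q.1.2.2 - q.2.1.2.2) * k₂ (q.1.2.2 - q.2.2.2.2) *
          ρ (obsXZ q.2.1) (obsXZ q.2.2) :=
      ((hb.comp (measurable_fst.snd.snd.sub measurable_snd.fst.snd.snd)).mul
        (hk₂.comp (measurable_fst.snd.snd.sub measurable_snd.snd.snd.snd))).mul
          (hρ.comp ((measurable_obsXZ.comp measurable_snd.fst).prodMk
            (measurable_obsXZ.comp measurable_snd.snd)))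
    -- Now everything is a function of the `(X, Z)` parts, and the kernels involve only `Z`, which
    -- permutations leave in place. So the bound on `Δ` by a mean over permutations becomes one by
    -- `2 ρ` at the data themselves.
    have h1 : ∫⁻ D, b ((D s).2.2 - (D i).2.2) * (k₂ ((D s).2.2 - (D j).2.2) *
        Δ (fun l => obsXZ (D l))) ∂Q ≤ ∫⁻ D, b ((D s).2.2 - (D i).2.2) *
        k₂ ((D s).2.2 - (D j).2.2) * (2 * ρ (obsXZ (D i)) (obsXZ (D j))) ∂Q := by
      simp only [← mul_assoc (b _)]
      refine h.lintegral_le_of_le_sum_cptProb hH1 hH2 fun D => ?_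
      refine (mul_le_mul_right (hΔρ D) _).trans (le_of_eq ?_)
      rw [Finset.mul_sum]
      refine Finset.sum_congr rfl fun π _ => ?_
      exact mul_left_comm _ _ _
    have h2 : ∫⁻ D, b ((D s).2.2 - (D i).2.2) * k₂ ((D s).2.2 - (D j).2.2) *
        (2 * ρ (obsXZ (D i)) (obsXZ (D j))) ∂Q = 2 * ∫⁻ D, b ((D s).2.2 - (D i).2.2) *
        k₂ ((D s).2.2 - (D j).2.2) * ρ (obsXZ (D i)) (obsXZ (D j)) ∂Q := by
      rw [← lintegral_const_mul _ hH3]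
      exact lintegral_congr fun D => mul_left_comm _ _ _
    rw [h2, lintegral_pi_triple P his.symm hjs.symm hij (f := fun w₀ w w' =>
      b (w₀.2.2 - w.2.2) * k₂ (w₀.2.2 - w'.2.2) * ρ (obsXZ w) (obsXZ w')) hm] at h1
    exact h1.trans (mul_le_mul_right
      (h.lintegral_kernel_kernel_defect_le hb hk₂ hb1 hk₂1 hρ hle) _)
  have hmA : Measurable fun D : Sample dX dY dZ n => S.indicator (1 : Rd dX × Rd dZ → ℝ≥0∞) (obsXZ (D i)) *
      (k₁ ((D s).2 - (D i).2) * (2 * k₂ ((D s).2.2 - (D j).2.2))) :=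
    (hS1.comp (measurable_pi_apply i)).mul (hmk1.mul (hmk2.const_mul 2))
  calc _ ≤ ∫⁻ D, (S.indicator (1 : Rd dX × Rd dZ → ℝ≥0∞) (obsXZ (D i)) * (k₁ ((D s).2 - (D i).2) *
        (2 * k₂ ((D s).2.2 - (D j).2.2))) + k₁ ((D s).2 - (D i).2) *
        (k₂ ((D s).2.2 - (D j).2.2) * Δ (fun l => obsXZ (D l)) *
          Sᶜ.indicator 1 (obsXZ (D i)))) ∂Q := by
        refine lintegral_mono fun D => ?_
        by_cases hD : obsXZ (D i) ∈ S
        · rw [Set.indicator_of_mem hD, Set.indicator_of_notMem (show obsXZ (D i) ∉ Sᶜ from fun h' => h' hD)]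
          simp only [Pi.one_apply, one_mul, mul_zero, add_zero]
          rw [mul_assoc, mul_comm 2]
          gcongr
          exact hΔ2 _
        · rw [Set.indicator_of_notMem hD, Set.indicator_of_mem (show obsXZ (D i) ∈ Sᶜ from hD)]
          simp only [Pi.one_apply, mul_one, zero_mul, zero_add, mul_assoc, le_refl]
    _ ≤ _ := by
        rw [lintegral_add_left hmA]
        exact add_le_add hA (hB.trans (mul_le_mul_right hD _))

end HasBoundedDensity

end WeightedSwap

/-! ### Transposition distances and density estimates for vanishing bandwidths -/

section Consequences

variable {dX dY dZ : ℕ} {p : Rd dX → Rd dY → Rd dZ → ℝ}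
  {P : Measure (Rd dX × Rd dY × Rd dZ)} {C : ℝ≥0} {K K₁ K₂ : ℝ → ℝ} {h h₁ h₂ : ℕ → ℝ}

instance isAddHaarMeasure_volume_prod :
    (volume : Measure (Rd dX × Rd dZ)).IsAddHaarMeasure := by
  rw [Measure.volume_eq_prod]; infer_instance

instance isNegInvariant_volume_prod : (volume : Measure (Rd dX × Rd dZ)).IsNegInvariant := by
  have : (volume : Measure (Rd dX × Rd dZ)).Regular := by
    rw [Measure.volume_eq_prod]; infer_instance
  exact Measure.IsAddHaarMeasure.isNegInvariant_of_regular _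

namespace HasBoundedDensity

theorem integrable_densityXZ [IsProbabilityMeasure P] (hp : HasBoundedDensity p P C) :
    Integrable (densityXZ p) := by
  have hm := measurable_densityXZ hp.measurable
  refine ⟨hm.aestronglyMeasurable, ?_⟩
  rw [hasFiniteIntegral_iff_ofReal (Eventually.of_forall (densityXZ_nonneg p)),
    Measure.volume_eq_prod, lintegral_prod_symm _ hm.ennreal_ofReal.aemeasurable]
  have h1 := hp.lintegral_obsXZ (H := fun _ => 1) measurable_const
  simp only [lintegral_const, measure_univ, mul_one] at h1
  rw [← h1]
  exact ENNReal.one_lt_top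

/-- A shift of `z` alone is the translation of the product space by `(0, -u)`. -/
theorem tendsto_l1Modulus_densityXZ [IsProbabilityMeasure P] (hp : HasBoundedDensity p P C) :
    Tendsto (l1Modulus volume volume (densityXZ p)) (𝓝 0) (𝓝 0) := by
  have hF := measurable_densityXZ hp.measurable
  have h1 := (tendsto_lintegral_enorm_translate_sub volume hp.integrable_densityXZ).comp
    (show Tendsto (fun u : Rd dZ => ((0 : Rd dX), -u)) (𝓝 0) (𝓝 0) by
      have : Continuous fun u : Rd dZ => ((0 : Rd dX), -u) := by fun_prop
      have h0 := this.tendsto 0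
      rwa [neg_zero] at h0)
  refine h1.congr fun u => ?_
  have hm : Measurable fun v : Rd dX × Rd dZ =>
      ‖densityXZ p ((0, -u) + v) - densityXZ p v‖ₑ :=
    ((hF.comp (measurable_const.add measurable_id)).sub hF).enorm
  simp only [Function.comp_apply]
  rw [Measure.volume_eq_prod, lintegral_prod_symm _ hm.aemeasurable, l1Modulus]
  refine lintegral_congr fun t => lintegral_congr fun x => ?_
  simp only [Prod.mk_add_mk, zero_add, neg_add_eq_sub]

/-- The mean effect of transpositions on the permutation law, weighted by the two kernels,
is negligible. -/
theorem eventually_lintegral_kernel_swapDist_le [IsProbabilityMeasure P]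
    (hp : HasBoundedDensity p P C)
    (hK₁ : KernelAssumption (dY + dZ) K₁) (hK₂ : KernelAssumption dZ K₂)
    (hpos₁ : ∀ n, 0 < h₁ n) (hpos₂ : ∀ n, 0 < h₂ n) (hlim₁ : Tendsto h₁ atTop (𝓝 0))
    (hlim₂ : Tendsto h₂ atTop (𝓝 0)) {ε : ℝ≥0∞} (hε : 0 < ε) :
    ∀ᶠ n in atTop, ∀ s i j : Fin n, i ≠ s → j ≠ s → i ≠ j →
      ∫⁻ D, ENNReal.ofReal (kernelYZ K₁ (h₁ n) ((D s).2 - (D i).2)) *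
        ENNReal.ofReal (kernelZ K₂ (h₂ n) ((D s).2.2 - (D j).2.2)) *
          ENNReal.ofReal (swapDist (cptProb p D) i j) ∂Measure.pi (fun _ : Fin n => P) ≤ ε := by
  have hω := hp.tendsto_l1Modulus_densityXZ
  obtain ⟨R₁, -, hR₁⟩ := hK₁.exists_support
  obtain ⟨R₂, -, hR₂⟩ := hK₂.exists_support
  have t1 := tendsto_lintegral_kernel_mul hω (μ := volume)
    (k := fun n => kernelYZMarg (dY := dY) K₁ (h₁ n))
    (fun n => measurable_kernelYZMarg hK₁.measurable)
    (fun n => (lintegral_kernelYZMarg hK₁ (hpos₁ n)).le)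
    (eventually_forall_notMem_of_support hlim₁ fun n v => kernelYZMarg_eq_zero hR₁ (hpos₁ n))
  have t2 := tendsto_lintegral_kernel_mul hω (μ := volume)
    (k := fun n z => ENNReal.ofReal (kernelZ K₂ (h₂ n) z))
    (fun n => (measurable_kernelZ hK₂.measurable).ennreal_ofReal)
    (fun n => (lintegral_kernelZ hK₂ (hpos₂ n)).le)
    (eventually_forall_notMem_of_support hlim₂ fun n v hv => by
      rw [kernelZ_eq_zero hR₂ (hpos₂ n) hv, ENNReal.ofReal_zero])
  -- `η` is fixed before `n` so that the region of small density costs less than `ε`; the factor `C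
  -- / η` is then a constant in front of moduli that tend to zero.
  obtain ⟨δ, hδ, hδε⟩ := ENNReal.exists_nnreal_pos_mul_lt
    (show (2 * C * C : ℝ≥0∞) ≠ ∞ by finiteness) hε.ne'
  obtain ⟨η, hη, hηδ⟩ := exists_measure_lt_le P
    ((measurable_densityXZ hp.measurable).comp measurable_obsXZ) hp.measure_densityXZ_le_zero
    (ENNReal.coe_pos.2 hδ)
  have t3 : Tendsto (fun n => 2 * C * C * (δ : ℝ≥0∞) + ENNReal.ofReal (C / η) *
      (2 * (C * (2 * C * ((∫⁻ u, kernelYZMarg (dY := dY) K₁ (h₁ n) u *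
        l1Modulus volume volume (densityXZ p) u) + ∫⁻ u, ENNReal.ofReal (kernelZ K₂ (h₂ n) u) *
          l1Modulus volume volume (densityXZ p) u))))) atTop
      (𝓝 (2 * C * C * (δ : ℝ≥0∞) + ENNReal.ofReal (C / η) * (2 * (C * (2 * C * (0 + 0)))))) :=
    tendsto_const_nhds.add (ENNReal.Tendsto.const_mul (ENNReal.Tendsto.const_mul
      (ENNReal.Tendsto.const_mul (ENNReal.Tendsto.const_mul (t1.add t2) (Or.inr (by finiteness)))
        (Or.inr (by finiteness))) (Or.inr (by finiteness))) (Or.inr (by finiteness)))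
  have hlt : 2 * C * C * (δ : ℝ≥0∞) + ENNReal.ofReal (C / η) * (2 * (C * (2 * C * (0 + 0)))) < ε := by
    simpa [mul_comm] using hδε
  filter_upwards [t3.eventually (gt_mem_nhds hlt)] with n hn s i j his hjs hij
  have hsd : Measurable fun D : Sample dX dY dZ n => ENNReal.ofReal (swapDist (cptProb p D) i j) :=
    (measurable_swapDist_cptProb hp.measurable i j).ennreal_ofReal
  have hb := hp.lintegral_kernel_kernel_obs_le (n := n)
    (measurable_kernelYZ hK₁.measurable (h := h₁ n)).ennreal_ofReal
    (measurable_kernelZ hK₂.measurable (h := h₂ n)).ennreal_ofReal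
    (lintegral_kernelYZ hK₁ (hpos₁ n)) (lintegral_kernelZ hK₂ (hpos₂ n))
    (Δ := fun q => ENNReal.ofReal (swapDist (cptProb p (ofXZ (dY := dY) q)) i j))
    (hsd.comp measurable_ofXZ)
    (fun q => by
      rw [← ENNReal.ofReal_ofNat]
      exact ENNReal.ofReal_le_ofReal
        (swapDist_le_two (fun π => cptProb_nonneg _ π) (sum_cptProb_le_one _) i j))
    (ρ := fun q q' => ENNReal.ofReal (swapDefect p q q'))
    (measurable_swapDefect hp.measurable).ennreal_ofReal
    (fun q q' => by
      rw [← ENNReal.ofReal_mul (densityXZ_nonneg p q),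
        ← ENNReal.ofReal_mul (mul_nonneg (densityXZ_nonneg p q) (densityXZ_nonneg p q')),
        Real.enorm_eq_ofReal_abs]
      exact ENNReal.ofReal_le_ofReal (densityXZ_mul_swapDefect_le p q q'))
    his hjs hij
    (fun D => by
      simp only [cptProb_ofXZ]
      have h0 : ∀ q q', 0 ≤ swapDefect p q q' := fun q q' => le_max_left _ _
      have h1 := ENNReal.ofReal_le_ofReal (swapDist_cptProb_le (p := p) D hij)
      rw [ENNReal.ofReal_sum_of_nonneg fun π _ => mul_nonneg (cptProb_nonneg D π)
        (mul_nonneg zero_le_two (h0 _ _))] at h1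
      refine h1.trans (Finset.sum_le_sum fun π _ => ?_)
      rw [ENNReal.ofReal_mul (cptProb_nonneg D π), ENNReal.ofReal_mul zero_le_two,
        ENNReal.ofReal_ofNat])
    hη
  simp only [cptProb_ofXZ] at hb
  refine hb.trans (le_trans ?_ hn.le)
  exact add_le_add_left (mul_le_mul_right hηδ _) _

end HasBoundedDensity

/-! ### Consistency of the kernel estimates of conditional probabilities -/

/-- The density of `(Y, Z)` on the event `X ∈ A`. -/
def sectionYZ (p : Rd dX → Rd dY → Rd dZ → ℝ) (A : Set (Rd dX)) (v : Rd dY × Rd dZ) : ℝ :=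
  (∫⁻ x in A, ENNReal.ofReal (p x v.1 v.2)).toReal

/-- The density of `Z` on the event `X ∈ A`. -/
def sectionZ (p : Rd dX → Rd dY → Rd dZ → ℝ) (A : Set (Rd dX)) (z : Rd dZ) : ℝ :=
  (∫⁻ x in A, margXZ p x z).toReal

/-- The kernel estimate of `sectionYZ`. -/
def kernelSumYZ (K : ℝ → ℝ) (h : ℝ) (A : Set (Rd dX)) {n : ℕ} (D : Sample dX dY dZ n)
    (s : Fin n) : ℝ :=
  kernelAverage Prod.snd (kernelYZ K h) (fun w => A.indicator 1 w.1) D s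

/-- The kernel estimate of `sectionZ`. -/
def kernelSumZ (K : ℝ → ℝ) (h : ℝ) (A : Set (Rd dX)) {n : ℕ} (D : Sample dX dY dZ n)
    (s : Fin n) : ℝ :=
  kernelAverage (fun w => w.2.2) (kernelZ K h) (fun w => A.indicator 1 w.1) D s

theorem ofReal_indicator_one {S : Type*} (A : Set S) (x : S) :
    ENNReal.ofReal (A.indicator 1 x) = A.indicator 1 x := by
  by_cases hx : x ∈ A <;> simp [hx]

theorem measurable_kernelAverage {S V : Type*} [MeasurableSpace S] [AddCommGroup V] [MeasurableSpace V]
    [MeasurableSub₂ V] {vm : S → V} {k : V → ℝ} {φ : S → ℝ} (hvm : Measurable vm)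
    (hk : Measurable k) (hφ : Measurable φ) {n : ℕ} (s : Fin n) :
    Measurable fun D : Fin n → S => kernelAverage vm k φ D s :=
  (Finset.measurable_sum _ fun i _ =>
    (hk.comp ((hvm.comp (measurable_pi_apply s)).sub (hvm.comp (measurable_pi_apply i)))).mul
      (hφ.comp (measurable_pi_apply i))).const_mul _

namespace HasBoundedDensity

theorem measurable_sectionYZ (hp : HasBoundedDensity p P C) (A : Set (Rd dX)) :
    Measurable (sectionYZ p A) :=
  (Measurable.lintegral_prod_right' (ν := volume.restrict A)
    (f := fun q : (Rd dY × Rd dZ) × Rd dX => ENNReal.ofReal (p q.2 q.1.1 q.1.2))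
    (hp.measurable.comp (measurable_snd.prodMk measurable_fst)).ennreal_ofReal).ennreal_toReal

theorem measurable_sectionZ (hp : HasBoundedDensity p P C) (A : Set (Rd dX)) :
    Measurable (sectionZ p A) :=
  (Measurable.lintegral_prod_right' (ν := volume.restrict A)
    (f := fun q : Rd dZ × Rd dX => margXZ p q.2 q.1)
    ((measurable_margXZ hp.measurable).comp measurable_swap)).ennreal_toReal

theorem ofReal_sectionYZ (hp : HasBoundedDensity p P C) (A : Set (Rd dX)) (v : Rd dY × Rd dZ) :
    ENNReal.ofReal (sectionYZ p A v) = ∫⁻ x in A, ENNReal.ofReal (p x v.1 v.2) :=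
  ENNReal.ofReal_toReal (((setLIntegral_le_lintegral _ _).trans (hp.margYZ_le v.1 v.2)).trans_lt
    ENNReal.coe_lt_top).ne

theorem ofReal_sectionZ (hp : HasBoundedDensity p P C) (A : Set (Rd dX)) (z : Rd dZ) :
    ENNReal.ofReal (sectionZ p A z) = ∫⁻ x in A, margXZ p x z :=
  ENNReal.ofReal_toReal (((setLIntegral_le_lintegral _ _).trans (hp.margZ_le z)).trans_lt
    ENNReal.coe_lt_top).ne

theorem lintegral_indicator_mul_YZ (hp : HasBoundedDensity p P C) {A : Set (Rd dX)}
    (hA : MeasurableSet A) {H : Rd dY × Rd dZ → ℝ≥0∞} (hH : Measurable H) :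
    ∫⁻ w, A.indicator 1 w.1 * H w.2 ∂P = ∫⁻ v, ENNReal.ofReal (sectionYZ p A v) * H v := by
  have hm := hp.measurable.ennreal_ofReal
  have h2 : Measurable fun w : Rd dX × Rd dY × Rd dZ => A.indicator 1 w.1 * H w.2 :=
    ((measurable_one.indicator hA).comp measurable_fst).mul (hH.comp measurable_snd)
  rw [hp.law, lintegral_withDensity_eq_lintegral_mul _ hm h2,
    Measure.volume_eq_prod, lintegral_prod_symm _ (hm.mul h2).aemeasurable]
  refine lintegral_congr fun v => ?_
  have h3 : Measurable fun x => ENNReal.ofReal (p x v.1 v.2) :=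
    hm.comp (measurable_id.prodMk measurable_const)
  rw [hp.ofReal_sectionYZ, ← lintegral_mul_const _ h3, ← lintegral_indicator hA]
  refine lintegral_congr fun x => ?_
  by_cases hx : x ∈ A <;> simp [hx]

theorem lintegral_indicator_mul_Z (hp : HasBoundedDensity p P C) {A : Set (Rd dX)}
    (hA : MeasurableSet A) {H : Rd dZ → ℝ≥0∞} (hH : Measurable H) :
    ∫⁻ w, A.indicator 1 w.1 * H w.2.2 ∂P = ∫⁻ z, ENNReal.ofReal (sectionZ p A z) * H z := by
  have h2 : Measurable fun q : Rd dX × Rd dZ => A.indicator 1 q.1 * H q.2 :=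
    ((measurable_one.indicator hA).comp measurable_fst).mul (hH.comp measurable_snd)
  refine (hp.lintegral_obsXZ h2).trans (lintegral_congr fun z => ?_)
  have h3 : Measurable fun x => margXZ p x z :=
    (measurable_margXZ hp.measurable).comp (measurable_id.prodMk measurable_const)
  rw [hp.ofReal_sectionZ, ← lintegral_mul_const _ h3, ← lintegral_indicator hA]
  refine lintegral_congr fun x => ?_
  rw [hp.ofReal_densityXZ]
  by_cases hx : x ∈ A <;> simp [hx]

theorem integrable_sectionYZ [IsProbabilityMeasure P] (hp : HasBoundedDensity p P C)
    {A : Set (Rd dX)} (hA : MeasurableSet A) : Integrable (sectionYZ p A) := by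
  have h0 : ∀ v, 0 ≤ sectionYZ p A v := fun _ => ENNReal.toReal_nonneg
  refine ⟨(hp.measurable_sectionYZ A).aestronglyMeasurable, ?_⟩
  rw [hasFiniteIntegral_iff_ofReal (Eventually.of_forall h0)]
  have h1 := hp.lintegral_indicator_mul_YZ hA (H := fun _ => 1) measurable_const
  simp only [mul_one] at h1
  rw [← h1]
  refine lt_of_le_of_lt (lintegral_mono (g := fun _ => 1) fun w => ?_) (by simp)
  exact Set.indicator_le_self' (fun _ _ => zero_le_one) _

theorem integrable_sectionZ [IsProbabilityMeasure P] (hp : HasBoundedDensity p P C)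
    {A : Set (Rd dX)} (hA : MeasurableSet A) : Integrable (sectionZ p A) := by
  have h0 : ∀ v, 0 ≤ sectionZ p A v := fun _ => ENNReal.toReal_nonneg
  refine ⟨(hp.measurable_sectionZ A).aestronglyMeasurable, ?_⟩
  rw [hasFiniteIntegral_iff_ofReal (Eventually.of_forall h0)]
  have h1 := hp.lintegral_indicator_mul_Z hA (H := fun _ => 1) measurable_const
  simp only [mul_one] at h1
  rw [← h1]
  refine lt_of_le_of_lt (lintegral_mono (g := fun _ => 1) fun w => ?_) (by simp)
  exact Set.indicator_le_self' (fun _ _ => zero_le_one) _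

/-- Markov's inequality for the mean convergence of kernel averages, which is therefore invoked with
accuracy `ε δ`. -/
theorem eventually_measure_kernelSumYZ_le [IsProbabilityMeasure P] (hp : HasBoundedDensity p P C)
    (hK : KernelAssumption (dY + dZ) K) (hpos : ∀ n, 0 < h n) (hlim : Tendsto h atTop (𝓝 0))
    (hlarge : Tendsto (fun n : ℕ => (n : ℝ) * h n ^ (dY + dZ)) atTop atTop)
    {A : Set (Rd dX)} (hA : MeasurableSet A) {δ : ℝ} (hδ : 0 < δ) {ε : ℝ≥0∞} (hε : 0 < ε) :
    ∀ᶠ n in atTop, ∀ s : Fin n, Measure.pi (fun _ : Fin n => P)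
      {D | δ ≤ |kernelSumYZ K (h n) A D s - sectionYZ p A (D s).2|} ≤ ε := by
  obtain ⟨B, hB⟩ := hK.bounded
  obtain ⟨R, -, hR⟩ := hK.exists_support
  have hφ : Measurable fun w : Rd dX × Rd dY × Rd dZ => A.indicator (1 : Rd dX → ℝ) w.1 :=
    (measurable_one.indicator hA).comp measurable_fst
  have hδ' : (0 : ℝ≥0∞) < ENNReal.ofReal δ := ENNReal.ofReal_pos.2 hδ
  have h1 := eventually_lintegral_kernelAverage_sub_le (P := P) (μ := volume) (vm := Prod.snd)
    (k := fun n => kernelYZ K (h n)) (φ := fun w => A.indicator 1 w.1) (ψ := sectionYZ p A)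
    (B := fun n => (h n ^ (dY + dZ))⁻¹ * B) (C := C)
    measurable_snd (fun n => measurable_kernelYZ hK.measurable)
    (fun n => kernelYZ_nonneg hK.nonneg (hpos n))
    (fun n v => mul_le_mul_of_nonneg_left (hB _) (by have := hpos n; positivity))
    (fun n => lintegral_kernelYZ hK (hpos n)) (tendsto_kernel_bound_div hlarge B)
    (eventually_forall_notMem_of_support hlim fun n v => kernelYZ_eq_zero hR (hpos n))
    hφ (fun w => Set.indicator_nonneg (fun _ _ => zero_le_one) _)
    (fun w => Set.indicator_le_self' (fun _ _ => zero_le_one) _)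
    (hp.measurable_sectionYZ A) (fun v => ENNReal.toReal_nonneg) (hp.integrable_sectionYZ hA)
    (fun H hH => by simp_rw [ofReal_indicator_one]; exact hp.lintegral_indicator_mul_YZ hA hH)
    (fun H hH => hp.lintegral_snd_le hH) (ENNReal.mul_pos hε.ne' hδ'.ne')
  filter_upwards [h1] with n hn s
  have hm : Measurable fun D : Sample dX dY dZ n =>
      ‖kernelSumYZ K (h n) A D s - sectionYZ p A (D s).2‖ₑ :=
    ((measurable_kernelAverage measurable_snd (measurable_kernelYZ hK.measurable) hφ s).sub
      ((hp.measurable_sectionYZ A).comp (measurable_pi_apply s).snd)).enorm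
  have h2 := (mul_meas_ge_le_lintegral (μ := Measure.pi fun _ : Fin n => P) hm
    (ENNReal.ofReal δ)).trans (hn s)
  rw [mul_comm ε, ENNReal.mul_le_mul_iff_right hδ'.ne' ENNReal.ofReal_ne_top] at h2
  refine (measure_mono fun D hD => ?_).trans h2
  simp only [Set.mem_ofPred_eq, Real.enorm_eq_ofReal_abs] at hD ⊢
  exact ENNReal.ofReal_le_ofReal hD

theorem eventually_measure_kernelSumZ_le [IsProbabilityMeasure P] (hp : HasBoundedDensity p P C)
    (hK : KernelAssumption dZ K) (hpos : ∀ n, 0 < h n) (hlim : Tendsto h atTop (𝓝 0))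
    (hlarge : Tendsto (fun n : ℕ => (n : ℝ) * h n ^ dZ) atTop atTop)
    {A : Set (Rd dX)} (hA : MeasurableSet A) {δ : ℝ} (hδ : 0 < δ) {ε : ℝ≥0∞} (hε : 0 < ε) :
    ∀ᶠ n in atTop, ∀ s : Fin n, Measure.pi (fun _ : Fin n => P)
      {D | δ ≤ |kernelSumZ K (h n) A D s - sectionZ p A (D s).2.2|} ≤ ε := by
  obtain ⟨B, hB⟩ := hK.bounded
  obtain ⟨R, -, hR⟩ := hK.exists_support
  have hφ : Measurable fun w : Rd dX × Rd dY × Rd dZ => A.indicator (1 : Rd dX → ℝ) w.1 :=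
    (measurable_one.indicator hA).comp measurable_fst
  have hδ' : (0 : ℝ≥0∞) < ENNReal.ofReal δ := ENNReal.ofReal_pos.2 hδ
  have h1 := eventually_lintegral_kernelAverage_sub_le (P := P) (μ := volume)
    (vm := fun w => w.2.2)
    (k := fun n => kernelZ K (h n)) (φ := fun w => A.indicator 1 w.1) (ψ := sectionZ p A)
    (B := fun n => (h n ^ dZ)⁻¹ * B) (C := C)
    measurable_snd.snd (fun n => measurable_kernelZ hK.measurable)
    (fun n => kernelZ_nonneg hK.nonneg (hpos n))
    (fun n v => mul_le_mul_of_nonneg_left (hB _) (by have := hpos n; positivity))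
    (fun n => lintegral_kernelZ hK (hpos n)) (tendsto_kernel_bound_div hlarge B)
    (eventually_forall_notMem_of_support hlim fun n v => kernelZ_eq_zero hR (hpos n))
    hφ (fun w => Set.indicator_nonneg (fun _ _ => zero_le_one) _)
    (fun w => Set.indicator_le_self' (fun _ _ => zero_le_one) _)
    (hp.measurable_sectionZ A) (fun v => ENNReal.toReal_nonneg) (hp.integrable_sectionZ hA)
    (fun H hH => by simp_rw [ofReal_indicator_one]; exact hp.lintegral_indicator_mul_Z hA hH)
    (fun H hH => hp.lintegral_Z_le hH) (ENNReal.mul_pos hε.ne' hδ'.ne')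
  filter_upwards [h1] with n hn s
  have hm : Measurable fun D : Sample dX dY dZ n =>
      ‖kernelSumZ K (h n) A D s - sectionZ p A (D s).2.2‖ₑ :=
    ((measurable_kernelAverage measurable_snd.snd (measurable_kernelZ hK.measurable) hφ s).sub
      ((hp.measurable_sectionZ A).comp (measurable_pi_apply s).snd.snd)).enorm
  have h2 := (mul_meas_ge_le_lintegral (μ := Measure.pi fun _ : Fin n => P) hm
    (ENNReal.ofReal δ)).trans (hn s)
  rw [mul_comm ε, ENNReal.mul_le_mul_iff_right hδ'.ne' ENNReal.ofReal_ne_top] at h2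
  refine (measure_mono fun D hD => ?_).trans h2
  simp only [Set.mem_ofPred_eq, Real.enorm_eq_ofReal_abs] at hD ⊢
  exact ENNReal.ofReal_le_ofReal hD

theorem measure_sectionYZ_univ_le_zero (hp : HasBoundedDensity p P C) :
    P {w | sectionYZ p Set.univ w.2 ≤ 0} = 0 := by
  have hs : MeasurableSet {v : Rd dY × Rd dZ | sectionYZ p Set.univ v ≤ 0} :=
    measurableSet_le (hp.measurable_sectionYZ _) measurable_const
  have h1 := hp.lintegral_indicator_mul_YZ .univ
    (H := Set.indicator {v | sectionYZ p Set.univ v ≤ 0} 1) (measurable_one.indicator hs)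
  have h2 : ∀ v, ENNReal.ofReal (sectionYZ p Set.univ v) *
      Set.indicator {v | sectionYZ p Set.univ v ≤ 0} (1 : Rd dY × Rd dZ → ℝ≥0∞) v = 0 := by
    intro v
    by_cases hq : sectionYZ p Set.univ v ≤ 0
    · rw [ENNReal.ofReal_of_nonpos hq, zero_mul]
    · rw [Set.indicator_of_notMem (show v ∉ {v | sectionYZ p Set.univ v ≤ 0} from hq), mul_zero]
  simp only [h2, lintegral_zero, Set.indicator_univ, Pi.one_apply, one_mul] at h1
  exact (lintegral_indicator_one (μ := P) (measurable_snd hs)).symm.trans h1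

theorem measure_sectionZ_univ_le_zero (hp : HasBoundedDensity p P C) :
    P {w | sectionZ p Set.univ w.2.2 ≤ 0} = 0 := by
  have hs : MeasurableSet {v : Rd dZ | sectionZ p Set.univ v ≤ 0} :=
    measurableSet_le (hp.measurable_sectionZ _) measurable_const
  have h1 := hp.lintegral_indicator_mul_Z .univ
    (H := Set.indicator {v | sectionZ p Set.univ v ≤ 0} 1) (measurable_one.indicator hs)
  have h2 : ∀ v, ENNReal.ofReal (sectionZ p Set.univ v) *
      Set.indicator {v | sectionZ p Set.univ v ≤ 0} (1 : Rd dZ → ℝ≥0∞) v = 0 := by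
    intro v
    by_cases hq : sectionZ p Set.univ v ≤ 0
    · rw [ENNReal.ofReal_of_nonpos hq, zero_mul]
    · rw [Set.indicator_of_notMem (show v ∉ {v | sectionZ p Set.univ v ≤ 0} from hq), mul_zero]
  simp only [h2, lintegral_zero, Set.indicator_univ, Pi.one_apply, one_mul] at h1
  exact (lintegral_indicator_one (μ := P)
    ((measurable_snd.snd : Measurable fun w : Rd dX × Rd dY × Rd dZ => w.2.2) hs)).symm.trans h1

end HasBoundedDensity

end Consequences

/-! ### The statistic of the permuted data -/

section PermutedStatistic

variable {dX dY dZ n : ℕ} {p : Rd dX → Rd dY → Rd dZ → ℝ}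
  {P : Measure (Rd dX × Rd dY × Rd dZ)} {C : ℝ≥0} {K₁ K₂ : ℝ → ℝ} {h₁ h₂ : ℝ}
  {a : Rd dY → Rd dZ → ℝ}

/-- The weights of the kernel estimate of the law of `X` given `(Y, Z) = (Y_s, Z_s)`. -/
def weightYZ (K : ℝ → ℝ) (h : ℝ) (D : Sample dX dY dZ n) (s i : Fin n) : ℝ :=
  kernelYZ K h ((D s).2 - (D i).2) / ∑ k, kernelYZ K h ((D s).2 - (D k).2)

/-- The weights of the kernel estimate of the law of `X` given `Z = Z_s`. -/
def weightZ (K : ℝ → ℝ) (h : ℝ) (D : Sample dX dY dZ n) (s i : Fin n) : ℝ :=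
  kernelZ K h ((D s).2.2 - (D i).2.2) / ∑ k, kernelZ K h ((D s).2.2 - (D k).2.2)

theorem weightYZ_nonneg (hK : ∀ r, 0 ≤ K₁ r) (hh : 0 < h₁) (D : Sample dX dY dZ n) (s i : Fin n) :
    0 ≤ weightYZ K₁ h₁ D s i :=
  div_nonneg (kernelYZ_nonneg hK hh _) (Finset.sum_nonneg fun _ _ => kernelYZ_nonneg hK hh _)

theorem weightZ_nonneg (hK : ∀ r, 0 ≤ K₂ r) (hh : 0 < h₂) (D : Sample dX dY dZ n) (s i : Fin n) :
    0 ≤ weightZ K₂ h₂ D s i :=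
  div_nonneg (kernelZ_nonneg hK hh _) (Finset.sum_nonneg fun _ _ => kernelZ_nonneg hK hh _)

theorem sum_weightYZ_le_one (D : Sample dX dY dZ n) (s : Fin n) : ∑ i, weightYZ K₁ h₁ D s i ≤ 1 := by
  simp_rw [weightYZ, ← Finset.sum_div]
  exact div_self_le_one _

theorem sum_weightZ_le_one (D : Sample dX dY dZ n) (s : Fin n) : ∑ i, weightZ K₂ h₂ D s i ≤ 1 := by
  simp_rw [weightZ, ← Finset.sum_div]
  exact div_self_le_one _

/-- The normalising power of the bandwidth cancels in the weights, so they may be written with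
kernels of integral one. They do not involve `X`. -/
theorem cbdEstimate_eq (hK₁ : ∀ r, 0 ≤ K₁ r) (hK₂ : ∀ r, 0 ≤ K₂ r) (hh₁ : 0 < h₁) (hh₂ : 0 < h₂)
    (D : Sample dX dY dZ n) :
    cbdEstimate K₁ K₂ h₁ h₂ a D = (1 / (n : ℝ)) * ∑ s, ballSum (fun i => (D i).1)
      (weightYZ K₁ h₁ D s) (weightZ K₂ h₂ D s) * a (D s).2.1 (D s).2.2 := by
  rw [cbdEstimate]
  congr 1
  refine Finset.sum_congr rfl fun s _ => ?_
  rw [estCondYZ, estCondZ, ballDivergence_weightedEmpirical _ (fun i => hK₁ _) (fun i => hK₂ _)]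
  have hc₁ : (h₁ ^ (dY + dZ))⁻¹ ≠ 0 := by positivity
  have hc₂ : (h₂ ^ dZ)⁻¹ ≠ 0 := by positivity
  congr 2
  · ext i
    simp only [weightYZ, kernelYZ, ← Finset.mul_sum]
    rw [mul_div_mul_left _ _ hc₁]
    rfl
  · ext i
    simp only [weightZ, kernelZ, ← Finset.mul_sum]
    rw [mul_div_mul_left _ _ hc₂]

theorem kernelSumYZ_univ (D : Sample dX dY dZ n) (s : Fin n) :
    kernelSumYZ K₁ h₁ Set.univ D s = (1 / (n : ℝ)) * ∑ k, kernelYZ K₁ h₁ ((D s).2 - (D k).2) := by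
  simp [kernelSumYZ, kernelAverage]

theorem kernelSumZ_univ (D : Sample dX dY dZ n) (s : Fin n) :
    kernelSumZ K₂ h₂ Set.univ D s = (1 / (n : ℝ)) * ∑ k, kernelZ K₂ h₂ ((D s).2.2 - (D k).2.2) := by
  simp [kernelSumZ, kernelAverage]

theorem cbdEstimate_nonneg (hK₁ : ∀ r, 0 ≤ K₁ r) (hK₂ : ∀ r, 0 ≤ K₂ r) (hh₁ : 0 < h₁)
    (hh₂ : 0 < h₂) (ha : ∀ y z, 0 ≤ a y z) (D : Sample dX dY dZ n) :
    0 ≤ cbdEstimate K₁ K₂ h₁ h₂ a D := by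
  rw [cbdEstimate_eq hK₁ hK₂ hh₁ hh₂]
  exact mul_nonneg (by positivity) (Finset.sum_nonneg fun s _ => mul_nonneg
    (ballSum_nonneg (weightYZ_nonneg hK₁ hh₁ D s) (weightZ_nonneg hK₂ hh₂ D s) _) (ha _ _))

/-- The total of the kernel weights at an observation is bounded below if the density estimate
is. -/
theorem div_sum_le_of_le_average {k : Fin n → ℝ} (hk : ∀ i, 0 ≤ k i) {c : ℝ} (hc : 0 < c)
    (hn : 0 < n) (h : c ≤ (1 / (n : ℝ)) * ∑ i, k i) (i : Fin n) :
    k i / ∑ j, k j ≤ k i / (n * c) := by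
  have hn' : (0 : ℝ) < n := Nat.cast_pos.2 hn
  refine div_le_div_of_nonneg_left (hk i) (by positivity) ?_
  rw [one_div, inv_mul_eq_div, le_div_iff₀ hn'] at h
  linarith

/-- If one of the density estimates at `s` is below `c`, the trivial bound `2` is used. Otherwise
the weights add up to one and are at most the kernel divided by `n c`, so the relabelling bound
applies with `m = (B₁ + B₂) / (n c)`. -/
theorem sum_cptProb_mul_ballSum_le (hK₁ : ∀ r, 0 ≤ K₁ r) (hK₂ : ∀ r, 0 ≤ K₂ r) (hh₁ : 0 < h₁)
    (hh₂ : 0 < h₂) {B₁ B₂ : ℝ} (hB₁ : ∀ v : Rd dY × Rd dZ, kernelYZ K₁ h₁ v ≤ B₁)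
    (hB₂ : ∀ z : Rd dZ, kernelZ K₂ h₂ z ≤ B₂) {c : ℝ} (hc : 0 < c) (D : Sample dX dY dZ n)
    (s : Fin n) :
    ∑ π, cptProb p D π * ballSum (fun i => (D (π i)).1) (weightYZ K₁ h₁ D s) (weightZ K₂ h₂ D s) ≤
      ({D : Sample dX dY dZ n | kernelSumYZ K₁ h₁ Set.univ D s < c}.indicator 2 D +
        {D : Sample dX dY dZ n | kernelSumZ K₂ h₂ Set.univ D s < c}.indicator 2 D) +
      (∑ i, ∑ j, (if i ≠ s ∧ j ≠ s ∧ i ≠ j then 1 / (n * c) ^ 2 *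
        (kernelYZ K₁ h₁ ((D s).2 - (D i).2) * kernelZ K₂ h₂ ((D s).2.2 - (D j).2.2) *
          swapDist (cptProb p D) i j) else 0) +
      14 * ((B₁ + B₂) / (n * c))) := by
  have hn : 0 < n := s.pos
  have hn' : (0 : ℝ) < n := Nat.cast_pos.2 hn
  have hw0 := weightYZ_nonneg hK₁ hh₁ D s
  have hv0 := weightZ_nonneg hK₂ hh₂ D s
  have hk1 : ∀ v : Rd dY × Rd dZ, 0 ≤ kernelYZ K₁ h₁ v := kernelYZ_nonneg hK₁ hh₁
  have hk2 : ∀ z : Rd dZ, 0 ≤ kernelZ K₂ h₂ z := kernelZ_nonneg hK₂ hh₂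
  have hB1 : 0 ≤ B₁ := (hk1 0).trans (hB₁ 0)
  have hB2 : 0 ≤ B₂ := (hk2 0).trans (hB₂ 0)
  have hnc : 0 < n * c := by positivity
  have hi1 : 0 ≤ {D : Sample dX dY dZ n | kernelSumYZ K₁ h₁ Set.univ D s < c}.indicator
    (2 : Sample dX dY dZ n → ℝ) D := Set.indicator_nonneg (fun _ _ => zero_le_two) _
  have hi2 : 0 ≤ {D : Sample dX dY dZ n | kernelSumZ K₂ h₂ Set.univ D s < c}.indicator
    (2 : Sample dX dY dZ n → ℝ) D := Set.indicator_nonneg (fun _ _ => zero_le_two) _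
  have hterm : ∀ i j : Fin n, 0 ≤ kernelYZ K₁ h₁ ((D s).2 - (D i).2) *
      kernelZ K₂ h₂ ((D s).2.2 - (D j).2.2) * swapDist (cptProb p D) i j := fun i j =>
    mul_nonneg (mul_nonneg (hk1 _) (hk2 _)) (swapDist_nonneg _ _ _)
  have hsum0 : 0 ≤ ∑ i, ∑ j, (if i ≠ s ∧ j ≠ s ∧ i ≠ j then 1 / (n * c) ^ 2 *
        (kernelYZ K₁ h₁ ((D s).2 - (D i).2) * kernelZ K₂ h₂ ((D s).2.2 - (D j).2.2) *
          swapDist (cptProb p D) i j) else 0) := by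
    refine Finset.sum_nonneg fun i _ => Finset.sum_nonneg fun j _ => ?_
    split_ifs
    · exact mul_nonneg (by positivity) (hterm i j)
    · exact le_rfl
  have hrest : 0 ≤ 14 * ((B₁ + B₂) / (n * c)) := by positivity
  by_cases hgood : c ≤ kernelSumYZ K₁ h₁ Set.univ D s ∧ c ≤ kernelSumZ K₂ h₂ Set.univ D s
  · obtain ⟨hg1, hg2⟩ := hgood
    rw [kernelSumYZ_univ] at hg1
    rw [kernelSumZ_univ] at hg2
    have hS1 : 0 < ∑ k, kernelYZ K₁ h₁ ((D s).2 - (D k).2) :=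
      pos_of_mul_pos_right (hc.trans_le hg1) (by positivity)
    have hS2 : 0 < ∑ k, kernelZ K₂ h₂ ((D s).2.2 - (D k).2.2) :=
      pos_of_mul_pos_right (hc.trans_le hg2) (by positivity)
    have hw1 : ∑ i, weightYZ K₁ h₁ D s i = 1 := by
      simp_rw [weightYZ, ← Finset.sum_div]; exact div_self hS1.ne'
    have hv1 : ∑ i, weightZ K₂ h₂ D s i = 1 := by
      simp_rw [weightZ, ← Finset.sum_div]; exact div_self hS2.ne'
    have hwle : ∀ i, weightYZ K₁ h₁ D s i ≤ kernelYZ K₁ h₁ ((D s).2 - (D i).2) / (n * c) :=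
      div_sum_le_of_le_average (fun i => hk1 _) hc hn hg1
    have hvle : ∀ i, weightZ K₂ h₂ D s i ≤ kernelZ K₂ h₂ ((D s).2.2 - (D i).2.2) / (n * c) :=
      div_sum_le_of_le_average (fun i => hk2 _) hc hn hg2
    have hwm : ∀ i, weightYZ K₁ h₁ D s i ≤ (B₁ + B₂) / (n * c) := fun i =>
      (hwle i).trans (div_le_div_of_nonneg_right ((hB₁ _).trans (by linarith)) hnc.le)
    have hvm : ∀ i, weightZ K₂ h₂ D s i ≤ (B₁ + B₂) / (n * c) := fun i =>
      (hvle i).trans (div_le_div_of_nonneg_right ((hB₂ _).trans (by linarith)) hnc.le)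
    refine (sum_mul_ballSum_le_of_ne (fun π => cptProb_nonneg D π) (sum_cptProb_le_one D) hw0 hv0
      hw1 hv1 hwm hvm (fun i => (D i).1) s).trans ?_
    refine le_trans (add_le_add_left ?_ _) (le_add_of_nonneg_left (add_nonneg hi1 hi2))
    refine Finset.sum_le_sum fun i _ => Finset.sum_le_sum fun j _ => ?_
    split_ifs
    · calc _ ≤ kernelYZ K₁ h₁ ((D s).2 - (D i).2) / (n * c) *
            (kernelZ K₂ h₂ ((D s).2.2 - (D j).2.2) / (n * c)) * swapDist (cptProb p D) i j := by
            refine mul_le_mul_of_nonneg_right ?_ (swapDist_nonneg _ _ _)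
            exact mul_le_mul (hwle i) (hvle j) (hv0 j) (div_nonneg (hk1 _) hnc.le)
        _ = _ := by field_simp
    · exact le_rfl
  · have h2 : ∑ π, cptProb p D π * ballSum (fun i => (D (π i)).1) (weightYZ K₁ h₁ D s)
        (weightZ K₂ h₂ D s) ≤ 2 := by
      calc _ ≤ ∑ π, cptProb p D π * 2 := Finset.sum_le_sum fun π _ =>
            mul_le_mul_of_nonneg_left (ballSum_le_two hw0 hv0 (sum_weightYZ_le_one D s)
              (sum_weightZ_le_one D s) _) (cptProb_nonneg D π)
        _ ≤ 2 := by
            rw [← Finset.sum_mul]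
            linarith [sum_cptProb_le_one (p := p) D]
    rw [not_and_or, not_le, not_le] at hgood
    rcases hgood with hg | hg
    · rw [Set.indicator_of_mem (show D ∈ {D : Sample dX dY dZ n |
        kernelSumYZ K₁ h₁ Set.univ D s < c} from hg), Pi.ofNat_apply]
      linarith
    · rw [Set.indicator_of_mem (show D ∈ {D : Sample dX dY dZ n |
        kernelSumZ K₂ h₂ Set.univ D s < c} from hg), Pi.ofNat_apply]
      linarith

/-- The weights and `a` are functions of `(Y, Z)` and do not change under the permutation; only the
points move. -/
theorem sum_cptProb_mul_cbdEstimate_eq (hK₁ : ∀ r, 0 ≤ K₁ r) (hK₂ : ∀ r, 0 ≤ K₂ r)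
    (hh₁ : 0 < h₁) (hh₂ : 0 < h₂) (D : Sample dX dY dZ n) :
    ∑ π, cptProb p D π * cbdEstimate K₁ K₂ h₁ h₂ a (permuteX π D) = (1 / (n : ℝ)) * ∑ s,
      (∑ π, cptProb p D π * ballSum (fun i => (D (π i)).1) (weightYZ K₁ h₁ D s)
        (weightZ K₂ h₂ D s)) * a (D s).2.1 (D s).2.2 := by
  simp_rw [cbdEstimate_eq hK₁ hK₂ hh₁ hh₂, Finset.sum_mul, Finset.mul_sum]
  rw [Finset.sum_comm]
  refine Finset.sum_congr rfl fun s _ => Finset.sum_congr rfl fun π _ => ?_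
  change cptProb p D π * (1 / (n : ℝ) * (ballSum (fun i => (D (π i)).1) (weightYZ K₁ h₁ D s)
    (weightZ K₂ h₂ D s) * a (D s).2.1 (D s).2.2)) = _
  ring

theorem lintegral_sum_cptProb_mul_cbdEstimate_le [IsProbabilityMeasure P]
    (hp : HasBoundedDensity p P C) (hKm₁ : Measurable K₁) (hKm₂ : Measurable K₂)
    (hK₁ : ∀ r, 0 ≤ K₁ r) (hK₂ : ∀ r, 0 ≤ K₂ r)
    (hh₁ : 0 < h₁) (hh₂ : 0 < h₂) {B₁ B₂ : ℝ} (hB₁ : ∀ v : Rd dY × Rd dZ, kernelYZ K₁ h₁ v ≤ B₁)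
    (hB₂ : ∀ z : Rd dZ, kernelZ K₂ h₂ z ≤ B₂) (ha0 : ∀ y z, 0 ≤ a y z) {Ca : ℝ}
    (hCa : ∀ y z, a y z ≤ Ca) {c : ℝ} (hc : 0 < c) {ε₁ ε₂ ε₃ : ℝ≥0∞}
    (h1 : ∀ s : Fin n, Measure.pi (fun _ : Fin n => P)
      {D | kernelSumYZ K₁ h₁ Set.univ D s < c} ≤ ε₁)
    (h2 : ∀ s : Fin n, Measure.pi (fun _ : Fin n => P)
      {D | kernelSumZ K₂ h₂ Set.univ D s < c} ≤ ε₂)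
    (h3 : ∀ s i j : Fin n, i ≠ s → j ≠ s → i ≠ j →
      ∫⁻ D, ENNReal.ofReal (kernelYZ K₁ h₁ ((D s).2 - (D i).2)) *
        ENNReal.ofReal (kernelZ K₂ h₂ ((D s).2.2 - (D j).2.2)) *
          ENNReal.ofReal (swapDist (cptProb p D) i j) ∂Measure.pi (fun _ : Fin n => P) ≤ ε₃)
    (hn : 0 < n) :
    ∫⁻ D, ∑ π, ENNReal.ofReal (cptProb p D π) *
        ENNReal.ofReal (cbdEstimate K₁ K₂ h₁ h₂ a (permuteX π D))
        ∂Measure.pi (fun _ : Fin n => P) ≤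
      ENNReal.ofReal Ca * (2 * ε₁ + 2 * ε₂ + (ENNReal.ofReal (1 / c ^ 2) * ε₃ +
        ENNReal.ofReal (14 * ((B₁ + B₂) / (n * c))))) := by
  have hn' : (0 : ℝ) < n := Nat.cast_pos.2 hn
  have hCa0 : 0 ≤ Ca := (ha0 0 0).trans (hCa 0 0)
  set Q := Measure.pi fun _ : Fin n => P
  have hk1 : ∀ v : Rd dY × Rd dZ, 0 ≤ kernelYZ K₁ h₁ v := kernelYZ_nonneg hK₁ hh₁
  have hk2 : ∀ z : Rd dZ, 0 ≤ kernelZ K₂ h₂ z := kernelZ_nonneg hK₂ hh₂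
  have hm1 : ∀ s, Measurable fun D : Sample dX dY dZ n => kernelSumYZ K₁ h₁ Set.univ D s := fun s =>
    measurable_kernelAverage measurable_snd (measurable_kernelYZ hKm₁)
      ((measurable_one.indicator .univ).comp measurable_fst) s
  have hm2 : ∀ s, Measurable fun D : Sample dX dY dZ n => kernelSumZ K₂ h₂ Set.univ D s := fun s =>
    measurable_kernelAverage measurable_snd.snd (measurable_kernelZ hKm₂)
      ((measurable_one.indicator .univ).comp measurable_fst) s
  have hs1 : ∀ s, MeasurableSet {D : Sample dX dY dZ n | kernelSumYZ K₁ h₁ Set.univ D s < c} :=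
    fun s => measurableSet_lt (hm1 s) measurable_const
  have hs2 : ∀ s, MeasurableSet {D : Sample dX dY dZ n | kernelSumZ K₂ h₂ Set.univ D s < c} :=
    fun s => measurableSet_lt (hm2 s) measurable_const
  have hmk : ∀ s i j : Fin n, Measurable fun D : Sample dX dY dZ n =>
      ENNReal.ofReal (kernelYZ K₁ h₁ ((D s).2 - (D i).2)) *
        ENNReal.ofReal (kernelZ K₂ h₂ ((D s).2.2 - (D j).2.2)) *
          ENNReal.ofReal (swapDist (cptProb p D) i j) := fun s i j =>
    (((measurable_kernelYZ hKm₁).comp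
      ((measurable_pi_apply s).snd.sub (measurable_pi_apply i).snd)).ennreal_ofReal.mul
      ((measurable_kernelZ hKm₂).comp
      ((measurable_pi_apply s).snd.snd.sub (measurable_pi_apply j).snd.snd)).ennreal_ofReal).mul
      (measurable_swapDist_cptProb hp.measurable i j).ennreal_ofReal
  -- the bound at a single observation
  set b : Fin n → Sample dX dY dZ n → ℝ≥0∞ := fun s D =>
    ({D : Sample dX dY dZ n | kernelSumYZ K₁ h₁ Set.univ D s < c}.indicator 2 D +
      {D : Sample dX dY dZ n | kernelSumZ K₂ h₂ Set.univ D s < c}.indicator 2 D) +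
    (∑ i, ∑ j, (if i ≠ s ∧ j ≠ s ∧ i ≠ j then ENNReal.ofReal (1 / (n * c) ^ 2) *
      (ENNReal.ofReal (kernelYZ K₁ h₁ ((D s).2 - (D i).2)) *
        ENNReal.ofReal (kernelZ K₂ h₂ ((D s).2.2 - (D j).2.2)) *
          ENNReal.ofReal (swapDist (cptProb p D) i j)) else 0) +
      ENNReal.ofReal (14 * ((B₁ + B₂) / (n * c)))) with hb
  have hof2 : ∀ (S : Set (Sample dX dY dZ n)) D,
      ENNReal.ofReal (S.indicator 2 D) = S.indicator 2 D := by
    intro S D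
    by_cases hD : D ∈ S <;> simp [hD]
  have hpt : ∀ s D, ENNReal.ofReal (∑ π, cptProb p D π * ballSum (fun i => (D (π i)).1)
      (weightYZ K₁ h₁ D s) (weightZ K₂ h₂ D s)) ≤ b s D := by
    intro s D
    refine (ENNReal.ofReal_le_ofReal
      (sum_cptProb_mul_ballSum_le hK₁ hK₂ hh₁ hh₂ hB₁ hB₂ hc D s)).trans ?_
    refine ENNReal.ofReal_add_le.trans (add_le_add (ENNReal.ofReal_add_le.trans (by
      rw [hof2, hof2])) (ENNReal.ofReal_add_le.trans (add_le_add_left ?_ _)))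
    rw [ENNReal.ofReal_sum_of_nonneg]
    · refine Finset.sum_le_sum fun i _ => ?_
      rw [ENNReal.ofReal_sum_of_nonneg]
      · refine Finset.sum_le_sum fun j _ => ?_
        split_ifs
        · rw [ENNReal.ofReal_mul (by positivity), ENNReal.ofReal_mul (mul_nonneg (hk1 _) (hk2 _)),
            ENNReal.ofReal_mul (hk1 _)]
        · simp
      · intro j _
        split_ifs
        · exact mul_nonneg (by positivity)
            (mul_nonneg (mul_nonneg (hk1 _) (hk2 _)) (swapDist_nonneg _ _ _))
        · exact le_rfl
    · refine fun i _ => Finset.sum_nonneg fun j _ => ?_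
      split_ifs
      · exact mul_nonneg (by positivity)
            (mul_nonneg (mul_nonneg (hk1 _) (hk2 _)) (swapDist_nonneg _ _ _))
      · exact le_rfl
  have hbm1 : ∀ s, Measurable fun D : Sample dX dY dZ n =>
      {D : Sample dX dY dZ n | kernelSumYZ K₁ h₁ Set.univ D s < c}.indicator (2 : Sample dX dY dZ n → ℝ≥0∞) D :=
    fun s => measurable_const.indicator (hs1 s)
  have hbm2 : ∀ s, Measurable fun D : Sample dX dY dZ n =>
      {D : Sample dX dY dZ n | kernelSumZ K₂ h₂ Set.univ D s < c}.indicator (2 : Sample dX dY dZ n → ℝ≥0∞) D :=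
    fun s => measurable_const.indicator (hs2 s)
  have hbm12 : ∀ s, Measurable fun D : Sample dX dY dZ n =>
      {D : Sample dX dY dZ n | kernelSumYZ K₁ h₁ Set.univ D s < c}.indicator (2 : Sample dX dY dZ n → ℝ≥0∞) D +
      {D : Sample dX dY dZ n | kernelSumZ K₂ h₂ Set.univ D s < c}.indicator (2 : Sample dX dY dZ n → ℝ≥0∞) D :=
    fun s => (hbm1 s).add (hbm2 s)
  have hbm3 : ∀ s i j : Fin n, Measurable fun D : Sample dX dY dZ n =>
      if i ≠ s ∧ j ≠ s ∧ i ≠ j then ENNReal.ofReal (1 / (n * c) ^ 2) *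
      (ENNReal.ofReal (kernelYZ K₁ h₁ ((D s).2 - (D i).2)) *
        ENNReal.ofReal (kernelZ K₂ h₂ ((D s).2.2 - (D j).2.2)) *
          ENNReal.ofReal (swapDist (cptProb p D) i j)) else 0 := fun s i j => by
    split_ifs
    · exact (hmk s i j).const_mul _
    · exact measurable_const
  have hbm4 : ∀ s i : Fin n, Measurable fun D : Sample dX dY dZ n => ∑ j,
      if i ≠ s ∧ j ≠ s ∧ i ≠ j then ENNReal.ofReal (1 / (n * c) ^ 2) *
      (ENNReal.ofReal (kernelYZ K₁ h₁ ((D s).2 - (D i).2)) *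
        ENNReal.ofReal (kernelZ K₂ h₂ ((D s).2.2 - (D j).2.2)) *
          ENNReal.ofReal (swapDist (cptProb p D) i j)) else 0 := fun s i =>
    Finset.measurable_sum _ fun j _ => hbm3 s i j
  have hbm5 : ∀ s : Fin n, Measurable fun D : Sample dX dY dZ n => ∑ i, ∑ j,
      if i ≠ s ∧ j ≠ s ∧ i ≠ j then ENNReal.ofReal (1 / (n * c) ^ 2) *
      (ENNReal.ofReal (kernelYZ K₁ h₁ ((D s).2 - (D i).2)) *
        ENNReal.ofReal (kernelZ K₂ h₂ ((D s).2.2 - (D j).2.2)) *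
          ENNReal.ofReal (swapDist (cptProb p D) i j)) else 0 := fun s =>
    Finset.measurable_sum _ fun i _ => hbm4 s i
  have hbm : ∀ s, Measurable (b s) := fun s =>
    (hbm12 s).add ((hbm5 s).add measurable_const)
  have hbint : ∀ s, ∫⁻ D, b s D ∂Q ≤ 2 * ε₁ + 2 * ε₂ + (ENNReal.ofReal (1 / c ^ 2) * ε₃ +
      ENNReal.ofReal (14 * ((B₁ + B₂) / (n * c)))) := by
    intro s
    have hi : ∀ S : Set (Sample dX dY dZ n), MeasurableSet S →
        ∫⁻ D, S.indicator (2 : Sample dX dY dZ n → ℝ≥0∞) D ∂Q = 2 * Q S := fun S hS =>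
      lintegral_indicator_const hS 2
    simp only [hb]
    rw [lintegral_add_left (hbm12 s), lintegral_add_left (hbm1 s), lintegral_add_left (hbm5 s),
      hi _ (hs1 s), hi _ (hs2 s), lintegral_const, measure_univ, mul_one]
    refine add_le_add (add_le_add (mul_le_mul_right (h1 s) _) (mul_le_mul_right (h2 s) _))
      (add_le_add_left ?_ _)
    rw [lintegral_finsetSum _ fun i _ => hbm4 s i]
    calc _ ≤ ∑ i : Fin n, ∑ j : Fin n, ENNReal.ofReal (1 / (n * c) ^ 2) * ε₃ := by
          refine Finset.sum_le_sum fun i _ => ?_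
          rw [lintegral_finsetSum _ fun j _ => hbm3 s i j]
          refine Finset.sum_le_sum fun j _ => ?_
          split_ifs with hij
          · rw [lintegral_const_mul _ (hmk s i j)]
            exact mul_le_mul_right (h3 s i j hij.1 hij.2.1 hij.2.2) _
          · simp
      -- The `n²` pairs cancel against the `1 / n²` of the two normalised weights.
      _ = ENNReal.ofReal (1 / c ^ 2) * ε₃ := by
          simp only [Finset.sum_const, Finset.card_univ, Fintype.card_fin, nsmul_eq_mul]
          rw [← mul_assoc, ← mul_assoc, ← ENNReal.ofReal_natCast, ← ENNReal.ofReal_mul hn'.le,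
            ← ENNReal.ofReal_mul (by positivity)]
          congr 2
          field_simp
  calc _ = ∫⁻ D, ENNReal.ofReal (∑ π, cptProb p D π *
        cbdEstimate K₁ K₂ h₁ h₂ a (permuteX π D)) ∂Q := by
        refine lintegral_congr fun D => ?_
        rw [ENNReal.ofReal_sum_of_nonneg fun π _ => mul_nonneg (cptProb_nonneg D π)
          (cbdEstimate_nonneg hK₁ hK₂ hh₁ hh₂ ha0 _)]
        exact Finset.sum_congr rfl fun π _ => (ENNReal.ofReal_mul (cptProb_nonneg D π)).symm
    _ ≤ ∫⁻ D, ENNReal.ofReal (Ca / n) * ∑ s, b s D ∂Q := by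
        refine lintegral_mono fun D => ?_
        have h0 : ∀ s, 0 ≤ ∑ π, cptProb p D π * ballSum (fun i => (D (π i)).1)
            (weightYZ K₁ h₁ D s) (weightZ K₂ h₂ D s) := fun s => Finset.sum_nonneg fun π _ =>
          mul_nonneg (cptProb_nonneg D π) (ballSum_nonneg (weightYZ_nonneg hK₁ hh₁ D s)
            (weightZ_nonneg hK₂ hh₂ D s) _)
        rw [sum_cptProb_mul_cbdEstimate_eq hK₁ hK₂ hh₁ hh₂]
        calc _ ≤ ENNReal.ofReal (Ca / n * ∑ s, ∑ π, cptProb p D π *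
              ballSum (fun i => (D (π i)).1) (weightYZ K₁ h₁ D s) (weightZ K₂ h₂ D s)) := by
              refine ENNReal.ofReal_le_ofReal ?_
              rw [one_div_mul_eq_div, div_mul_eq_mul_div, Finset.mul_sum]
              refine div_le_div_of_nonneg_right (Finset.sum_le_sum fun s _ => ?_) hn'.le
              rw [mul_comm Ca]
              exact mul_le_mul_of_nonneg_left (hCa _ _) (h0 s)
          _ ≤ _ := by
              rw [ENNReal.ofReal_mul (by positivity), ENNReal.ofReal_sum_of_nonneg fun s _ => h0 s]
              exact mul_le_mul_right (Finset.sum_le_sum fun s _ => hpt s D) _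
    _ = ENNReal.ofReal (Ca / n) * ∑ s, ∫⁻ D, b s D ∂Q := by
        rw [lintegral_const_mul _ (Finset.measurable_sum _ fun s _ => hbm s),
          lintegral_finsetSum _ fun s _ => hbm s]
    _ ≤ ENNReal.ofReal (Ca / n) * ∑ _s : Fin n, (2 * ε₁ + 2 * ε₂ + (ENNReal.ofReal (1 / c ^ 2) * ε₃ +
          ENNReal.ofReal (14 * ((B₁ + B₂) / (n * c))))) :=
        mul_le_mul_right (Finset.sum_le_sum fun s _ => hbint s) _
    _ = _ := by
        simp only [Finset.sum_const, Finset.card_univ, Fintype.card_fin, nsmul_eq_mul]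
        rw [← mul_assoc, ← ENNReal.ofReal_natCast, ← ENNReal.ofReal_mul (by positivity),
          div_mul_cancel₀ _ hn'.ne']

end PermutedStatistic

/-! ### The permuted statistic as the sample size grows -/

section PermutedLimit

variable {dX dY dZ : ℕ} {p : Rd dX → Rd dY → Rd dZ → ℝ}
  {P : Measure (Rd dX × Rd dY × Rd dZ)} {C : ℝ≥0} {K K₁ K₂ : ℝ → ℝ} {h h₁ h₂ : ℕ → ℝ}
  {a : Rd dY → Rd dZ → ℝ}

theorem measure_pi_eval_preimage {S : Type*} [MeasurableSpace S] (P : Measure S)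
    [IsProbabilityMeasure P] {n : ℕ} (s : Fin n) {A : Set S} (hA : MeasurableSet A) :
    Measure.pi (fun _ : Fin n => P) {D | D s ∈ A} = P A :=
  (measurePreserving_eval (fun _ : Fin n => P) s).measure_preimage hA.nullMeasurableSet

/-- A quantity that is close to a positive function of an observation is bounded below with high
probability. -/
theorem exists_eventually_measure_lt_le {S : Type*} [MeasurableSpace S] (P : Measure S)
    [IsProbabilityMeasure P] {ψ : S → ℝ} (hψ : Measurable ψ) (hψ0 : P {w | ψ w ≤ 0} = 0)
    {κ : (n : ℕ) → (Fin n → S) → Fin n → ℝ}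
    (hκ : ∀ δ : ℝ, 0 < δ → ∀ ε : ℝ≥0∞, 0 < ε → ∀ᶠ n in atTop, ∀ s : Fin n,
      Measure.pi (fun _ : Fin n => P) {D | δ ≤ |κ n D s - ψ (D s)|} ≤ ε)
    {ε : ℝ≥0∞} (hε : 0 < ε) :
    ∃ c : ℝ, 0 < c ∧ ∀ᶠ n in atTop, ∀ s : Fin n,
      Measure.pi (fun _ : Fin n => P) {D | κ n D s < c} ≤ 2 * ε := by
  obtain ⟨η, hη, hP⟩ := exists_measure_lt_le P hψ hψ0 hε
  -- If `κ < η / 2`, then either `ψ < η` or the estimate is off by at least `η / 2`.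
  refine ⟨η / 2, half_pos hη, (hκ (η / 2) (half_pos hη) ε hε).mono fun n hn s => ?_⟩
  have hA : MeasurableSet {w | ψ w < η} := measurableSet_lt hψ measurable_const
  calc _ ≤ Measure.pi (fun _ : Fin n => P) ({D | D s ∈ {w | ψ w < η}} ∪
        {D | η / 2 ≤ |κ n D s - ψ (D s)|}) := by
        refine measure_mono fun D hD => ?_
        simp only [Set.mem_union, Set.mem_ofPred_eq] at hD ⊢
        by_contra! hcon
        have := neg_abs_le (κ n D s - ψ (D s))
        linarith [hcon.1, hcon.2]
    _ ≤ ε + ε := (measure_union_le _ _).trans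
        (add_le_add ((measure_pi_eval_preimage P s hA).le.trans hP) (hn s))
    _ = 2 * ε := (two_mul ε).symm

/-- The conditional mean, over the permutations, of the statistic of the permuted data tends to
zero in mean. -/
theorem HasBoundedDensity.eventually_lintegral_cbdEstimate_permuteX_le [IsProbabilityMeasure P]
    (hp : HasBoundedDensity p P C)
    (hK₁ : KernelAssumption (dY + dZ) K₁) (hK₂ : KernelAssumption dZ K₂)
    (hh : BandwidthAssumption (dY + dZ) dZ h₁ h₂) (ha0 : ∀ y z, 0 ≤ a y z)
    (haC : ∃ Ca, ∀ y z, a y z ≤ Ca) {ε : ℝ≥0∞} (hε : 0 < ε) :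
    ∀ᶠ n in atTop, ∫⁻ D, ∑ π, ENNReal.ofReal (cptProb p D π) *
        ENNReal.ofReal (cbdEstimate K₁ K₂ (h₁ n) (h₂ n) a (permuteX π D))
        ∂Measure.pi (fun _ : Fin n => P) ≤ ε := by
  obtain ⟨Ca, hCa⟩ := haC
  have hlim₁ := tendsto_zero_of_bandwidth hh.pos₁ hh.large₁ hh.small₁
  have hlim₂ := tendsto_zero_of_bandwidth hh.pos₂ hh.large₂ hh.small₂
  -- The `10` is the sum in the bound: `2 · 2` for each of the two density estimates, `1` for the
  -- transpositions and `1` for the largest weight.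
  obtain ⟨e, he, hee⟩ := ENNReal.exists_nnreal_pos_mul_lt
    (show ENNReal.ofReal Ca * 10 ≠ ∞ by finiteness) hε.ne'
  have he' : (0 : ℝ≥0∞) < e := ENNReal.coe_pos.2 he
  obtain ⟨c₁, hc₁, hev₁⟩ := exists_eventually_measure_lt_le P
    (ψ := fun w => sectionYZ p Set.univ w.2)
    ((hp.measurable_sectionYZ Set.univ).comp measurable_snd) hp.measure_sectionYZ_univ_le_zero
    (κ := fun n D s => kernelSumYZ K₁ (h₁ n) Set.univ D s)
    (fun δ hδ ε' hε' => hp.eventually_measure_kernelSumYZ_le hK₁ hh.pos₁ hlim₁ hh.large₁ .univ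
      hδ hε') he'
  obtain ⟨c₂, hc₂, hev₂⟩ := exists_eventually_measure_lt_le P
    (ψ := fun w => sectionZ p Set.univ w.2.2)
    ((hp.measurable_sectionZ Set.univ).comp measurable_snd.snd) hp.measure_sectionZ_univ_le_zero
    (κ := fun n D s => kernelSumZ K₂ (h₂ n) Set.univ D s)
    (fun δ hδ ε' hε' => hp.eventually_measure_kernelSumZ_le hK₂ hh.pos₂ hlim₂ hh.large₂ .univ
      hδ hε') he'
  set c := min c₁ c₂
  have hc : 0 < c := lt_min hc₁ hc₂
  -- The accuracy for the transpositions is chosen after `c`, since it is multiplied by `1 / c ^ 2`.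
  obtain ⟨ε₃, hε₃, hε₃e⟩ := ENNReal.exists_nnreal_pos_mul_lt
    (show ENNReal.ofReal (1 / c ^ 2) ≠ ∞ by finiteness) he'.ne'
  have hev₃ := hp.eventually_lintegral_kernel_swapDist_le hK₁ hK₂ hh.pos₁ hh.pos₂ hlim₁ hlim₂
    (ENNReal.coe_pos.2 hε₃)
  obtain ⟨B₁, hB₁⟩ := hK₁.bounded
  obtain ⟨B₂, hB₂⟩ := hK₂.bounded
  have ht : Tendsto (fun n : ℕ => ENNReal.ofReal (14 * (((h₁ n ^ (dY + dZ))⁻¹ * B₁ +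
      (h₂ n ^ dZ)⁻¹ * B₂) / (n * c)))) atTop (𝓝 0) := by
    rw [← ENNReal.ofReal_zero]
    refine ENNReal.tendsto_ofReal ?_
    have h1 := (((tendsto_kernel_bound_div hh.large₁ B₁).add
      (tendsto_kernel_bound_div hh.large₂ B₂)).div_const c).const_mul 14
    rw [add_zero, zero_div, mul_zero] at h1
    refine h1.congr fun n => ?_
    rw [← add_div, div_div]
  filter_upwards [hev₁, hev₂, hev₃, ht.eventually (gt_mem_nhds he'), eventually_gt_atTop 0]
    with n hn₁ hn₂ hn₃ hn₄ hn
  have hsub : ∀ (κ : Sample dX dY dZ n → ℝ) (c' : ℝ), c ≤ c' → {D | κ D < c} ⊆ {D | κ D < c'} :=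
    fun κ c' hcc D hD => lt_of_lt_of_le (show κ D < c from hD) hcc
  have hpos₁ := hh.pos₁ n
  have hpos₂ := hh.pos₂ n
  refine (lintegral_sum_cptProb_mul_cbdEstimate_le hp hK₁.measurable hK₂.measurable hK₁.nonneg
    hK₂.nonneg hpos₁ hpos₂
    (fun v => mul_le_mul_of_nonneg_left (hB₁ _) (by positivity))
    (fun v => mul_le_mul_of_nonneg_left (hB₂ _) (by positivity)) ha0 hCa hc
    (fun s => (measure_mono (hsub (fun D => kernelSumYZ K₁ (h₁ n) Set.univ D s) _
      (min_le_left c₁ c₂))).trans (hn₁ s))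
    (fun s => (measure_mono (hsub (fun D => kernelSumZ K₂ (h₂ n) Set.univ D s) _
      (min_le_right c₁ c₂))).trans (hn₂ s))
    hn₃ hn).trans ?_
  calc _ ≤ ENNReal.ofReal Ca * (2 * (2 * e) + 2 * (2 * e) + (e + e)) := by
        gcongr
        rw [mul_comm]; exact hε₃e.le
    _ = e * (ENNReal.ofReal Ca * 10) := by ring
    _ ≤ ε := hee.le

end PermutedLimit

/-! ### Lower bounds for the statistic -/

section LowerBound

/-- The mass that the weights `w` on the points `x` give to `A`. -/
def massOn {E : Type*} {n : ℕ} (x : Fin n → E) (w : Fin n → ℝ) (A : Set E) : ℝ :=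
  ∑ i, w i * A.indicator 1 (x i)

/-- A ball with centre in `U` and boundary point in `V` lies between `I` and `O`, so its two masses
differ by at least `θ`. Of all pairs only those in `V × U` are kept, with their `w ⊗ w` weight. -/
theorem mul_sq_le_ballSum {E : Type*} [PseudoMetricSpace E] {n : ℕ} {x : Fin n → E}
    {w v : Fin n → ℝ} (hw : ∀ i, 0 ≤ w i) (hv : ∀ i, 0 ≤ v i) {U V I O : Set E}
    (hI : ∀ u ∈ U, ∀ u' ∈ V, I ⊆ Metric.closedBall u (dist u' u))
    (hO : ∀ u ∈ U, ∀ u' ∈ V, Metric.closedBall u (dist u' u) ⊆ O) {θ : ℝ} (hθ : 0 ≤ θ)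
    (hgap : θ ≤ massOn x w I - massOn x v O ∨ θ ≤ massOn x v I - massOn x w O) :
    massOn x w U * massOn x w V * θ ^ 2 ≤ ballSum x w v := by
  have hmass : ∀ (u : Fin n → ℝ), (∀ i, 0 ≤ u i) → ∀ a b, x a ∈ V → x b ∈ U →
      massOn x u I ≤ ∑ i, u i * ballIndicator x a b i ∧
      ∑ i, u i * ballIndicator x a b i ≤ massOn x u O := by
    intro u hu a b ha hb
    constructor
    · refine Finset.sum_le_sum fun i _ => mul_le_mul_of_nonneg_left ?_ (hu i)
      by_cases hi : x i ∈ I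
      · rw [ballIndicator, if_pos (Metric.mem_closedBall.1 (hI _ hb _ ha hi)),
          Set.indicator_of_mem hi, Pi.one_apply]
      · rw [Set.indicator_of_notMem hi]
        exact ballIndicator_nonneg _ _ _ _
    · refine Finset.sum_le_sum fun i _ => mul_le_mul_of_nonneg_left ?_ (hu i)
      by_cases hi : x i ∈ O
      · rw [Set.indicator_of_mem hi, Pi.one_apply]
        exact ballIndicator_le_one _ _ _ _
      · rw [ballIndicator, if_neg fun h => hi (hO _ hb _ ha (Metric.mem_closedBall.2 h))]
        exact Set.indicator_nonneg (fun _ _ => zero_le_one) _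
  have hsq : ∀ a b, x a ∈ V → x b ∈ U → θ ^ 2 ≤ ballDiff x w v a b ^ 2 := by
    intro a b ha hb
    obtain ⟨h1, h2⟩ := hmass w hw a b ha hb
    obtain ⟨h3, h4⟩ := hmass v hv a b ha hb
    have hd : ballDiff x w v a b =
        ∑ i, w i * ballIndicator x a b i - ∑ i, v i * ballIndicator x a b i := by
      simp_rw [ballDiff, sub_mul, Finset.sum_sub_distrib]
    rw [← sq_abs (ballDiff x w v a b)]
    refine pow_le_pow_left₀ hθ ?_ 2
    rcases hgap with h | h
    · exact le_trans (by rw [hd]; linarith) (le_abs_self _)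
    · exact le_trans (by rw [hd]; linarith) (neg_le_abs _)
  calc massOn x w U * massOn x w V * θ ^ 2
      = ∑ a, ∑ b, (w a * V.indicator 1 (x a)) * (w b * U.indicator 1 (x b)) * θ ^ 2 := by
        simp_rw [massOn, ← Finset.sum_mul, ← Finset.mul_sum, ← Finset.sum_mul]
        ring
    _ ≤ ballSum x w v := by
        refine Finset.sum_le_sum fun a _ => Finset.sum_le_sum fun b _ => ?_
        have hnn : 0 ≤ (w a * w b + v a * v b) * ballDiff x w v a b ^ 2 :=
          mul_nonneg (add_nonneg (mul_nonneg (hw a) (hw b)) (mul_nonneg (hv a) (hv b)))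
            (sq_nonneg _)
        by_cases ha : x a ∈ V
        · by_cases hb : x b ∈ U
          · rw [Set.indicator_of_mem ha, Set.indicator_of_mem hb, Pi.one_apply, Pi.one_apply,
              mul_one, mul_one]
            exact mul_le_mul (le_add_of_nonneg_right (mul_nonneg (hv a) (hv b))) (hsq a b ha hb)
              (sq_nonneg _) (add_nonneg (mul_nonneg (hw a) (hw b)) (mul_nonneg (hv a) (hv b)))
          · rw [Set.indicator_of_notMem hb]; simpa using hnn
        · rw [Set.indicator_of_notMem ha]; simpa using hnn

variable {dX dY dZ n : ℕ}

theorem massOn_weightYZ (K : ℝ → ℝ) (h : ℝ) (D : Sample dX dY dZ n) (s : Fin n)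
    (A : Set (Rd dX)) :
    massOn (fun i => (D i).1) (weightYZ K h D s) A =
      kernelSumYZ K h A D s / kernelSumYZ K h Set.univ D s := by
  have hn : (1 / (n : ℝ)) ≠ 0 := by have := s.pos; positivity
  rw [kernelSumYZ_univ, kernelSumYZ, kernelAverage, mul_div_mul_left _ _ hn, massOn,
    Finset.sum_div]
  exact Finset.sum_congr rfl fun i _ => div_mul_eq_mul_div _ _ _

theorem massOn_weightZ (K : ℝ → ℝ) (h : ℝ) (D : Sample dX dY dZ n) (s : Fin n)
    (A : Set (Rd dX)) :
    massOn (fun i => (D i).1) (weightZ K h D s) A =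
      kernelSumZ K h A D s / kernelSumZ K h Set.univ D s := by
  have hn : (1 / (n : ℝ)) ≠ 0 := by have := s.pos; positivity
  rw [kernelSumZ_univ, kernelSumZ, kernelAverage, mul_div_mul_left _ _ hn, massOn,
    Finset.sum_div]
  exact Finset.sum_congr rfl fun i _ => div_mul_eq_mul_div _ _ _

/-- Differences of products are stable under small perturbations of the factors. -/
theorem half_le_mul_sub_mul {C η δ a b c d a' b' c' d' : ℝ} (hδ : 0 ≤ δ) (hδ1 : δ ≤ 1)
    (hδη : δ * (4 * (2 * C + 1)) ≤ η) (ha : 0 ≤ a ∧ a ≤ C) (hb : 0 ≤ b ∧ b ≤ C)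
    (hc : 0 ≤ c ∧ c ≤ C) (hd : 0 ≤ d ∧ d ≤ C) (ha' : |a' - a| ≤ δ) (hb' : |b' - b| ≤ δ)
    (hc' : |c' - c| ≤ δ) (hd' : |d' - d| ≤ δ) (h : η ≤ a * b - c * d) :
    η / 2 ≤ a' * b' - c' * d' := by
  have key : ∀ {x y x' y' : ℝ}, 0 ≤ x ∧ x ≤ C → 0 ≤ y ∧ y ≤ C → |x' - x| ≤ δ → |y' - y| ≤ δ →
      |x' * y' - x * y| ≤ δ * (2 * C + 1) := by
    intro x y x' y' hx hy hx' hy'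
    have hC : 0 ≤ C := hx.1.trans hx.2
    have h1 : |x'| ≤ C + 1 := by
      have := abs_le.1 hx'
      rw [abs_le]
      constructor <;> linarith [hx.1, hx.2]
    calc |x' * y' - x * y| = |x' * (y' - y) + (x' - x) * y| := by ring_nf
      _ ≤ |x'| * |y' - y| + |x' - x| * |y| := by
          rw [← abs_mul, ← abs_mul]; exact abs_add_le _ _
      _ ≤ (C + 1) * δ + δ * C := by
          rw [abs_of_nonneg hy.1]
          exact add_le_add (mul_le_mul h1 hy' (abs_nonneg _) (by linarith))
            (mul_le_mul hx' hy.2 hy.1 hδ)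
      _ = δ * (2 * C + 1) := by ring
  -- Each of the two products moves by at most `δ (2 C + 1) ≤ η / 4`.
  have h1 := (abs_le.1 (key ha hb ha' hb')).1
  have h2 := (abs_le.1 (key hc hd hc' hd')).2
  linarith

/-- The statistic at one observation is bounded below, if the densities at this observation show a
difference between the two conditional laws, and are well estimated. -/
theorem le_ballSum_of_kernelSum {K₁ K₂ : ℝ → ℝ} {h₁ h₂ : ℝ} (hK₁ : ∀ r, 0 ≤ K₁ r)
    (hK₂ : ∀ r, 0 ≤ K₂ r) (hh₁ : 0 < h₁) (hh₂ : 0 < h₂) {D : Sample dX dY dZ n} {s : Fin n}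
    {U V I O : Set (Rd dX)} (hI : ∀ u ∈ U, ∀ u' ∈ V, I ⊆ Metric.closedBall u (dist u' u))
    (hO : ∀ u ∈ U, ∀ u' ∈ V, Metric.closedBall u (dist u' u) ⊆ O) {C η δ : ℝ} (hη : 0 < η)
    (hδ : 0 ≤ δ) (hδ1 : δ ≤ 1) (hδη : δ * (4 * (2 * C + 1)) ≤ η) {f g : Set (Rd dX) → ℝ}
    (hf : ∀ A, 0 ≤ f A ∧ f A ≤ C) (hg : ∀ A, 0 ≤ g A ∧ g A ≤ C)
    (hf' : ∀ A ∈ ({Set.univ, U, V, I, O} : Set (Set (Rd dX))), |kernelSumYZ K₁ h₁ A D s - f A| ≤ δ)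
    (hg' : ∀ A ∈ ({Set.univ, U, V, I, O} : Set (Set (Rd dX))), |kernelSumZ K₂ h₂ A D s - g A| ≤ δ)
    (hf0 : η ≤ f Set.univ) (hg0 : η ≤ g Set.univ) (hU : η ≤ f U) (hV : η ≤ f V)
    (hgap : η ≤ f I * g Set.univ - g O * f Set.univ ∨ η ≤ g I * f Set.univ - f O * g Set.univ) :
    (η / 2 / (C + 1)) * (η / 2 / (C + 1)) * (η / 2 / (C + 1) ^ 2) ^ 2 ≤
      ballSum (fun i => (D i).1) (weightYZ K₁ h₁ D s) (weightZ K₂ h₂ D s) := by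
  have hC : 0 ≤ C := (hf U).1.trans (hf U).2
  have hδ2 : δ ≤ η / 2 := by nlinarith
  have hf0' := abs_le.1 (hf' Set.univ (by simp))
  have hg0' := abs_le.1 (hg' Set.univ (by simp))
  have hfpos : 0 < kernelSumYZ K₁ h₁ Set.univ D s := by linarith [hf0'.1]
  have hgpos : 0 < kernelSumZ K₂ h₂ Set.univ D s := by linarith [hg0'.1]
  have hfle : kernelSumYZ K₁ h₁ Set.univ D s ≤ C + 1 := by linarith [hf0'.2, (hf Set.univ).2]
  have hgle : kernelSumZ K₂ h₂ Set.univ D s ≤ C + 1 := by linarith [hg0'.2, (hg Set.univ).2]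
  have hmass : ∀ A ∈ ({Set.univ, U, V, I, O} : Set (Set (Rd dX))), η ≤ f A →
      η / 2 / (C + 1) ≤ massOn (fun i => (D i).1) (weightYZ K₁ h₁ D s) A := by
    intro A hA hfA
    rw [massOn_weightYZ]
    exact div_le_div₀ (by linarith [(abs_le.1 (hf' A hA)).1])
      (by linarith [(abs_le.1 (hf' A hA)).1]) hfpos hfle
  -- The gap is stated after cross-multiplication; going back to conditional probabilities only
  -- needs upper bounds on the denominators.
  have hratio : ∀ {a b c d : ℝ}, 0 < b → 0 < d → b ≤ C + 1 → d ≤ C + 1 → η / 2 ≤ a * d - c * b →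
      η / 2 / (C + 1) ^ 2 ≤ a / b - c / d := by
    intro a b c d hb hd hb' hd' h
    rw [div_sub_div _ _ hb.ne' hd.ne', mul_comm b c, sq]
    exact div_le_div₀ (by linarith) h (by positivity) (mul_le_mul hb' hd' hd.le (by linarith))
  have hgap' : η / 2 / (C + 1) ^ 2 ≤ massOn (fun i => (D i).1) (weightYZ K₁ h₁ D s) I -
      massOn (fun i => (D i).1) (weightZ K₂ h₂ D s) O ∨
      η / 2 / (C + 1) ^ 2 ≤ massOn (fun i => (D i).1) (weightZ K₂ h₂ D s) I -
      massOn (fun i => (D i).1) (weightYZ K₁ h₁ D s) O := by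
    simp only [massOn_weightYZ, massOn_weightZ]
    refine hgap.imp (fun h => ?_) (fun h => ?_)
    · exact hratio hfpos hgpos hfle hgle (half_le_mul_sub_mul hδ hδ1 hδη (hf _) (hg _) (hg _) (hf _)
        (hf' I (by simp)) (hg' _ (by simp)) (hg' O (by simp)) (hf' _ (by simp)) h)
    · exact hratio hgpos hfpos hgle hfle (half_le_mul_sub_mul hδ hδ1 hδη (hg _) (hf _) (hf _) (hg _)
        (hg' I (by simp)) (hf' _ (by simp)) (hf' O (by simp)) (hg' _ (by simp)) h)
  refine le_trans ?_ (mul_sq_le_ballSum (weightYZ_nonneg hK₁ hh₁ D s) (weightZ_nonneg hK₂ hh₂ D s)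
    hI hO (by positivity) hgap')
  exact mul_le_mul_of_nonneg_right (mul_le_mul (hmass U (by simp) hU) (hmass V (by simp) hV)
    (by positivity) (le_trans (by positivity) (hmass U (by simp) hU))) (sq_nonneg _)

/-- An average of nonnegative terms is bounded below with high probability, if its terms are bounded
below at the observations in a set of positive probability, up to improbable events. -/
theorem exists_eventually_measure_lt_le_of_average {S : Type*} [MeasurableSpace S] (P : Measure S)
    [IsProbabilityMeasure P] {G : Set S} (hG : MeasurableSet G) (hG0 : P G ≠ 0)
    {bad : (n : ℕ) → Fin n → Set (Fin n → S)} (hbad : ∀ n s, MeasurableSet (bad n s))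
    (hbadP : ∀ ε : ℝ≥0∞, 0 < ε → ∀ᶠ n in atTop, ∀ s : Fin n,
      Measure.pi (fun _ : Fin n => P) (bad n s) ≤ ε)
    {T : (n : ℕ) → (Fin n → S) → ℝ} {β : ℝ} (hβ : 0 < β) {t : (n : ℕ) → (Fin n → S) → Fin n → ℝ}
    (hT : ∀ n D, T n D = (1 / (n : ℝ)) * ∑ s, t n D s) (ht0 : ∀ n D s, 0 ≤ t n D s)
    (ht : ∀ n D s, D s ∈ G → D ∉ bad n s → β ≤ t n D s) :
    ∃ c : ℝ, 0 < c ∧ ∀ ε : ℝ≥0∞, 0 < ε → ∀ᶠ n in atTop,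
      Measure.pi (fun _ : Fin n => P) {D | T n D < c} ≤ ε := by
  set γ := P.real G with hγdef
  have hγ : 0 < γ := ENNReal.toReal_pos hG0 (measure_ne_top _ _)
  have hγ1 : γ ≤ 1 := measureReal_le_one
  refine ⟨β * (γ / 2), by positivity, fun ε hε => ?_⟩
  have hγ2 : (0 : ℝ≥0∞) < ENNReal.ofReal (γ / 2) := ENNReal.ofReal_pos.2 (by positivity)
  -- The `3` counts `2 e` for the fluctuation of the frequency of `G` and `e` for the mean
  -- proportion of bad indices.
  obtain ⟨e, he, hee⟩ := ENNReal.exists_nnreal_pos_mul_lt (show (3 : ℝ≥0∞) ≠ ∞ by finiteness)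
    (ENNReal.mul_pos hγ2.ne' hε.ne').ne'
  have he' : (0 : ℝ) < e := he
  have hlim : Tendsto (fun n : ℕ => (e : ℝ) + 1 * 1 / (n * e)) atTop (𝓝 (e + 0)) := by
    refine tendsto_const_nhds.add ?_
    have := (tendsto_inv_atTop_zero.comp (tendsto_natCast_atTop_atTop (R := ℝ))).mul_const
      (e : ℝ)⁻¹
    rw [zero_mul] at this
    refine this.congr fun n => ?_
    simp [mul_comm]
  have hlt : (e : ℝ) + 0 < 2 * e := by linarith
  filter_upwards [hbadP e (ENNReal.coe_pos.2 he), hlim.eventually (gt_mem_nhds hlt),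
    eventually_gt_atTop 0] with n hn1 hn2 hn
  have hn' : (0 : ℝ) < n := Nat.cast_pos.2 hn
  set Q := Measure.pi fun _ : Fin n => P
  set N : (Fin n → S) → ℝ := fun D => (1 / (n : ℝ)) * ∑ i, G.indicator 1 (D i)
  have hX : Measurable (G.indicator (1 : S → ℝ)) := measurable_one.indicator hG
  have hint : ∫ w, G.indicator (1 : S → ℝ) w ∂P = γ := integral_indicator_one hG
  have h1 : ∫⁻ D, ‖N D - γ‖ₑ ∂Q ≤ 2 * e := by
    have h := lintegral_enorm_average_sub_le (P := P) (B := 1) hn hX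
      (fun w => Set.indicator_nonneg (fun _ _ => zero_le_one) w)
      (fun w => Set.indicator_le_self' (fun _ _ => zero_le_one) w) (C := 1)
      (by rw [hint]; exact hγ1) he'
    rw [hint] at h
    refine h.trans ((ENNReal.ofReal_le_ofReal hn2.le).trans (le_of_eq ?_))
    rw [ENNReal.ofReal_mul zero_le_two, ENNReal.ofReal_ofNat, ENNReal.ofReal_coe_nnreal]
  set R : (Fin n → S) → ℝ≥0∞ := fun D =>
    ENNReal.ofReal (1 / (n : ℝ)) * ∑ s, (bad n s).indicator 1 D with hR
  have hbm : ∀ s, Measurable ((bad n s).indicator (1 : (Fin n → S) → ℝ≥0∞)) := fun s =>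
    measurable_one.indicator (hbad n s)
  have hsm : Measurable fun D : Fin n → S => ∑ s, (bad n s).indicator (1 : (Fin n → S) → ℝ≥0∞) D :=
    Finset.measurable_sum _ fun s _ => hbm s
  have hRm : Measurable R := hsm.const_mul _
  have h2 : ∫⁻ D, R D ∂Q ≤ e := by
    simp only [hR]
    rw [lintegral_const_mul _ hsm, lintegral_finsetSum _ fun s _ => hbm s]
    calc _ ≤ ENNReal.ofReal (1 / (n : ℝ)) * ∑ _s : Fin n, (e : ℝ≥0∞) := by
          gcongr with s
          rw [lintegral_indicator_one (hbad n s)]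
          exact hn1 s
      _ = e := by
          rw [Finset.sum_const, Finset.card_univ, Fintype.card_fin, nsmul_eq_mul, ← mul_assoc,
            ← ENNReal.ofReal_natCast, ← ENNReal.ofReal_mul (by positivity),
            one_div_mul_cancel hn'.ne', ENNReal.ofReal_one, one_mul]
  have hm := mul_meas_ge_le_lintegral (μ := Q) ((by fun_prop : Measurable fun D => ‖N D - γ‖ₑ).add
    hRm) (ENNReal.ofReal (γ / 2))
  simp only [Pi.add_apply] at hm
  rw [lintegral_add_right _ hRm] at hm
  have h3 : ENNReal.ofReal (γ / 2) * Q {D | ENNReal.ofReal (γ / 2) ≤ ‖N D - γ‖ₑ + R D} ≤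
      ENNReal.ofReal (γ / 2) * ε := by
    refine hm.trans ((add_le_add h1 h2).trans (le_trans (le_of_eq ?_) hee.le))
    ring
  rw [ENNReal.mul_le_mul_iff_right hγ2.ne' ENNReal.ofReal_ne_top] at h3
  refine (measure_mono fun D hD => ?_).trans h3
  simp only [Set.mem_ofPred_eq] at hD ⊢
  have hb0 : ∀ s, 0 ≤ (bad n s).indicator (1 : (Fin n → S) → ℝ) D := fun s =>
    Set.indicator_nonneg (fun _ _ => zero_le_one) _
  have hRr : R D = ENNReal.ofReal ((1 / (n : ℝ)) * ∑ s, (bad n s).indicator 1 D) := by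
    rw [ENNReal.ofReal_mul (by positivity), ENNReal.ofReal_sum_of_nonneg fun s _ => hb0 s]
    simp_rw [ofReal_indicator_one]
    rfl
  have hB0 : 0 ≤ (1 / (n : ℝ)) * ∑ s, (bad n s).indicator (1 : (Fin n → S) → ℝ) D :=
    mul_nonneg (by positivity) (Finset.sum_nonneg fun s _ => hb0 s)
  rw [hRr, Real.enorm_eq_ofReal_abs, ← ENNReal.ofReal_add (abs_nonneg _) hB0]
  refine ENNReal.ofReal_le_ofReal ?_
  -- Each index in `G` contributes `β` unless it is bad. So a small `T` forces the frequency of `G`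
  -- to be far from `γ`, or the proportion of bad indices to be large, by `γ / 2` in total.
  have hTge : β * (N D - (1 / (n : ℝ)) * ∑ s, (bad n s).indicator (1 : (Fin n → S) → ℝ) D) ≤
      T n D := by
    rw [hT, ← mul_sub, ← Finset.sum_sub_distrib, mul_left_comm, Finset.mul_sum]
    refine mul_le_mul_of_nonneg_left (Finset.sum_le_sum fun s _ => ?_) (by positivity)
    by_cases hs : D s ∈ G
    · by_cases hb : D ∈ bad n s
      · rw [Set.indicator_of_mem hs, Set.indicator_of_mem hb]
        simpa using ht0 n D s
      · rw [Set.indicator_of_mem hs, Set.indicator_of_notMem hb]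
        simpa using ht n D s hs hb
    · rw [Set.indicator_of_notMem hs, zero_sub]
      refine le_trans ?_ (ht0 n D s)
      nlinarith [hb0 s]
  have h4 := lt_of_mul_lt_mul_left (hTge.trans_lt hD) hβ.le
  have h5 := neg_abs_le (N D - γ)
  linarith

end LowerBound

/-! ### Detecting conditional dependence by finitely many balls -/

section Gap

/-- The larger closed balls decrease to the closed ball and the smaller ones exhaust the open ball;
the sphere between the two is null for `F`. -/
theorem eventually_measure_closedBall_lt {d : ℕ} [Nontrivial (Rd d)] {F G : Measure (Rd d)}
    [IsFiniteMeasure F] [IsFiniteMeasure G] (hF : F ≪ volume) {u : Rd d} {r : ℝ}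
    (h : G (Metric.closedBall u r) < F (Metric.closedBall u r)) :
    ∀ᶠ m : ℕ in atTop, G (Metric.closedBall u (r + 6 * (1 / ((m : ℝ) + 1)))) <
      F (Metric.closedBall u (r - 6 * (1 / ((m : ℝ) + 1)))) := by
  have hmono : ∀ {m n : ℕ}, m ≤ n → (1 : ℝ) / ((n : ℝ) + 1) ≤ 1 / ((m : ℝ) + 1) := fun hmn =>
    one_div_le_one_div_of_le (by positivity) (by exact_mod_cast Nat.succ_le_succ hmn)
  have hlim := (tendsto_one_div_add_atTop_nhds_zero_nat (𝕜 := ℝ)).const_mul 6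
  rw [mul_zero] at hlim
  have h1 : Tendsto (fun m : ℕ => G (Metric.closedBall u (r + 6 * (1 / ((m : ℝ) + 1))))) atTop
      (𝓝 (G (⋂ m : ℕ, Metric.closedBall u (r + 6 * (1 / ((m : ℝ) + 1)))))) := by
    refine tendsto_measure_iInter_atTop
      (fun m => Metric.isClosed_closedBall.measurableSet.nullMeasurableSet) ?_
      ⟨0, measure_ne_top _ _⟩
    exact fun m n hmn => Metric.closedBall_subset_closedBall (by linarith [hmono hmn])
  have h2 : Tendsto (fun m : ℕ => F (Metric.closedBall u (r - 6 * (1 / ((m : ℝ) + 1))))) atTop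
      (𝓝 (F (⋃ m : ℕ, Metric.closedBall u (r - 6 * (1 / ((m : ℝ) + 1)))))) :=
    tendsto_measure_iUnion_atTop fun m n hmn =>
      Metric.closedBall_subset_closedBall (by linarith [hmono hmn])
  have e1 : ⋂ m : ℕ, Metric.closedBall u (r + 6 * (1 / ((m : ℝ) + 1))) ⊆ Metric.closedBall u r := by
    intro y hy
    refine Metric.mem_closedBall.2 (ge_of_tendsto' (b := dist y u)
      (by simpa using tendsto_const_nhds.add hlim) fun m =>
        Metric.mem_closedBall.1 (Set.mem_iInter.1 hy m))
  have e2 : Metric.ball u r ⊆ ⋃ m : ℕ, Metric.closedBall u (r - 6 * (1 / ((m : ℝ) + 1))) := by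
    intro y hy
    have hpos : 0 < r - dist y u := sub_pos.2 (Metric.mem_ball.1 hy)
    obtain ⟨m, hm⟩ := (hlim.eventually (gt_mem_nhds hpos)).exists
    exact Set.mem_iUnion.2 ⟨m, Metric.mem_closedBall.2 (by linarith)⟩
  have e3 : F (Metric.closedBall u r) ≤ F (Metric.ball u r) := by
    rw [← Metric.ball_union_sphere]
    refine (measure_union_le _ _).trans ?_
    rw [hF (Measure.addHaar_sphere volume u r), add_zero]
  exact h1.eventually_lt h2 (((measure_mono e1).trans_lt h).trans_le
    (e3.trans (measure_mono e2)))

/-- Two absolutely continuous measures of the same mass that differ are told apart by balls from a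
countable family. -/
theorem exists_denseSeq_ball_of_ne {d : ℕ} [Nontrivial (Rd d)] {F G : Measure (Rd d)}
    [IsFiniteMeasure F] [IsFiniteMeasure G] (hF : F ≪ volume) (hG : G ≪ volume)
    (hmass : F Set.univ = G Set.univ) (hne : F ≠ G) :
    ∃ k l m : ℕ, let q := TopologicalSpace.denseSeq (Rd d) k
      let q' := TopologicalSpace.denseSeq (Rd d) l
      let ρ : ℝ := 1 / ((m : ℝ) + 1)
      0 < F (Metric.ball q ρ) ∧ 0 < F (Metric.ball q' ρ) ∧
      (G (Metric.closedBall q (dist q q' + 3 * ρ)) < F (Metric.closedBall q (dist q q' - 3 * ρ)) ∨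
        F (Metric.closedBall q (dist q q' + 3 * ρ)) <
          G (Metric.closedBall q (dist q q' - 3 * ρ))) := by
  obtain ⟨u, hu, v, hv, huv⟩ : ∃ u ∈ F.support, ∃ v ∈ F.support,
      F (Metric.closedBall u (dist v u)) ≠ G (Metric.closedBall u (dist v u)) := by
    by_contra! hcon
    exact hne (measure_eq_of_closedBall_eq F G (fun x => hF (measure_singleton x)) hmass hcon)
  obtain ⟨m, hm⟩ : ∃ m : ℕ, G (Metric.closedBall u (dist v u + 6 * (1 / ((m : ℝ) + 1)))) <
        F (Metric.closedBall u (dist v u - 6 * (1 / ((m : ℝ) + 1)))) ∨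
      F (Metric.closedBall u (dist v u + 6 * (1 / ((m : ℝ) + 1)))) <
        G (Metric.closedBall u (dist v u - 6 * (1 / ((m : ℝ) + 1)))) := by
    rcases lt_or_gt_of_ne huv with h | h
    · exact (eventually_measure_closedBall_lt hG h).exists.imp fun m hm => Or.inr hm
    · exact (eventually_measure_closedBall_lt hF h).exists.imp fun m hm => Or.inl hm
  have hρ : (0 : ℝ) < 1 / ((m : ℝ) + 1) := by positivity
  obtain ⟨k, hk⟩ := (TopologicalSpace.denseRange_denseSeq (Rd d)).exists_dist_lt u hρ
  obtain ⟨l, hl⟩ := (TopologicalSpace.denseRange_denseSeq (Rd d)).exists_dist_lt v hρ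
  refine ⟨k, l, m, ?_⟩
  dsimp only
  set q := TopologicalSpace.denseSeq (Rd d) k
  set q' := TopologicalSpace.denseSeq (Rd d) l
  set ρ : ℝ := 1 / ((m : ℝ) + 1)
  have hd1 : dist q q' ≤ dist v u + 2 * ρ := by
    have h1 := dist_triangle4 q u v q'
    rw [dist_comm q u, dist_comm u v] at h1
    linarith
  have hd2 : dist v u ≤ dist q q' + 2 * ρ := by
    have h1 := dist_triangle4 v q' q u
    rw [dist_comm q' q, dist_comm q u] at h1
    linarith
  -- Moving centre and boundary point by less than `ρ` changes their distance by at most `2 ρ`. With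
  -- the margin `3 ρ` and the shift `ρ` of the centre this uses up the `6 ρ` kept in reserve.
  have hout : Metric.closedBall q (dist q q' + 3 * ρ) ⊆
      Metric.closedBall u (dist v u + 6 * ρ) := by
    refine Metric.closedBall_subset_closedBall' ?_
    rw [dist_comm q u]
    linarith
  have hin : Metric.closedBall u (dist v u - 6 * ρ) ⊆
      Metric.closedBall q (dist q q' - 3 * ρ) :=
    Metric.closedBall_subset_closedBall' (by linarith)
  refine ⟨(Measure.mem_support_iff_forall u).1 hu _ (Metric.isOpen_ball.mem_nhds hk),
    (Measure.mem_support_iff_forall v).1 hv _ (Metric.isOpen_ball.mem_nhds hl), ?_⟩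
  exact hm.imp (fun h => ((measure_mono hout).trans_lt h).trans_le (measure_mono hin))
    (fun h => ((measure_mono hout).trans_lt h).trans_le (measure_mono hin))

/-- From `z F = y G` and `G = z c` it follows that `F = y c`, by cancelling `z`. It is stated after
integration against `f`, because the first identity is one between measures; if `y = 0`, then `F`
vanishes almost everywhere. -/
theorem lintegral_mul_eq_of_smul_withDensity_eq {E : Type*} [MeasurableSpace E] {ν : Measure E}
    {F G c f : E → ℝ≥0∞} (hF : Measurable F) (hG : Measurable G) (hc : Measurable c)
    (hf : Measurable f) {y z : ℝ≥0∞} (hz : z ≠ ∞) (hy0 : y = 0 → ∫⁻ x, F x ∂ν = 0)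
    (hz0 : y ≠ 0 → z ≠ 0) (h : y ≠ 0 → z • ν.withDensity F = y • ν.withDensity G)
    (hzc : ∀ᵐ x ∂ν, z * c x = G x) :
    ∫⁻ x, F x * f x ∂ν = y * ∫⁻ x, c x * f x ∂ν := by
  by_cases hy : y = 0
  · have hFf : Measurable fun x => F x * f x := hF.mul hf
    rw [hy, zero_mul, lintegral_eq_zero_iff hFf]
    filter_upwards [(lintegral_eq_zero_iff hF).1 (hy0 hy)] with x hx
    simp only [Pi.zero_apply] at hx ⊢
    rw [hx, zero_mul]
  · have hcf : Measurable fun x => c x * f x := hc.mul hf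
    have h1 := congrArg (fun m : Measure E => ∫⁻ x, f x ∂m) (h hy)
    simp only [lintegral_smul_measure, smul_eq_mul] at h1
    rw [lintegral_withDensity_eq_lintegral_mul _ hF hf,
      lintegral_withDensity_eq_lintegral_mul _ hG hf] at h1
    rw [← ENNReal.mul_right_inj (hz0 hy) hz, mul_left_comm, ← lintegral_const_mul _ hcf]
    refine h1.trans (congrArg _ (lintegral_congr_ae ?_))
    filter_upwards [hzc] with x hx
    rw [Pi.mul_apply, ← mul_assoc, hx]

variable {dX dY dZ : ℕ} {p : Rd dX → Rd dY → Rd dZ → ℝ}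
  {P : Measure (Rd dX × Rd dY × Rd dZ)} {C : ℝ≥0} {a : Rd dY → Rd dZ → ℝ}

/-- The points at which certain balls tell the conditional laws of `X` given `(Y, Z)` and given `Z`
apart. -/
def gapSet (p : Rd dX → Rd dY → Rd dZ → ℝ) (a : Rd dY → Rd dZ → ℝ) (U V I O : Set (Rd dX))
    (η : ℝ) : Set (Rd dY × Rd dZ) :=
  {v | η < a v.1 v.2 ∧ η < sectionYZ p Set.univ v ∧ η < sectionZ p Set.univ v.2 ∧
    η < sectionYZ p U v ∧ η < sectionYZ p V v ∧
    (η < sectionYZ p I v * sectionZ p Set.univ v.2 - sectionZ p O v.2 * sectionYZ p Set.univ v ∨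
      η < sectionZ p I v.2 * sectionYZ p Set.univ v - sectionYZ p O v * sectionZ p Set.univ v.2)}

theorem sectionYZ_nonneg (A : Set (Rd dX)) (v : Rd dY × Rd dZ) : 0 ≤ sectionYZ p A v :=
  ENNReal.toReal_nonneg

theorem sectionZ_nonneg (A : Set (Rd dX)) (z : Rd dZ) : 0 ≤ sectionZ p A z :=
  ENNReal.toReal_nonneg

namespace HasBoundedDensity

theorem measurableSet_gapSet (hp : HasBoundedDensity p P C) (ha : Measurable (Function.uncurry a))
    (U V I O : Set (Rd dX)) (η : ℝ) : MeasurableSet (gapSet p a U V I O η) := by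
  have hY := hp.measurable_sectionYZ
  have hZ : ∀ A, Measurable fun v : Rd dY × Rd dZ => sectionZ p A v.2 := fun A =>
    (hp.measurable_sectionZ A).comp measurable_snd
  refine (measurableSet_lt measurable_const ha).inter ((measurableSet_lt measurable_const
    (hY _)).inter ((measurableSet_lt measurable_const (hZ _)).inter ((measurableSet_lt
    measurable_const (hY _)).inter ((measurableSet_lt measurable_const (hY _)).inter
    ((measurableSet_lt measurable_const (((hY _).mul (hZ _)).sub ((hZ _).mul (hY _)))).union
    (measurableSet_lt measurable_const (((hZ _).mul (hY _)).sub ((hY _).mul (hZ _)))))))))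

/-- Cross-multiplying the conditional laws by `p_{Y,Z}` and `p_Z` gives two measures of the same
mass without any division. Balls separate them strictly, and finitely many strict inequalities hold
with a common margin `1 / (m' + 1)`. -/
theorem exists_mem_gapSet [Nontrivial (Rd dX)] (hp : HasBoundedDensity p P C) {v : Rd dY × Rd dZ}
    (ha : 0 < a v.1 v.2) (hY : margYZ p v.1 v.2 ≠ 0) (hZ : margZ p v.2 ≠ 0)
    (hne : margZ p v.2 • volume.withDensity (fun x => ENNReal.ofReal (p x v.1 v.2)) ≠
      margYZ p v.1 v.2 • volume.withDensity (fun x => margXZ p x v.2)) :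
    ∃ k l m m' : ℕ, let q := TopologicalSpace.denseSeq (Rd dX) k
      let q' := TopologicalSpace.denseSeq (Rd dX) l
      let ρ : ℝ := 1 / ((m : ℝ) + 1)
      v ∈ gapSet p a (Metric.ball q ρ) (Metric.ball q' ρ)
        (Metric.closedBall q (dist q q' - 3 * ρ)) (Metric.closedBall q (dist q q' + 3 * ρ))
        (1 / ((m' : ℝ) + 1)) := by
  have hYt : margYZ p v.1 v.2 ≠ ∞ := ((hp.margYZ_le _ _).trans_lt ENNReal.coe_lt_top).ne
  have hZt : margZ p v.2 ≠ ∞ := ((hp.margZ_le _).trans_lt ENNReal.coe_lt_top).ne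
  set F := margZ p v.2 • volume.withDensity (fun x => ENNReal.ofReal (p x v.1 v.2)) with hFdef
  set G := margYZ p v.1 v.2 • volume.withDensity (fun x => margXZ p x v.2) with hGdef
  have hFA : ∀ A, MeasurableSet A → F A = ENNReal.ofReal (sectionYZ p A v * sectionZ p Set.univ v.2) := by
    intro A hA
    rw [mul_comm, ENNReal.ofReal_mul (sectionZ_nonneg _ _), hp.ofReal_sectionYZ, hp.ofReal_sectionZ,
      hFdef, Measure.smul_apply, withDensity_apply _ hA, smul_eq_mul, Measure.restrict_univ]
    rfl
  have hGA : ∀ A, MeasurableSet A → G A = ENNReal.ofReal (sectionZ p A v.2 * sectionYZ p Set.univ v) := by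
    intro A hA
    rw [mul_comm, ENNReal.ofReal_mul (sectionYZ_nonneg _ _), hp.ofReal_sectionYZ, hp.ofReal_sectionZ,
      hGdef, Measure.smul_apply, withDensity_apply _ hA, smul_eq_mul, Measure.restrict_univ]
    rfl
  have hFfin : IsFiniteMeasure F := ⟨by rw [hFA _ .univ]; exact ENNReal.ofReal_lt_top⟩
  have hGfin : IsFiniteMeasure G := ⟨by rw [hGA _ .univ]; exact ENNReal.ofReal_lt_top⟩
  have hFac : F ≪ volume := (withDensity_absolutelyContinuous _ _).smul_left _
  have hGac : G ≪ volume := (withDensity_absolutelyContinuous _ _).smul_left _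
  have hmass : F Set.univ = G Set.univ := by rw [hFA _ .univ, hGA _ .univ, mul_comm]
  obtain ⟨k, l, m, h1, h2, h3⟩ := exists_denseSeq_ball_of_ne hFac hGac hmass hne
  refine ⟨k, l, m, ?_⟩
  dsimp only
  set q := TopologicalSpace.denseSeq (Rd dX) k
  set q' := TopologicalSpace.denseSeq (Rd dX) l
  set ρ : ℝ := 1 / ((m : ℝ) + 1)
  have hY0 : 0 < sectionYZ p Set.univ v := by
    rw [sectionYZ, Measure.restrict_univ]; exact ENNReal.toReal_pos hY hYt
  have hZ0 : 0 < sectionZ p Set.univ v.2 := by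
    rw [sectionZ, Measure.restrict_univ]; exact ENNReal.toReal_pos hZ hZt
  have hpos : ∀ A, MeasurableSet A → 0 < F A → 0 < sectionYZ p A v := by
    intro A hA h
    rw [hFA A hA, ENNReal.ofReal_pos] at h
    exact pos_of_mul_pos_left h hZ0.le
  have hU := hpos _ Metric.isOpen_ball.measurableSet h1
  have hV := hpos _ Metric.isOpen_ball.measurableSet h2
  have hcb : ∀ r, MeasurableSet (Metric.closedBall q r) := fun r =>
    Metric.isClosed_closedBall.measurableSet
  have hev : ∀ {b : ℝ}, 0 < b → ∀ᶠ m' : ℕ in atTop, 1 / ((m' : ℝ) + 1) < b := fun hb =>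
    (tendsto_one_div_add_atTop_nhds_zero_nat (𝕜 := ℝ)).eventually (gt_mem_nhds hb)
  rw [hGA _ (hcb _), hFA _ (hcb _), hFA _ (hcb _), hGA _ (hcb _),
    ENNReal.ofReal_lt_ofReal_iff_of_nonneg (mul_nonneg (sectionZ_nonneg _ _) hY0.le),
    ENNReal.ofReal_lt_ofReal_iff_of_nonneg (mul_nonneg (sectionYZ_nonneg _ _) hZ0.le),
    ← sub_pos, ← sub_pos (b := sectionYZ p (Metric.closedBall q (dist q q' + 3 * ρ)) v * _)] at h3
  have hgap : ∀ᶠ m' : ℕ in atTop, 1 / ((m' : ℝ) + 1) <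
      sectionYZ p (Metric.closedBall q (dist q q' - 3 * ρ)) v * sectionZ p Set.univ v.2 -
        sectionZ p (Metric.closedBall q (dist q q' + 3 * ρ)) v.2 * sectionYZ p Set.univ v ∨
      1 / ((m' : ℝ) + 1) <
      sectionZ p (Metric.closedBall q (dist q q' - 3 * ρ)) v.2 * sectionYZ p Set.univ v -
        sectionYZ p (Metric.closedBall q (dist q q' + 3 * ρ)) v * sectionZ p Set.univ v.2 := by
    rcases h3 with h | h
    · exact (hev h).mono fun _ => Or.inl
    · exact (hev h).mono fun _ => Or.inr
  exact ((hev ha).and ((hev hY0).and ((hev hZ0).and ((hev hU).and ((hev hV).and hgap))))).exists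

theorem lintegral_eq_lintegral_lintegral (hp : HasBoundedDensity p P C)
    {H : Rd dX × Rd dY × Rd dZ → ℝ≥0∞} (hH : Measurable H) :
    ∫⁻ w, H w ∂P = ∫⁻ v : Rd dY × Rd dZ, ∫⁻ x, ENNReal.ofReal (p x v.1 v.2) * H (x, v) := by
  have hm := hp.measurable.ennreal_ofReal
  rw [hp.law, lintegral_withDensity_eq_lintegral_mul _ hm hH,
    Measure.volume_eq_prod, lintegral_prod_symm _ (hm.mul hH).aemeasurable]
  exact lintegral_congr fun v => lintegral_congr fun x => rfl

/-- If the conditional laws of `X` given `(Y, Z)` and given `Z` have the same densities, then `X`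
and `Y` are conditionally independent given `Z`. -/
theorem eq_condProduct (hp : HasBoundedDensity p P C) (h : ∀ᵐ v : Rd dY × Rd dZ,
      margYZ p v.1 v.2 ≠ 0 → margZ p v.2 ≠ 0 ∧
      margZ p v.2 • volume.withDensity (fun x => ENNReal.ofReal (p x v.1 v.2)) =
      margYZ p v.1 v.2 • volume.withDensity (fun x => margXZ p x v.2)) :
    P = condProduct p := by
  have hm := hp.measurable.ennreal_ofReal
  have hc := (measurable_condDensity hp.measurable).ennreal_ofReal
  refine Measure.ext_of_lintegral _ fun f hf => ?_
  have hin : Measurable fun v : Rd dY × Rd dZ =>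
      ∫⁻ x, ENNReal.ofReal (condDensity p x v.2) * f (x, v) := by
    have hφ : Measurable fun q : (Rd dY × Rd dZ) × Rd dX => (q.2, q.1.2) :=
      measurable_snd.prodMk (measurable_snd.comp measurable_fst)
    have h1 : Measurable fun q : (Rd dY × Rd dZ) × Rd dX =>
        ENNReal.ofReal (condDensity p q.2 q.1.2) := by
      have := hc.comp hφ
      simpa only [Function.comp_def] using this
    have hψ : Measurable fun q : (Rd dY × Rd dZ) × Rd dX => (q.2, q.1) :=
      measurable_snd.prodMk measurable_fst
    have h2 : Measurable fun q : (Rd dY × Rd dZ) × Rd dX => f (q.2, q.1) := hf.comp hψ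
    have h3 : Measurable fun q : (Rd dY × Rd dZ) × Rd dX =>
        ENNReal.ofReal (condDensity p q.2 q.1.2) * f (q.2, q.1) := h1.mul h2
    exact h3.lintegral_prod_right'
  have e1 := hp.lintegral_condProduct hf
  generalize hJ : (fun v : Rd dY × Rd dZ =>
      ∫⁻ x, ENNReal.ofReal (condDensity p x v.2) * f (x, v)) = J at hin
  have hJ' : ∀ v, ∫⁻ x, ENNReal.ofReal (condDensity p x v.2) * f (x, v) = J v := fun v =>
    congrFun hJ v
  simp only [hJ', hp.lintegral_YZ hin] at e1
  rw [e1, hp.lintegral_eq_lintegral_lintegral hf]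
  refine lintegral_congr_ae (h.mono fun v hv => ?_)
  have hpv : Measurable fun x => ENNReal.ofReal (p x v.1 v.2) := hm.comp measurable_prodMk_right
  have hmv : Measurable fun x => margXZ p x v.2 :=
    (measurable_margXZ hp.measurable).comp measurable_prodMk_right
  have hcv : Measurable fun x => ENNReal.ofReal (condDensity p x v.2) := by
    have := hc.comp (measurable_prodMk_right (y := v.2))
    simpa only [Function.comp_def] using this
  have hfv : Measurable fun x => f (x, v) := hf.comp measurable_prodMk_right
  have hzc := hp.margZ_mul_condDensity v.2
  have hY : margYZ p v.1 v.2 = ∫⁻ x, ENNReal.ofReal (p x v.1 v.2) := rfl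
  have hZt : margZ p v.2 ≠ ∞ := ((hp.margZ_le v.2).trans_lt ENNReal.coe_lt_top).ne
  have hJv := hJ' v
  beta_reduce
  generalize margYZ p v.1 v.2 = y at hv hY ⊢
  generalize margZ p v.2 = z at hv hzc hZt
  have key := lintegral_mul_eq_of_smul_withDensity_eq hpv hmv hcv hfv hZt (fun h0 => hY.symm.trans h0)
    (fun h0 => (hv h0).1) (fun h0 => (hv h0).2) hzc
  rw [hJv] at key
  exact key

/-- Otherwise the countably many gap sets with centres in a dense sequence and radii `1 / (m + 1)`
are all null. Then at almost every `(y, z)` with positive density no ball separates the two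
conditional laws, and `P` equals `condProduct p`. -/
theorem exists_measure_gapSet_ne_zero [Nontrivial (Rd dX)] (hp : HasBoundedDensity p P C)
    (ham : Measurable (Function.uncurry a))
    (ha : ∀ y z, margYZ p y z ≠ 0 → 0 < a y z) (hP : P ≠ condProduct p) :
    ∃ (q q' : Rd dX) (ρ η : ℝ), 0 < η ∧ P {w | w.2 ∈ gapSet p a (Metric.ball q ρ)
      (Metric.ball q' ρ) (Metric.closedBall q (dist q q' - 3 * ρ))
      (Metric.closedBall q (dist q q' + 3 * ρ)) η} ≠ 0 := by
  by_contra! hcon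
  refine hP (hp.eq_condProduct ?_)
  have hnull : ∀ S : Set (Rd dY × Rd dZ), MeasurableSet S → P {w | w.2 ∈ S} = 0 →
      ∀ᵐ v : Rd dY × Rd dZ, margYZ p v.1 v.2 ≠ 0 → v ∉ S := by
    intro S hS h0
    have h1 : ∀ᵐ v ∂P.map Prod.snd, v ∉ S := by
      rw [ae_iff]
      simp only [not_not]
      exact (Measure.map_apply measurable_snd hS).trans h0
    rwa [hp.map_snd, ae_withDensity_iff (measurable_margYZ hp.measurable)] at h1
  have hη : ∀ m : ℕ, (0 : ℝ) < 1 / ((m : ℝ) + 1) := fun m => by positivity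
  have h1 : ∀ᵐ v : Rd dY × Rd dZ, ∀ k l m m' : ℕ, margYZ p v.1 v.2 ≠ 0 → v ∉ gapSet p a
      (Metric.ball (TopologicalSpace.denseSeq (Rd dX) k) (1 / ((m : ℝ) + 1)))
      (Metric.ball (TopologicalSpace.denseSeq (Rd dX) l) (1 / ((m : ℝ) + 1)))
      (Metric.closedBall (TopologicalSpace.denseSeq (Rd dX) k)
        (dist (TopologicalSpace.denseSeq (Rd dX) k) (TopologicalSpace.denseSeq (Rd dX) l) -
          3 * (1 / ((m : ℝ) + 1))))
      (Metric.closedBall (TopologicalSpace.denseSeq (Rd dX) k)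
        (dist (TopologicalSpace.denseSeq (Rd dX) k) (TopologicalSpace.denseSeq (Rd dX) l) +
          3 * (1 / ((m : ℝ) + 1)))) (1 / ((m' : ℝ) + 1)) := by
    simp only [ae_all_iff (ι := ℕ)]
    exact fun k l m m' => hnull _ (hp.measurableSet_gapSet ham _ _ _ _ _) (hcon _ _ _ _ (hη m'))
  have h2 := hnull {v | sectionZ p Set.univ v.2 ≤ 0} (measurableSet_le
    ((hp.measurable_sectionZ _).comp measurable_snd) measurable_const)
    hp.measure_sectionZ_univ_le_zero
  filter_upwards [h1, h2] with v hv1 hv2 hY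
  have hZ : margZ p v.2 ≠ 0 := by
    intro h0
    refine hv2 hY (le_of_eq ?_)
    rw [sectionZ, Measure.restrict_univ]
    exact (congrArg ENNReal.toReal h0).trans ENNReal.toReal_zero
  refine ⟨hZ, ?_⟩
  by_contra hne
  obtain ⟨k, l, m, m', hmem⟩ := hp.exists_mem_gapSet (a := a) (ha _ _ hY) hY hZ hne
  exact hv1 k l m m' hY hmem

end HasBoundedDensity

end Gap

/-! ### The statistic under conditional dependence -/

section LowerBound

variable {dX dY dZ : ℕ} {p : Rd dX → Rd dY → Rd dZ → ℝ}
  {P : Measure (Rd dX × Rd dY × Rd dZ)} {C : ℝ≥0} {a : Rd dY → Rd dZ → ℝ} {K₁ K₂ : ℝ → ℝ}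

theorem measurable_ballSum {S E : Type*} [MeasurableSpace S] [PseudoMetricSpace E]
    [SecondCountableTopology E] [MeasurableSpace E] [OpensMeasurableSpace E] {n : ℕ}
    {x : S → Fin n → E} {w v : S → Fin n → ℝ} (hx : ∀ i, Measurable fun t => x t i)
    (hw : ∀ i, Measurable fun t => w t i) (hv : ∀ i, Measurable fun t => v t i) :
    Measurable fun t => ballSum (x t) (w t) (v t) := by
  have hI : ∀ a b i, Measurable fun t => ballIndicator (x t) a b i := fun a b i =>
    Measurable.ite (measurableSet_le ((hx i).dist (hx b)) ((hx a).dist (hx b))) measurable_const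
      measurable_const
  have hD : ∀ a b, Measurable fun t => ballDiff (x t) (w t) (v t) a b := fun a b =>
    Finset.measurable_sum _ fun i _ => ((hw i).sub (hv i)).mul (hI a b i)
  exact Finset.measurable_sum _ fun a _ => Finset.measurable_sum _ fun b _ =>
    (((hw a).mul (hw b)).add ((hv a).mul (hv b))).mul ((hD a b).pow_const 2)

theorem measurable_cbdEstimate {n : ℕ} (hK₁ : KernelAssumption (dY + dZ) K₁)
    (hK₂ : KernelAssumption dZ K₂) {h₁ h₂ : ℝ} (hh₁ : 0 < h₁) (hh₂ : 0 < h₂)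
    (ha : Measurable (Function.uncurry a)) :
    Measurable fun D : Sample dX dY dZ n => cbdEstimate K₁ K₂ h₁ h₂ a D := by
  simp only [cbdEstimate_eq hK₁.nonneg hK₂.nonneg hh₁ hh₂]
  have hD : ∀ i : Fin n, Measurable fun D : Sample dX dY dZ n => D i := fun i =>
    measurable_pi_apply i
  have hk₁ : ∀ s i : Fin n, Measurable fun D : Sample dX dY dZ n =>
      kernelYZ K₁ h₁ ((D s).2 - (D i).2) := fun s i =>
    (measurable_kernelYZ hK₁.measurable).comp ((hD s).snd.sub (hD i).snd)
  have hk₂ : ∀ s i : Fin n, Measurable fun D : Sample dX dY dZ n =>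
      kernelZ K₂ h₂ ((D s).2.2 - (D i).2.2) := fun s i =>
    (measurable_kernelZ hK₂.measurable).comp ((hD s).snd.snd.sub (hD i).snd.snd)
  refine (Finset.measurable_sum _ fun s _ => ?_).const_mul _
  refine (measurable_ballSum (fun i => (hD i).fst) (fun i => ?_) (fun i => ?_)).mul
    (ha.comp (hD s).snd)
  · exact (hk₁ s i).div (Finset.measurable_sum _ fun k _ => hk₁ s k)
  · exact (hk₂ s i).div (Finset.measurable_sum _ fun k _ => hk₂ s k)

namespace HasBoundedDensity

theorem sectionYZ_le (hp : HasBoundedDensity p P C) (A : Set (Rd dX)) (v : Rd dY × Rd dZ) :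
    sectionYZ p A v ≤ C :=
  ENNReal.toReal_le_coe_of_le_coe ((setLIntegral_le_lintegral _ _).trans (hp.margYZ_le v.1 v.2))

theorem sectionZ_le (hp : HasBoundedDensity p P C) (A : Set (Rd dX)) (z : Rd dZ) :
    sectionZ p A z ≤ C :=
  ENNReal.toReal_le_coe_of_le_coe ((setLIntegral_le_lintegral _ _).trans (hp.margZ_le z))

/-- If `X` and `Y` are not conditionally independent given `Z`, then the estimate of the conditional
ball divergence is bounded away from zero with high probability. -/
theorem exists_eventually_measure_cbdEstimate_lt_le [IsProbabilityMeasure P]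
    [Nontrivial (Rd dX)] (hp : HasBoundedDensity p P C)
    (hK₁ : KernelAssumption (dY + dZ) K₁) (hK₂ : KernelAssumption dZ K₂) {h₁ h₂ : ℕ → ℝ}
    (hh : BandwidthAssumption (dY + dZ) dZ h₁ h₂) (ha : WeightAssumption p a)
    (hP : P ≠ condProduct p) :
    ∃ c : ℝ, 0 < c ∧ ∀ ε : ℝ≥0∞, 0 < ε → ∀ᶠ n in atTop, Measure.pi (fun _ : Fin n => P)
      {D | cbdEstimate K₁ K₂ (h₁ n) (h₂ n) a D < c} ≤ ε := by
  have hlim₁ := tendsto_zero_of_bandwidth hh.pos₁ hh.large₁ hh.small₁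
  have hlim₂ := tendsto_zero_of_bandwidth hh.pos₂ hh.large₂ hh.small₂
  obtain ⟨q, q', ρ, η, hη, hG0⟩ := hp.exists_measure_gapSet_ne_zero ha.measurable ha.pos hP
  have hdist : ∀ u ∈ Metric.ball q ρ, ∀ u' ∈ Metric.ball q' ρ,
      dist q q' ≤ dist u' u + 2 * ρ ∧ dist u' u ≤ dist q q' + 2 * ρ := by
    intro u hu u' hu'
    rw [Metric.mem_ball] at hu hu'
    have h1 := dist_triangle4 q u u' q'
    have h2 := dist_triangle4 u' q' q u
    rw [dist_comm q u, dist_comm u u'] at h1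
    rw [dist_comm q' q, dist_comm q u] at h2
    constructor <;> linarith
  have hI : ∀ u ∈ Metric.ball q ρ, ∀ u' ∈ Metric.ball q' ρ,
      Metric.closedBall q (dist q q' - 3 * ρ) ⊆ Metric.closedBall u (dist u' u) := by
    intro u hu u' hu'
    refine Metric.closedBall_subset_closedBall' ?_
    rw [dist_comm q u]
    linarith [(hdist u hu u' hu').1, Metric.mem_ball.1 hu]
  have hO : ∀ u ∈ Metric.ball q ρ, ∀ u' ∈ Metric.ball q' ρ,
      Metric.closedBall u (dist u' u) ⊆ Metric.closedBall q (dist q q' + 3 * ρ) := by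
    intro u hu u' hu'
    refine Metric.closedBall_subset_closedBall' ?_
    linarith [(hdist u hu u' hu').2, Metric.mem_ball.1 hu]
  have hUm : MeasurableSet (Metric.ball q ρ) := Metric.isOpen_ball.measurableSet
  have hVm : MeasurableSet (Metric.ball q' ρ) := Metric.isOpen_ball.measurableSet
  have hIm : MeasurableSet (Metric.closedBall q (dist q q' - 3 * ρ)) :=
    Metric.isClosed_closedBall.measurableSet
  have hOm : MeasurableSet (Metric.closedBall q (dist q q' + 3 * ρ)) :=
    Metric.isClosed_closedBall.measurableSet
  -- From here on the balls matter only through the inclusions `hI`, `hO` and their measurability.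
  generalize Metric.ball q ρ = U at *
  generalize Metric.ball q' ρ = V at *
  generalize Metric.closedBall q (dist q q' - 3 * ρ) = I at *
  generalize Metric.closedBall q (dist q q' + 3 * ρ) = O at *
  have hGm : MeasurableSet {w : Rd dX × Rd dY × Rd dZ | w.2 ∈ gapSet p a U V I O η} :=
    measurable_snd (hp.measurableSet_gapSet ha.measurable U V I O η)
  -- The accuracy of the density estimates at which the gap `η` of cross products is still at least
  -- `η / 2`.
  set δ : ℝ := min 1 (η / (4 * (2 * C + 1))) with hδdef
  have hC : (0 : ℝ) ≤ C := C.2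
  have hδ : 0 < δ := lt_min one_pos (by positivity)
  have hδη : δ * (4 * (2 * (C : ℝ) + 1)) ≤ η := by
    rw [← le_div_iff₀ (by positivity)]
    exact min_le_right _ _
  obtain ⟨A, hA⟩ : ∃ A : Fin 5 → Set (Rd dX), A = ![Set.univ, U, V, I, O] := ⟨_, rfl⟩
  have hAm : ∀ j, MeasurableSet (A j) := by
    intro j
    fin_cases j <;> simp [hA, hUm, hVm, hIm, hOm]
  have hAmem : ∀ B ∈ ({Set.univ, U, V, I, O} : Set (Set (Rd dX))), ∃ j, A j = B := by
    rintro B (rfl | rfl | rfl | rfl | rfl)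
    exacts [⟨0, by simp [hA]⟩, ⟨1, by simp [hA]⟩, ⟨2, by simp [hA]⟩, ⟨3, by simp [hA]⟩,
      ⟨4, by simp [hA]⟩]
  have hmY : ∀ (n : ℕ) (s : Fin n) (j : Fin 5), MeasurableSet
      {D : Sample dX dY dZ n | δ ≤ |kernelSumYZ K₁ (h₁ n) (A j) D s - sectionYZ p (A j) (D s).2|} :=
    fun n s j => measurableSet_le measurable_const (continuous_abs.measurable.comp
      ((measurable_kernelAverage measurable_snd (measurable_kernelYZ hK₁.measurable)
        ((measurable_one.indicator (hAm j)).comp measurable_fst) s).sub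
        ((hp.measurable_sectionYZ (A j)).comp (measurable_pi_apply s).snd)))
  have hmZ : ∀ (n : ℕ) (s : Fin n) (j : Fin 5), MeasurableSet
      {D : Sample dX dY dZ n | δ ≤ |kernelSumZ K₂ (h₂ n) (A j) D s - sectionZ p (A j) (D s).2.2|} :=
    fun n s j => measurableSet_le measurable_const (continuous_abs.measurable.comp
      ((measurable_kernelAverage measurable_snd.snd (measurable_kernelZ hK₂.measurable)
        ((measurable_one.indicator (hAm j)).comp measurable_fst) s).sub
        ((hp.measurable_sectionZ (A j)).comp (measurable_pi_apply s).snd.snd)))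
  refine exists_eventually_measure_lt_le_of_average P hGm hG0
    (bad := fun n s => ⋃ j : Fin 5,
      {D | δ ≤ |kernelSumYZ K₁ (h₁ n) (A j) D s - sectionYZ p (A j) (D s).2|} ∪
      {D | δ ≤ |kernelSumZ K₂ (h₂ n) (A j) D s - sectionZ p (A j) (D s).2.2|})
    (fun n s => MeasurableSet.iUnion fun j => (hmY n s j).union (hmZ n s j)) ?_
    (β := (η / 2 / (C + 1)) * (η / 2 / (C + 1)) * (η / 2 / (C + 1) ^ 2) ^ 2 * η) (by positivity)
    (fun n D => cbdEstimate_eq hK₁.nonneg hK₂.nonneg (hh.pos₁ n) (hh.pos₂ n) D)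
    (fun n D s => mul_nonneg (ballSum_nonneg (weightYZ_nonneg hK₁.nonneg (hh.pos₁ n) D s)
      (weightZ_nonneg hK₂.nonneg (hh.pos₂ n) D s) _) (ha.nonneg _ _)) ?_
  · intro ε hε
    -- Ten estimates have to be accurate: five sets, each for `(Y, Z)` and for `Z`.
    have hε' : 0 < ε / 10 := ENNReal.div_pos hε.ne' (by norm_num)
    filter_upwards [eventually_all.2 fun j => hp.eventually_measure_kernelSumYZ_le hK₁ hh.pos₁ hlim₁
      hh.large₁ (hAm j) hδ hε', eventually_all.2 fun j => hp.eventually_measure_kernelSumZ_le hK₂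
      hh.pos₂ hlim₂ hh.large₂ (hAm j) hδ hε'] with n h1 h2 s
    refine (measure_iUnion_fintype_le _ _).trans ((Finset.sum_le_sum fun j _ =>
      (measure_union_le _ _).trans (add_le_add (h1 j s) (h2 j s))).trans (le_of_eq ?_))
    rw [Finset.sum_const, Finset.card_univ, Fintype.card_fin, nsmul_eq_mul, ← two_mul, ← mul_assoc]
    norm_num
    exact ENNReal.mul_div_cancel (by norm_num) (by norm_num)
  · rintro n D s ⟨h1, h2, h3, h4, h5, h6⟩ hbad
    simp only [Set.mem_iUnion, Set.mem_union, Set.mem_ofPred_eq, not_exists, not_or, not_le] at hbad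
    refine mul_le_mul (le_ballSum_of_kernelSum hK₁.nonneg hK₂.nonneg (hh.pos₁ n) (hh.pos₂ n) hI hO
      hη hδ.le (min_le_left _ _) hδη (f := fun B => sectionYZ p B (D s).2)
      (g := fun B => sectionZ p B (D s).2.2)
      (fun B => ⟨sectionYZ_nonneg _ _, hp.sectionYZ_le _ _⟩)
      (fun B => ⟨sectionZ_nonneg _ _, hp.sectionZ_le _ _⟩) (fun B hB => ?_) (fun B hB => ?_)
      h2.le h3.le h4.le h5.le (h6.imp le_of_lt le_of_lt)) h1.le hη.le
      (ballSum_nonneg (weightYZ_nonneg hK₁.nonneg (hh.pos₁ n) D s)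
        (weightZ_nonneg hK₂.nonneg (hh.pos₂ n) D s) _)
    · obtain ⟨j, rfl⟩ := hAmem B hB
      exact (hbad j).1.le
    · obtain ⟨j, rfl⟩ := hAmem B hB
      exact (hbad j).2.le

end HasBoundedDensity

end LowerBound

/-! ### The test based on a random permutation -/

section Draw

/-- The coordinate `j` has law `q`, and each of the other factors sums to at most one. It is an
inequality since `q` may have total mass zero, when all likelihoods vanish. -/
theorem sum_prod_mul_le {ι : Type*} [Fintype ι] {M : ℕ} {q : ι → ℝ≥0∞} (hq : ∑ x, q x ≤ 1)
    (g : ι → ℝ≥0∞) (j : Fin M) :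
    ∑ σ : Fin M → ι, (∏ i, q (σ i)) * g (σ j) ≤ ∑ x, q x * g x := by
  classical
  have h1 : ∀ σ : Fin M → ι, (∏ i, q (σ i)) * g (σ j) =
      ∏ i, q (σ i) * (if i = j then g (σ i) else 1) := by
    intro σ
    rw [Finset.prod_mul_distrib, Finset.prod_ite_eq' Finset.univ j fun i => g (σ i),
      if_pos (Finset.mem_univ j)]
  have h2 := Finset.prod_univ_sum (fun _ : Fin M => (Finset.univ : Finset ι))
    (fun i x => q x * (if i = j then g x else 1))
  rw [Fintype.piFinset_univ] at h2
  simp only [h1]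
  rw [← h2, ← Finset.mul_prod_erase _ _ (Finset.mem_univ j)]
  simp only [if_true]
  refine mul_le_of_le_one_right' (Finset.prod_le_one' fun i hi => ?_)
  simpa only [if_neg (Finset.ne_of_mem_erase hi), mul_one] using hq

variable {dX dY dZ : ℕ} {p : Rd dX → Rd dY → Rd dZ → ℝ}
  {P : Measure (Rd dX × Rd dY × Rd dZ)} [IsProbabilityMeasure P]
  {Ω : Type*} [MeasurableSpace Ω] {μ : Measure Ω}
  {W : ℕ → Ω → Rd dX × Rd dY × Rd dZ} {M : ℕ} {π : (n : ℕ) → Fin M → Ω → Equiv.Perm (Fin n)}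

theorem measurable_firstObs (hW : ∀ i, Measurable (W i)) (n : ℕ) : Measurable (firstObs W n) :=
  measurable_pi_lambda _ fun i => hW i

namespace IsCPTDraw

theorem measurableSet_forall (hπ : IsCPTDraw μ p W M π) (n : ℕ)
    (σ : Fin M → Equiv.Perm (Fin n)) : MeasurableSet {ω | ∀ j, π n j ω = σ j} := by
  have : {ω | ∀ j, π n j ω = σ j} = ⋂ j, {ω | π n j ω = σ j} := by ext; simp
  rw [this]
  exact MeasurableSet.iInter fun j => hπ.measurable n j (σ j)

/-- The permutations take finitely many values, and fixing them leaves an event of the data alone,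
to which the conditional law applies. -/
theorem _root_.setOf_firstObs_eq_iUnion {n : ℕ} (A : (Fin M → Equiv.Perm (Fin n)) → Set (Sample dX dY dZ n)) :
    {ω | firstObs W n ω ∈ A fun j => π n j ω} =
      ⋃ σ, (firstObs W n ⁻¹' A σ ∩ {ω | ∀ j, π n j ω = σ j}) := by
  ext ω
  simp only [Set.mem_iUnion, Set.mem_inter_iff, Set.mem_preimage, Set.mem_ofPred_eq]
  refine ⟨fun h => ⟨_, h, fun _ => rfl⟩, fun ⟨σ, h, hσ⟩ => ?_⟩
  rwa [show (fun j => π n j ω) = σ from funext hσ]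

theorem measurableSet_setOf (hπ : IsCPTDraw μ p W M π) (hW : ∀ i, Measurable (W i)) {n : ℕ}
    {A : (Fin M → Equiv.Perm (Fin n)) → Set (Sample dX dY dZ n)} (hA : ∀ σ, MeasurableSet (A σ)) :
    MeasurableSet {ω | firstObs W n ω ∈ A fun j => π n j ω} := by
  rw [setOf_firstObs_eq_iUnion]
  exact MeasurableSet.iUnion fun σ =>
    (measurable_firstObs hW n (hA σ)).inter (hπ.measurableSet_forall n σ)

end IsCPTDraw

variable [IsProbabilityMeasure μ]

theorem map_firstObs (hW : ∀ i, Measurable (W i)) (hWi : iIndepFun W μ)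
    (hWP : ∀ i, μ.map (W i) = P) (n : ℕ) :
    μ.map (firstObs W n) = Measure.pi fun _ : Fin n => P := by
  have h1 : iIndepFun (fun i : Fin n => W i) μ := hWi.precomp Fin.val_injective
  have h2 := (iIndepFun_iff_map_fun_eq_pi_map (f := fun i : Fin n => W i)
    fun i => (hW i).aemeasurable).1 h1
  simp only [hWP] at h2
  exact h2

namespace IsCPTDraw

/-- The defining property of conditional expectation: the conditional probability of the
permutations is integrated over an event of the data. -/
theorem measure_inter (hπ : IsCPTDraw μ p W M π) (hW : ∀ i, Measurable (W i))
    (hWi : iIndepFun W μ) (hWP : ∀ i, μ.map (W i) = P)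
    (hp : Measurable fun w : Rd dX × Rd dY × Rd dZ => p w.1 w.2.1 w.2.2) {n : ℕ}
    (σ : Fin M → Equiv.Perm (Fin n)) {B : Set (Sample dX dY dZ n)} (hB : MeasurableSet B) :
    μ (firstObs W n ⁻¹' B ∩ {ω | ∀ j, π n j ω = σ j}) =
      ∫⁻ D in B, ∏ j, ENNReal.ofReal (cptProb p D (σ j)) ∂Measure.pi (fun _ : Fin n => P) := by
  have hm := measurable_firstObs hW n
  have hle := hm.comap_le
  have hE := hπ.measurableSet_forall n σ
  have hS : MeasurableSet (firstObs W n ⁻¹' B) := hm hB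
  have hint : Integrable ({ω | ∀ j, π n j ω = σ j}.indicator fun _ => (1 : ℝ)) μ :=
    (integrable_const 1).indicator hE
  have h1 := setIntegral_condExp hle hint (s := firstObs W n ⁻¹' B) ⟨B, hB, rfl⟩
  have hc := hπ.cond_law n σ
  rw [setIntegral_congr_ae (g := fun ω => ∏ j, cptProb p (firstObs W n ω) (σ j)) hS
    (hc.mono fun ω h _ => h), setIntegral_indicator hE, setIntegral_const, smul_eq_mul, mul_one] at h1
  have hint' : Integrable (fun ω => ∏ j, cptProb p (firstObs W n ω) (σ j)) μ :=
    integrable_condExp.congr hc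
  rw [← ofReal_measureReal (measure_ne_top _ _), ← h1,
    ofReal_integral_eq_lintegral_ofReal hint'.integrableOn (Eventually.of_forall fun ω =>
      Finset.prod_nonneg fun j _ => cptProb_nonneg _ _), ← map_firstObs hW hWi hWP n,
    setLIntegral_map hB (Finset.measurable_prod _ fun j _ =>
      (measurable_cptProb hp (σ j)).ennreal_ofReal) hm]
  exact lintegral_congr fun ω => ENNReal.ofReal_prod_of_nonneg fun j _ => cptProb_nonneg _ _

theorem measure_setOf_le (hπ : IsCPTDraw μ p W M π) (hW : ∀ i, Measurable (W i))
    (hWi : iIndepFun W μ) (hWP : ∀ i, μ.map (W i) = P)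
    (hp : Measurable fun w : Rd dX × Rd dY × Rd dZ => p w.1 w.2.1 w.2.2) {n : ℕ}
    {A : (Fin M → Equiv.Perm (Fin n)) → Set (Sample dX dY dZ n)} (hA : ∀ σ, MeasurableSet (A σ)) :
    μ {ω | firstObs W n ω ∈ A fun j => π n j ω} ≤
      ∫⁻ D, ∑ σ, (∏ j, ENNReal.ofReal (cptProb p D (σ j))) * (A σ).indicator 1 D
        ∂Measure.pi (fun _ : Fin n => P) := by
  have hq : ∀ σ : Fin M → Equiv.Perm (Fin n), Measurable fun D : Sample dX dY dZ n =>
      ∏ j, ENNReal.ofReal (cptProb p D (σ j)) := fun σ =>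
    Finset.measurable_prod _ fun j _ => (measurable_cptProb hp (σ j)).ennreal_ofReal
  have hi : ∀ σ : Fin M → Equiv.Perm (Fin n), Measurable fun D : Sample dX dY dZ n =>
      (A σ).indicator (1 : Sample dX dY dZ n → ℝ≥0∞) D := fun σ => measurable_one.indicator (hA σ)
  have hqi : ∀ σ : Fin M → Equiv.Perm (Fin n), Measurable fun D : Sample dX dY dZ n =>
      (∏ j, ENNReal.ofReal (cptProb p D (σ j))) * (A σ).indicator (1 : Sample dX dY dZ n → ℝ≥0∞) D :=
    fun σ => (hq σ).mul (hi σ)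
  rw [setOf_firstObs_eq_iUnion, lintegral_finsetSum _ fun σ _ => hqi σ]
  refine (measure_iUnion_fintype_le _ _).trans (Finset.sum_le_sum fun σ _ => ?_)
  rw [hπ.measure_inter hW hWi hWP hp σ (hA σ), ← lintegral_indicator (hA σ)]
  refine le_of_eq (lintegral_congr fun D => ?_)
  by_cases hD : D ∈ A σ <;> simp [hD]

/-- The probability that the statistic of a permuted data set is large. -/
theorem measure_exists_le (hπ : IsCPTDraw μ p W M π) (hW : ∀ i, Measurable (W i))
    (hWi : iIndepFun W μ) (hWP : ∀ i, μ.map (W i) = P)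
    (hp : Measurable fun w : Rd dX × Rd dY × Rd dZ => p w.1 w.2.1 w.2.2) {n : ℕ}
    {T : Sample dX dY dZ n → ℝ} (hT : Measurable T) {c : ℝ} (hc : 0 < c) :
    μ {ω | ∃ j, c ≤ T (permuteX (π n j ω) (firstObs W n ω))} ≤
      M * ((ENNReal.ofReal c)⁻¹ * ∫⁻ D, ∑ τ, ENNReal.ofReal (cptProb p D τ) *
        ENNReal.ofReal (T (permuteX τ D)) ∂Measure.pi (fun _ : Fin n => P)) := by
  have hc0 : ENNReal.ofReal c ≠ 0 := (ENNReal.ofReal_pos.2 hc).ne'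
  have hB : ∀ τ : Equiv.Perm (Fin n), MeasurableSet {D | c ≤ T (permuteX τ D)} := fun τ =>
    measurableSet_le measurable_const (hT.comp (measurable_permuteX τ))
  have hm : Measurable fun D : Sample dX dY dZ n => ∑ τ, ENNReal.ofReal (cptProb p D τ) *
        ENNReal.ofReal (T (permuteX τ D)) := Finset.measurable_sum _ fun τ _ =>
    (measurable_cptProb hp τ).ennreal_ofReal.mul (hT.comp (measurable_permuteX τ)).ennreal_ofReal
  have key : ∀ j : Fin M, μ {ω | c ≤ T (permuteX (π n j ω) (firstObs W n ω))} ≤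
      (ENNReal.ofReal c)⁻¹ * ∫⁻ D, ∑ τ, ENNReal.ofReal (cptProb p D τ) *
        ENNReal.ofReal (T (permuteX τ D)) ∂Measure.pi (fun _ : Fin n => P) := by
    intro j
    refine (hπ.measure_setOf_le hW hWi hWP hp (A := fun σ => {D | c ≤ T (permuteX (σ j) D)})
      fun σ => hB (σ j)).trans ?_
    rw [← lintegral_const_mul _ hm]
    refine lintegral_mono fun D => ?_
    have hsum : ∑ τ, ENNReal.ofReal (cptProb p D τ) ≤ 1 := by
      rw [← ENNReal.ofReal_sum_of_nonneg fun τ _ => cptProb_nonneg D τ]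
      exact ENNReal.ofReal_le_one.2 (sum_cptProb_le_one D)
    refine (sum_prod_mul_le hsum
      (fun τ => {D | c ≤ T (permuteX τ D)}.indicator (1 : Sample dX dY dZ n → ℝ≥0∞) D) j).trans ?_
    rw [Finset.mul_sum]
    refine Finset.sum_le_sum fun τ _ => ?_
    rw [mul_left_comm]
    refine mul_le_mul_right ?_ _
    -- Markov's inequality under the permutation law.
    by_cases hD : c ≤ T (permuteX τ D)
    · rw [Set.indicator_of_mem (show D ∈ {D | c ≤ T (permuteX τ D)} from hD), Pi.one_apply,
        ← ENNReal.inv_mul_cancel hc0 ENNReal.ofReal_ne_top]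
      exact mul_le_mul_right (ENNReal.ofReal_le_ofReal hD) _
    · rw [Set.indicator_of_notMem (show D ∉ {D | c ≤ T (permuteX τ D)} from hD)]
      exact zero_le
  have hU : {ω | ∃ j, c ≤ T (permuteX (π n j ω) (firstObs W n ω))} =
      ⋃ j, {ω | c ≤ T (permuteX (π n j ω) (firstObs W n ω))} := by ext; simp
  rw [hU]
  refine (measure_iUnion_fintype_le _ _).trans ((Finset.sum_le_sum fun j _ => key j).trans
    (le_of_eq ?_))
  rw [Finset.sum_const, Finset.card_univ, Fintype.card_fin, nsmul_eq_mul]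

end IsCPTDraw

/-- The test rejects if the statistic of the data exceeds those of all permuted data sets. -/
theorem cptPValue_lt_of_lt {n : ℕ} {T : Sample dX dY dZ n → ℝ} {D : Sample dX dY dZ n}
    {σ : Fin M → Equiv.Perm (Fin n)} {α : ℝ} (hα : 0 < α) (hM : (1 - α) / α < M)
    (h : ∀ j, T (permuteX (σ j) D) < T D) : cptPValue T D σ < α := by
  have hM' : (0 : ℝ) < 1 + M := by positivity
  -- No permuted statistic reaches the observed one, so the p-value is `1 / (1 + M)`.
  rw [cptPValue, Finset.sum_eq_zero fun j _ => if_neg (not_le.2 (h j)), div_lt_iff₀ hM']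
  rw [div_lt_iff₀ hα] at hM
  linarith

end Draw

end

theorem mainTheorem8 {dX dY dZ : ℕ} (hdX : 0 < dX) (hdY : 0 < dY) (hdZ : 0 < dZ)
    (p : Rd dX → Rd dY → Rd dZ → ℝ)
    (hp_meas : Measurable (fun w : Rd dX × Rd dY × Rd dZ => p w.1 w.2.1 w.2.2))
    (hp_nonneg : ∀ x y z, 0 ≤ p x y z)
    (P : Measure (Rd dX × Rd dY × Rd dZ)) [IsProbabilityMeasure P]
    (hP : P = volume.withDensity (fun w => ENNReal.ofReal (p w.1 w.2.1 w.2.2)))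
    (hA1 : DensityAssumption p)
    (K₁ K₂ : ℝ → ℝ) (hK₁ : KernelAssumption (dY + dZ) K₁) (hK₂ : KernelAssumption dZ K₂)
    (h₁ h₂ : ℕ → ℝ) (hA3 : BandwidthAssumption (dY + dZ) dZ h₁ h₂)
    (a : Rd dY → Rd dZ → ℝ) (ha : WeightAssumption p a)
    (α : ℝ) (hα₀ : 0 < α) (hα₁ : α < 1) (M : ℕ)
    {Ω : Type*} [MeasurableSpace Ω] (μ : Measure Ω) [IsProbabilityMeasure μ]
    (W : ℕ → Ω → Rd dX × Rd dY × Rd dZ) (hW_meas : ∀ i, Measurable (W i))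
    (hW_indep : iIndepFun W μ) (hW_law : ∀ i, μ.map (W i) = P)
    (π : (n : ℕ) → Fin M → Ω → Equiv.Perm (Fin n)) (hπ : IsCPTDraw μ p W M π) :
    (CondIndepXYgivenZ P → ∀ n : ℕ, μ.real (cptRejects K₁ K₂ h₁ h₂ a α W π n) ≤ α) ∧
    (¬ CondIndepXYgivenZ P → (1 - α) / α < (M : ℝ) →
      Tendsto (fun n : ℕ => μ.real (cptRejects K₁ K₂ h₁ h₂ a α W π n)) atTop (𝓝 1)) := by
  obtain ⟨C, hC, -, hXZ, hYZ, -, -, hZ⟩ := hA1.bounded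
  have hp : HasBoundedDensity p P C := ⟨hp_meas, hp_nonneg, hP, hC, hXZ, hYZ, hZ⟩
  have hT : ∀ n, Measurable fun D : Sample dX dY dZ n => cbdEstimate K₁ K₂ (h₁ n) (h₂ n) a D :=
    fun n => measurable_cbdEstimate hK₁ hK₂ (hA3.pos₁ n) (hA3.pos₂ n) ha.measurable
  have hA := fun n σ => measurableSet_cptPValue_lt (M := M) (hT n) σ α
  refine ⟨fun hind n => ENNReal.toReal_le_of_le_ofReal hα₀.le ?_, fun hdep hM => ?_⟩
  · have hcp := hp.condIndep_iff.1 hind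
    have hfin : IsFiniteMeasure
        (volume.withDensity fun v : Rd dY × Rd dZ => margYZ p v.1 v.2) := by
      rw [← hp.map_snd]
      infer_instance
    refine (hπ.measure_setOf_le hW_meas hW_indep hW_law hp_meas (hA n)).trans
      (le_trans (le_of_eq (lintegral_congr fun D => ?_))
        (lintegral_rejectProb_le hp_meas _ P hcp M hα₀.le (hT n)))
    rw [rejectProb, ENNReal.ofReal_sum_of_nonneg fun σ _ => mul_nonneg
      (Finset.prod_nonneg fun j _ => cptProb_nonneg _ _) (by split_ifs <;> norm_num)]
    refine Finset.sum_congr rfl fun σ _ => ?_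
    rw [ENNReal.ofReal_mul (Finset.prod_nonneg fun j _ => cptProb_nonneg _ _),
      ENNReal.ofReal_prod_of_nonneg fun j _ => cptProb_nonneg _ _]
    by_cases hD : cptPValue (cbdEstimate K₁ K₂ (h₁ n) (h₂ n) a) D σ < α <;> simp [hD]
  · have hne : Nonempty (Fin dX) := ⟨⟨0, hdX⟩⟩
    have hnt : Nontrivial (Rd dX) := inferInstance
    obtain ⟨c, hc, hlow⟩ := hp.exists_eventually_measure_cbdEstimate_lt_le hK₁ hK₂ hA3 ha
      fun h => hdep (hp.condIndep_iff.2 h)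
    have hms : ∀ n, MeasurableSet (cptRejects K₁ K₂ h₁ h₂ a α W π n) := fun n =>
      hπ.measurableSet_setOf hW_meas (hA n)
    have hlim : Tendsto (fun n => μ (cptRejects K₁ K₂ h₁ h₂ a α W π n)ᶜ) atTop (𝓝 0) := by
      refine ENNReal.tendsto_nhds_zero.2 fun ε hε => ?_
      have hε2 : 0 < ε / 2 := ENNReal.half_pos hε.ne'
      obtain ⟨e, he, hee⟩ := ENNReal.exists_nnreal_pos_mul_lt
        (show (M : ℝ≥0∞) * (ENNReal.ofReal c)⁻¹ ≠ ∞ from ENNReal.mul_ne_top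
          (ENNReal.natCast_ne_top M) (ENNReal.inv_ne_top.2 (ENNReal.ofReal_pos.2 hc).ne')) hε2.ne'
      filter_upwards [hlow (ε / 2) hε2, hp.eventually_lintegral_cbdEstimate_permuteX_le hK₁ hK₂ hA3
        ha.nonneg ha.bounded (ENNReal.coe_pos.2 he)] with n hn1 hn2
      -- If the observed statistic is at least `c` and all permuted ones are below `c`, the test
      -- rejects.
      have hsub : (cptRejects K₁ K₂ h₁ h₂ a α W π n)ᶜ ⊆
          firstObs W n ⁻¹' {D | cbdEstimate K₁ K₂ (h₁ n) (h₂ n) a D < c} ∪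
          {ω | ∃ j, c ≤ cbdEstimate K₁ K₂ (h₁ n) (h₂ n) a
            (permuteX (π n j ω) (firstObs W n ω))} := by
        intro ω hω
        by_contra hcon
        simp only [Set.mem_union, Set.mem_preimage, Set.mem_ofPred_eq, not_or, not_exists, not_lt,
          not_le] at hcon
        exact hω (cptPValue_lt_of_lt hα₀ hM fun j => (hcon.2 j).trans_le hcon.1)
      have h1 : μ (firstObs W n ⁻¹' {D | cbdEstimate K₁ K₂ (h₁ n) (h₂ n) a D < c}) ≤ ε / 2 := by
        rw [← Measure.map_apply (measurable_firstObs hW_meas n)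
          (measurableSet_lt (hT n) measurable_const), map_firstObs hW_meas hW_indep hW_law n]
        exact hn1
      have h2 := (hπ.measure_exists_le hW_meas hW_indep hW_law hp_meas (hT n) hc).trans
        (mul_le_mul_right (mul_le_mul_right hn2 _) _)
      rw [← mul_assoc, mul_comm _ (e : ℝ≥0∞)] at h2
      calc _ ≤ ε / 2 + ε / 2 := (measure_mono hsub).trans ((measure_union_le _ _).trans
            (add_le_add h1 (h2.trans hee.le)))
        _ = ε := ENNReal.add_halves ε
    have hreal : ∀ n, μ.real (cptRejects K₁ K₂ h₁ h₂ a α W π n) =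
        1 - μ.real (cptRejects K₁ K₂ h₁ h₂ a α W π n)ᶜ := fun n => by
      rw [probReal_compl_eq_one_sub (hms n), sub_sub_cancel]
    simp only [hreal]
    have := (ENNReal.tendsto_toReal ENNReal.zero_ne_top).comp hlim
    simpa only [Measure.real, ENNReal.toReal_zero, sub_zero, Function.comp_def] using
      (tendsto_const_nhds (x := (1 : ℝ))).sub this
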